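/- Let $\mathcal V$ be the category of finite-dimensional complex inner product spaces and all linear maps. A (unitary) exponential functor is a triple $(F,\tau,\iota)$ consisting of a functor $F\colon\mathcal V\to\mathcal V$ with $F(f^*)=F(f)^*$ for all $f$, unitary isomorphisms $\tau_{V,W}\colon F(V\oplus W)\to F(V)\otimes F(W)$ natural in $V$ and $W$, and a unitary $\iota\colon F(0)\to\mathbb C$, such that (up to the canonical associators) $(\mathrm{id}\otimes\tau_{W,X})\circ\tau_{V,W\oplus X}=(\tau_{V,W}\otimes\mathrm{id})\circ\tau_{V\oplus W,X}$, and such that $(\mathrm{id}\otimes\iota)\circ\tau_{V,0}$ and $(\iota\otimes\mathrm{id})\circ\tau_{0,V}$ are, up to $F(V)\otimes\mathbb C\cong F(V)\cong\mathbb C\otimes F(V)$, the maps induced by the canonical maps $V\oplus 0\to V$ and $0\oplus V\to V$. It is polynomial if $F(\lambda_1f_1+\dots+\lambda_kf_k)$ is a polynomial in $\lambda_1,\dots,\lambda_k\in\mathbb C$ with coefficients in $\mathrm{Hom}(F(V),F(W))$, for all linear maps $f_1,\dots,f_k\colon V\to W$. In that case let $F_n(V)\subseteq F(V)$ be the subspace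 on which $F(\lambda\,\mathrm{id}_V)$ is multiplication by $\lambda^n$ for all $\lambda\in\mathbb C$. Two polynomial exponential functors $F,G$ are monoidally isomorphic, $F\sim_\otimes G$, if there are unitaries $v(V)\colon F(V)\to G(V)$, natural in $V$, with $\tau^G_{V,W}\circ v(V\oplus W)=(v(V)\otimes v(W))\circ\tau^F_{V,W}$ for all $V,W$. A (unitary involutive) R-matrix on $W$ is a unitary $R$ on $W\otimes W$ with $R^2=\mathrm{id}$ and $(R\otimes\mathrm{id})(\mathrm{id}\otimes R)(R\otimes\mathrm{id})=(\mathrm{id}\otimes R)(R\otimes\mathrm{id})(\mathrm{id}\otimes R)$. For each $n\ge 0$ it defines a unitary representation $\rho_R^{(n)}$ of $S_n$ on $W^{\otimes n}$ (with $W^{\otimes 0}=\mathbb C$) that sends the transposition of $i$ and $i+1$ to $R$ acting on the $i$th and $(i+1)$st tensor factors. Two R-matrices $R$ on $W_R$ and $S$ on $W_S$ are strongly equivalent, $R\sim_\otimes S$, if there is a unitary $v_1\colon W_R\to W_S$ such that for every $n$ the unitary $v_1^{\otimes n}$ intertwines $\rho_R^{(n)}$ and $\rho_S^{(n)}$. The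 R-matrix of a polynomial exponential functor $F$ is the R-matrix on $W=F_1(\mathbb C)$ obtained by restricting to $W\otimes W\subseteq F(\mathbb C)\otimes F(\mathbb C)$ the unitary $\tau_{\mathbb C,\mathbb C}\circ F(s)\circ\tau_{\mathbb C,\mathbb C}^{-1}$, where $s$ interchanges the two summands of $\mathbb C\oplus\mathbb C$. Given an R-matrix $R$ on $W$, let $F^R(V)=\bigoplus_{n\ge 0}\big((W\otimes V)^{\otimes n}\big)^{S_n}$, where $S_n$ acts by $\rho^{(n)}_{R\boxtimes T}$; here $T$ is the interchange of the factors of $V\otimes V$, and $R\boxtimes T$ is $R\otimes T$ regarded as an R-matrix on $W\otimes V$. On morphisms, $F^R(f)$ is the restriction of $\bigoplus_n(\mathrm{id}_W\otimes f)^{\otimes n}$. A priori $F^R(V)$ may be infinite-dimensional. Let $\kappa_{V_1,V_2}\colon F^R(V_1)\otimes F^R(V_2)\to F^R(V_1\oplus V_2)$ be the linear map given, on the tensor product of the summands of degrees $i$ and $j$, by $$x\mapsto\binom{i+j}{i}^{-1/2}\sum_{\sigma\in S_{i+j}/(S_i\times S_j)}\sigma\cdot\iota_{i,j}(x),$$ where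 $\iota_{i,j}\colon(W\otimes V_1)^{\otimes i}\otimes(W\otimes V_2)^{\otimes j}\to(W\otimes(V_1\oplus V_2))^{\otimes(i+j)}$ is induced by the inclusions of $V_1$ and $V_2$ into $V_1\oplus V_2$, and the sum runs over coset representatives. Equip $F^R$ with $\tau_{V_1,V_2}=\kappa_{V_1,V_2}^{-1}$ and with the canonical map $\iota\colon F^R(0)\to\mathbb C$, the projection onto the summand $n=0$. **Lemma.** Let $F$ and $G$ be polynomial exponential functors with R-matrices $R$ and $S$. Then $$F\sim_\otimes G\iff R\sim_\otimes S.$$ In particular, $(F^R,\tau,\iota)$ is a polynomial exponential functor (so that all $F^R(V)$ are finite-dimensional and all $\kappa_{V_1,V_2}$ are bijective), and $F\sim_\otimes F^R$. -/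

import Mathlib

/-! ### Homomorphisms out of the symmetric groups -/

section Coxeter

open Equiv

/-- The product `s (k - 1) * ⋯ * s 1 * s 0`. -/
def coxCycle {G : Type*} [Group G] (s : ℕ → G) : ℕ → G
  | 0 => 1
  | k + 1 => s k * coxCycle s k

variable {G : Type*} [Group G]

theorem coxCycle_comm (s : ℕ → G) (n : ℕ)
    (comm : ∀ i j, i + 1 < j → j < n → s i * s j = s j * s i)
    (k i : ℕ) (hk : k < i) (hi : i < n) : s i * coxCycle s k = coxCycle s k * s i := by
  induction k with
  | zero => simp [coxCycle]
  | succ k ih =>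
    rw [coxCycle, ← mul_assoc, ← comm k i (by omega) hi, mul_assoc, ih (by omega), mul_assoc]

theorem coxCycle_braid (s : ℕ → G) (n : ℕ)
    (comm : ∀ i j, i + 1 < j → j < n → s i * s j = s j * s i)
    (braid : ∀ i, i + 1 < n → s i * s (i + 1) * s i = s (i + 1) * s i * s (i + 1))
    (i m : ℕ) (h : i + m + 1 < n) :
    s i * coxCycle s (i + 2 + m) = coxCycle s (i + 2 + m) * s (i + 1) := by
  induction m with
  | zero =>
    have h1 := coxCycle_comm s n comm i (i + 1) (by omega) (by omega)
    have h2 := braid i (by omega)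
    calc s i * (s (i + 1) * (s i * coxCycle s i))
        = (s i * s (i + 1) * s i) * coxCycle s i := by group
      _ = s (i + 1) * s i * (s (i + 1) * coxCycle s i) := by rw [h2]; group
      _ = _ := by rw [h1]; simp only [coxCycle]; group
  | succ m ih =>
    have h1 := comm i (i + 2 + m) (by omega) (by omega)
    change s i * (s (i + 2 + m) * coxCycle s (i + 2 + m)) =
      (s (i + 2 + m) * coxCycle s (i + 2 + m)) * s (i + 1)
    rw [← mul_assoc, h1, mul_assoc, ih (by omega), mul_assoc]

/-- Elements that satisfy the Coxeter relations define a homomorphism out of a symmetric group. -/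
theorem exists_perm_hom (n : ℕ) : ∀ {G : Type*} [Group G] (s : ℕ → G)
    (_ : ∀ i, i < n → s i * s i = 1)
    (_ : ∀ i j, i + 1 < j → j < n → s i * s j = s j * s i)
    (_ : ∀ i, i + 1 < n → s i * s (i + 1) * s i = s (i + 1) * s i * s (i + 1)),
    ∃ ρ : Perm (Fin (n + 1)) →* G, ∀ i : Fin n, ρ (swap i.castSucc i.succ) = s i := by
  induction n with
  | zero => intro G _ s _ _ _; exact ⟨1, fun i => i.elim0⟩
  | succ n ih =>
    intro G _ s invol comm braid
    obtain ⟨ρ', hρ'⟩ := ih (fun i => s (i + 1)) (fun i hi => invol _ (by omega))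
      (fun i j h1 h2 => comm _ _ (by omega) (by omega)) (fun i hi => braid _ (by omega))
    -- the adjacent transpositions, extended by `1`
    let t : ℕ → Perm (Fin (n + 2)) := fun i =>
      if h : i < n + 1 then swap (⟨i, by omega⟩ : Fin (n + 2)) ⟨i + 1, by omega⟩ else 1
    have ht : ∀ i : Fin (n + 1), t i = swap i.castSucc i.succ := by
      intro i; simp only [t, i.isLt, dif_pos]; rfl
    let e : Perm (Fin (n + 1)) →* Perm (Fin (n + 2)) :=
      Perm.viaEmbeddingHom (Fin.succEmb (n + 1))
    have he : ∀ π x, e π (Fin.succ x) = Fin.succ (π x) := fun π x =>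
      Perm.viaEmbedding_apply π (Fin.succEmb (n + 1)) x
    have he0 : ∀ π, e π 0 = 0 := fun π =>
      Perm.viaEmbedding_apply_of_notMem π (Fin.succEmb (n + 1)) 0
        (by rintro ⟨x, hx⟩; exact Fin.succ_ne_zero x hx)
    have het : ∀ i : Fin n, e (swap i.castSucc i.succ) = t (i + 1) := by
      intro i
      have := ht i.succ
      simp only [Fin.val_succ] at this
      rw [this]
      ext x
      refine Fin.cases ?_ (fun y => ?_) x
      · rw [he0, swap_apply_of_ne_of_ne]
        · simp [Fin.ext_iff]
        · simp [Fin.ext_iff]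
      · rw [he, Fin.castSucc_succ, (Fin.succ_injective _).map_swap]
    have tinv : ∀ i, t i * t i = 1 := by
      intro i; simp only [t]; split_ifs <;> simp
    have tcomm : ∀ i j, i + 1 < j → j < n + 1 → t i * t j = t j * t i := by
      intro i j h1 h2
      simp only [t, h2, show i < n + 1 by omega, dif_pos]
      refine (Perm.disjoint_iff_disjoint_support.2 ?_).commute
      rw [Perm.support_swap (by simp), Perm.support_swap (by simp)]
      simp [Fin.ext_iff]; omega
    have tbraid : ∀ i, i + 1 < n + 1 → t i * t (i + 1) * t i = t (i + 1) * t i * t (i + 1) := by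
      intro i h
      simp only [t, h, show i < n + 1 by omega, dif_pos]
      have a1 : (⟨i, by omega⟩ : Fin (n + 2)) ≠ ⟨i + 1, by omega⟩ := by simp
      have a2 : (⟨i, by omega⟩ : Fin (n + 2)) ≠ ⟨i + 1 + 1, by omega⟩ := by
        simp only [ne_eq, Fin.mk.injEq]; omega
      have a3 : (⟨i + 1, by omega⟩ : Fin (n + 2)) ≠ ⟨i + 1 + 1, by omega⟩ := by simp
      rw [swap_mul_swap_mul_swap a1 a2, swap_comm (⟨i, _⟩ : Fin (n + 2)),
        swap_comm (⟨i + 1, by omega⟩ : Fin (n + 2)) ⟨i + 1 + 1, by omega⟩,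
        swap_mul_swap_mul_swap a3.symm a2.symm, swap_comm]
    -- pairs of generators
    let p : ℕ → Perm (Fin (n + 2)) × G := fun i => (t i, s i)
    let E : Perm (Fin (n + 1)) →* Perm (Fin (n + 2)) × G := e.prod ρ'
    have pinv : ∀ i, i < n + 1 → p i * p i = 1 := fun i hi =>
      Prod.ext (tinv i) (invol i hi)
    have pcomm : ∀ i j, i + 1 < j → j < n + 1 → p i * p j = p j * p i := fun i j h1 h2 =>
      Prod.ext (tcomm i j h1 h2) (comm i j h1 h2)
    have pbraid : ∀ i, i + 1 < n + 1 → p i * p (i + 1) * p i = p (i + 1) * p i * p (i + 1) :=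
      fun i h => Prod.ext (tbraid i h) (braid i h)
    have hE : ∀ i : Fin n, E (swap i.castSucc i.succ) = p (i + 1) := fun i =>
      Prod.ext (het i) (hρ' i)
    have key : ∀ i, i < n + 1 → ∀ k, k ≤ n + 1 → ∀ π, ∃ k' ≤ n + 1, ∃ π',
        p i * (coxCycle p k * E π) = coxCycle p k' * E π' := by
      intro i hi k hk π
      rcases lt_trichotomy k i with h | h | h
      · obtain ⟨j, rfl⟩ : ∃ j, i = j + 1 := ⟨i - 1, by omega⟩
        refine ⟨k, hk, swap (Fin.castSucc ⟨j, by omega⟩) (Fin.succ ⟨j, by omega⟩) * π, ?_⟩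
        rw [map_mul, hE ⟨j, by omega⟩, ← mul_assoc, coxCycle_comm p (n + 1) pcomm k _ h hi,
          mul_assoc]
      · subst h
        exact ⟨k + 1, by omega, π, by rw [coxCycle, mul_assoc]⟩
      · obtain ⟨m, rfl⟩ : ∃ m, k = i + 1 + m := ⟨k - (i + 1), by omega⟩
        rcases m with _ | m
        · refine ⟨i, by omega, π, ?_⟩
          rw [add_zero, coxCycle, mul_assoc, ← mul_assoc, pinv i hi, one_mul]
        · have hb := coxCycle_braid p (n + 1) pcomm pbraid i m (by omega)
          rw [show i + 2 + m = i + 1 + (m + 1) by omega] at hb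
          refine ⟨i + 1 + (m + 1), hk,
            swap (Fin.castSucc ⟨i, by omega⟩) (Fin.succ ⟨i, by omega⟩) * π, ?_⟩
          rw [map_mul, hE ⟨i, by omega⟩, ← mul_assoc, hb, mul_assoc]
    let M : Submonoid (Perm (Fin (n + 2)) × G) :=
      Submonoid.closure (Set.range fun i : Fin (n + 1) => p i)
    have hM : ∀ x ∈ M, ∃ k ≤ n + 1, ∃ π, x = coxCycle p k * E π := by
      intro x hx
      induction hx using Submonoid.closure_induction_left with
      | one => exact ⟨0, by omega, 1, by simp [coxCycle]⟩
      | mul_left x hx y hy ih =>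
        obtain ⟨i, rfl⟩ := hx
        obtain ⟨k, hk, π, rfl⟩ := ih
        exact key i i.isLt k hk π
    have hc : ∀ k (hk : k ≤ n + 1), (coxCycle p k).1 0 = (⟨k, by omega⟩ : Fin (n + 2)) := by
      intro k hk
      induction k with
      | zero => simp [coxCycle]
      | succ k ih =>
        simp only [coxCycle, Prod.fst_mul, Perm.mul_apply, ih (by omega), p, t,
          show k < n + 1 by omega, dif_pos, swap_apply_left]
    have inj : ∀ x ∈ M, ∀ y ∈ M, x.1 = y.1 → x = y := by
      intro x hx y hy hxy
      obtain ⟨k, hk, π, rfl⟩ := hM x hx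
      obtain ⟨l, hl, π', rfl⟩ := hM y hy
      have h0 := congrArg (fun f : Perm (Fin (n + 2)) => f 0) hxy
      have hE0 : ∀ π, (E π).1 0 = 0 := he0
      simp only [Prod.fst_mul, Perm.mul_apply, hE0, hc k hk, hc l hl, Fin.mk.injEq] at h0
      subst h0
      have h1 : e π = e π' := by
        have := hxy
        simp only [Prod.fst_mul] at this
        exact mul_left_cancel this
      rw [Perm.viaEmbeddingHom_injective _ h1]
    let f : M →* Perm (Fin (n + 2)) := (MonoidHom.fst _ _).comp M.subtype
    have fbij : Function.Bijective f := by
      constructor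
      · intro x y h; exact Subtype.ext (inj _ x.2 _ y.2 h)
      · rw [← MonoidHom.mrange_eq_top, eq_top_iff, ← Perm.mclosure_swap_castSucc_succ,
          Submonoid.closure_le]
        rintro _ ⟨i, rfl⟩
        exact ⟨⟨p i, Submonoid.subset_closure ⟨i, rfl⟩⟩, ht i⟩
    let g : M ≃* Perm (Fin (n + 2)) := MulEquiv.ofBijective f fbij
    refine ⟨((MonoidHom.snd _ _).comp M.subtype).comp g.symm.toMonoidHom, fun i => ?_⟩
    have : g.symm (swap i.castSucc i.succ) = ⟨p i, Submonoid.subset_closure ⟨i, rfl⟩⟩ := by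
      rw [MulEquiv.symm_apply_eq]; exact (ht i).symm
    change (g.symm (swap i.castSucc i.succ)).1.2 = s i
    rw [this]

end Coxeter

open CategoryTheory

noncomputable section

/-! ### Finite-dimensional inner product spaces -/

/-- A complex inner product space (of arbitrary dimension). -/
structure Inn where
  carrier : Type
  [grp : NormedAddCommGroup carrier]
  [ips : InnerProductSpace ℂ carrier]

namespace Inn

instance : CoeSort Inn Type := ⟨Inn.carrier⟩
instance (V : Inn) : NormedAddCommGroup V.carrier := V.grp
instance (V : Inn) : InnerProductSpace ℂ V.carrier := V.ips

/-- Inner product spaces with all linear maps as morphisms. -/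
instance : Category Inn where
  Hom V W := V →ₗ[ℂ] W
  id _ := LinearMap.id
  comp f g := g ∘ₗ f

theorem iso_mul_apply {V : Inn} (a b : V ≃ₗᵢ[ℂ] V) (x : V) : (a * b) x = a (b x) := rfl

theorem iso_one_apply {V : Inn} (x : V) : (1 : V ≃ₗᵢ[ℂ] V) x = x := rfl

/-- The one-dimensional space `ℂ`. -/
def unit : Inn := ⟨ℂ⟩

/-- The tensor product, with its canonical inner product. -/
def tensor (V W : Inn) : Inn := ⟨TensorProduct ℂ V W⟩

variable {V V' V'' W W' W'' X : Inn}

/-- The canonical bilinear map `(v, w) ↦ v ⊗ w`. -/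
def tmk (V W : Inn) : V →ₗ[ℂ] W →ₗ[ℂ] V.tensor W := TensorProduct.mk ℂ V W

/-- The linear map on `V ⊗ W` given by a bilinear map. -/
def tlift (f : V →ₗ[ℂ] W →ₗ[ℂ] X) : V.tensor W →ₗ[ℂ] X := TensorProduct.lift f

/-- The tensor product `f ⊗ g` of linear maps. -/
def tmap (f : V →ₗ[ℂ] V') (g : W →ₗ[ℂ] W') : V.tensor W →ₗ[ℂ] V'.tensor W' :=
  TensorProduct.map f g

/-- The tensor product `f ⊗ g` of unitaries. -/
def tcongr (f : V ≃ₗᵢ[ℂ] V') (g : W ≃ₗᵢ[ℂ] W') : V.tensor W ≃ₗᵢ[ℂ] V'.tensor W' :=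
  TensorProduct.congrIsometry f g

/-- The associator `(V ⊗ W) ⊗ X → V ⊗ (W ⊗ X)`. -/
def tassoc (V W X : Inn) : (V.tensor W).tensor X ≃ₗᵢ[ℂ] V.tensor (W.tensor X) :=
  TensorProduct.assocIsometry ℂ V W X

/-- The interchange `V ⊗ W → W ⊗ V` of the factors. -/
def tcomm (V W : Inn) : V.tensor W ≃ₗᵢ[ℂ] W.tensor V :=
  TensorProduct.commIsometry ℂ V W

/-- The canonical map `V ⊗ ℂ → V`. -/
def trid (V : Inn) : V.tensor unit ≃ₗᵢ[ℂ] V := TensorProduct.ridIsometry ℂ V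

/-- The canonical map `ℂ ⊗ V → V`. -/
def tlid (V : Inn) : unit.tensor V ≃ₗᵢ[ℂ] V := TensorProduct.lidIsometry ℂ V

@[simp] theorem tlift_tmk (f : V →ₗ[ℂ] W →ₗ[ℂ] X) (v : V) (w : W) :
    tlift f (tmk V W v w) = f v w := rfl

@[simp] theorem tmap_tmk (f : V →ₗ[ℂ] V') (g : W →ₗ[ℂ] W') (v : V) (w : W) :
    tmap f g (tmk V W v w) = tmk V' W' (f v) (g w) := rfl

@[simp] theorem tcongr_tmk (f : V ≃ₗᵢ[ℂ] V') (g : W ≃ₗᵢ[ℂ] W') (v : V) (w : W) :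
    tcongr f g (tmk V W v w) = tmk V' W' (f v) (g w) := rfl

@[simp] theorem tassoc_tmk (v : V) (w : W) (x : X) :
    tassoc V W X (tmk _ _ (tmk _ _ v w) x) = tmk _ _ v (tmk _ _ w x) := rfl

@[simp] theorem tassoc_symm_tmk (v : V) (w : W) (x : X) :
    (tassoc V W X).symm (tmk _ _ v (tmk _ _ w x)) = tmk _ _ (tmk _ _ v w) x := rfl

@[simp] theorem tcomm_tmk (v : V) (w : W) : tcomm V W (tmk _ _ v w) = tmk _ _ w v := rfl

theorem tensor_induction {p : V.tensor W → Prop} (z : V.tensor W) (zero : p 0)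
    (tmul : ∀ v w, p (tmk V W v w)) (add : ∀ x y, p x → p y → p (x + y)) : p z :=
  TensorProduct.induction_on (motive := p) z zero tmul add

/-- Two linear maps on `V ⊗ W` that agree on elementary tensors are equal. -/
theorem tensor_ext {f g : V.tensor W →ₗ[ℂ] X} (h : ∀ v w, f (tmk V W v w) = g (tmk V W v w)) :
    f = g := by
  ext z
  induction z using tensor_induction with
  | zero => simp
  | tmul v w => exact h v w
  | add x y hx hy => simp [hx, hy]

theorem isometry_ext {f g : V.tensor W ≃ₗᵢ[ℂ] X}
    (h : ∀ v w, f (tmk V W v w) = g (tmk V W v w)) : f = g := by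
  ext z
  induction z using tensor_induction with
  | zero => simp
  | tmul v w => exact h v w
  | add x y hx hy => simp [hx, hy]

@[simp] theorem toLinearMap_tcongr (f : V ≃ₗᵢ[ℂ] V') (g : W ≃ₗᵢ[ℂ] W') :
    ((tcongr f g).toLinearEquiv : V.tensor W →ₗ[ℂ] V'.tensor W') =
      tmap f.toLinearEquiv.toLinearMap g.toLinearEquiv.toLinearMap :=
  tensor_ext fun _ _ => rfl

theorem tcongr_mul (a b : V ≃ₗᵢ[ℂ] V) :
    tcongr (a * b) (1 : W ≃ₗᵢ[ℂ] W) = tcongr a 1 * tcongr b 1 :=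
  isometry_ext fun _ _ => rfl

theorem tcongr_one : tcongr (1 : V ≃ₗᵢ[ℂ] V) (1 : W ≃ₗᵢ[ℂ] W) = 1 :=
  isometry_ext fun _ _ => rfl

/-- The tensor power `V ^ ⊗ n`, bracketed to the left, with `V ^ ⊗ 0 = ℂ`. -/
def tpow (V : Inn) : ℕ → Inn
  | 0 => unit
  | n + 1 => (tpow V n).tensor V

/-- The tensor power `f ⊗ ⋯ ⊗ f` of a linear map. -/
def tpowMap (f : V →ₗ[ℂ] W) : (n : ℕ) → V.tpow n →ₗ[ℂ] W.tpow n
  | 0 => LinearMap.id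
  | n + 1 => tmap (tpowMap f n) f

/-- Concatenation `V ^ ⊗ i ⊗ V ^ ⊗ j → V ^ ⊗ (i + j)`. -/
def tpowMul (V : Inn) (i : ℕ) : (j : ℕ) → (V.tpow i).tensor (V.tpow j) →ₗ[ℂ] V.tpow (i + j)
  | 0 => (trid (V.tpow i)).toLinearEquiv.toLinearMap
  | j + 1 => tmap (tpowMul V i j) LinearMap.id ∘ₗ
      (tassoc (V.tpow i) (V.tpow j) V).symm.toLinearEquiv.toLinearMap

end Inn

/-- A finite-dimensional complex inner product space. -/
structure FinInn extends Inn where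
  finiteDimensional : FiniteDimensional ℂ carrier

namespace FinInn

instance : CoeSort FinInn Type := ⟨fun V => V.carrier⟩
instance (V : FinInn) : FiniteDimensional ℂ V.carrier := V.finiteDimensional

/-- Finite-dimensional inner product spaces with all linear maps as morphisms. -/
instance : Category FinInn where
  Hom V W := V →ₗ[ℂ] W
  id _ := LinearMap.id
  comp f g := g ∘ₗ f

/-- The orthogonal direct sum `V ⊕ W`. -/
def dsum (V W : FinInn) : FinInn :=
  ⟨⟨WithLp 2 (V × W)⟩, inferInstanceAs (FiniteDimensional ℂ (WithLp 2 (V × W)))⟩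

/-- The zero space. -/
def zero : FinInn := ⟨⟨PUnit⟩, inferInstanceAs (FiniteDimensional ℂ PUnit)⟩

/-- The one-dimensional space `ℂ`. -/
def line : FinInn := ⟨Inn.unit, inferInstanceAs (FiniteDimensional ℂ ℂ)⟩

variable {V V' W W' X : FinInn}

/-- The element `(v, w)` of `V ⊕ W`. -/
def dpair (v : V) (w : W) : V.dsum W := WithLp.toLp 2 (v, w)

theorem exists_dpair (x : V.dsum W) : ∃ v w, x = dpair v w := ⟨_, _, rfl⟩

/-- The direct sum `f ⊕ g` of linear maps. -/
def dmap (f : V →ₗ[ℂ] V') (g : W →ₗ[ℂ] W') : V.dsum W →ₗ[ℂ] V'.dsum W' :=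
  (LinearMap.prodMap f g).withLpMap 2

/-- The associator `(V ⊕ W) ⊕ X → V ⊕ (W ⊕ X)`. -/
def dassoc (V W X : FinInn) : (V.dsum W).dsum X ≃ₗᵢ[ℂ] V.dsum (W.dsum X) :=
  LinearIsometryEquiv.withLpProdAssoc 2 ℂ V W X

/-- The interchange `V ⊕ W → W ⊕ V` of the summands. -/
def dcomm (V W : FinInn) : V.dsum W ≃ₗᵢ[ℂ] W.dsum V :=
  LinearIsometryEquiv.withLpProdComm 2 ℂ V W

/-- The canonical map `V ⊕ 0 → V`. -/
def drid (V : FinInn) : V.dsum zero ≃ₗᵢ[ℂ] V :=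
  LinearIsometryEquiv.withLpProdUnique 2 ℂ V PUnit

/-- The canonical map `0 ⊕ V → V`. -/
def dlid (V : FinInn) : zero.dsum V ≃ₗᵢ[ℂ] V :=
  LinearIsometryEquiv.withLpUniqueProd 2 ℂ PUnit V

/-- The inclusion of the first summand. -/
def dinl (V W : FinInn) : V →ₗ[ℂ] V.dsum W :=
  (WithLp.linearEquiv 2 ℂ (V × W)).symm.toLinearMap ∘ₗ LinearMap.inl ℂ V W

/-- The inclusion of the second summand. -/
def dinr (V W : FinInn) : W →ₗ[ℂ] V.dsum W :=
  (WithLp.linearEquiv 2 ℂ (V × W)).symm.toLinearMap ∘ₗ LinearMap.inr ℂ V W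

@[simp] theorem dmap_dpair (f : V →ₗ[ℂ] V') (g : W →ₗ[ℂ] W') (v : V) (w : W) :
    dmap f g (dpair v w) = dpair (f v) (g w) := rfl

@[simp] theorem dassoc_dpair (v : V) (w : W) (x : X) :
    dassoc V W X (dpair (dpair v w) x) = dpair v (dpair w x) := rfl

@[simp] theorem dassoc_symm_dpair (v : V) (w : W) (x : X) :
    (dassoc V W X).symm (dpair v (dpair w x)) = dpair (dpair v w) x := rfl

@[simp] theorem dcomm_dpair (v : V) (w : W) : dcomm V W (dpair v w) = dpair w v := rfl

@[simp] theorem drid_dpair (v : V) (w : zero) : drid V (dpair v w) = v := rfl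

@[simp] theorem dlid_dpair (v : V) (w : zero) : dlid V (dpair w v) = v := rfl

@[simp] theorem dinl_apply (v : V) : dinl V W v = dpair v 0 := rfl

@[simp] theorem dinr_apply (w : W) : dinr V W w = dpair 0 w := rfl

end FinInn

/-! ### R-matrices and the associated representations of the symmetric groups -/

namespace RMatrix

open Inn

variable {W : Inn}

/-- The map `R ⊗ id` on `(W ⊗ W) ⊗ W`. -/
def actFirst (R : W.tensor W ≃ₗᵢ[ℂ] W.tensor W) :
    (W.tensor W).tensor W ≃ₗᵢ[ℂ] (W.tensor W).tensor W :=
  tcongr R 1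

/-- The map `id ⊗ R` on `(T ⊗ W) ⊗ W = T ⊗ (W ⊗ W)`. -/
def actLast (T : Inn) (R : W.tensor W ≃ₗᵢ[ℂ] W.tensor W) :
    (T.tensor W).tensor W ≃ₗᵢ[ℂ] (T.tensor W).tensor W :=
  ((tassoc T W W).trans (tcongr 1 R)).trans (tassoc T W W).symm

end RMatrix

/-- A unitary involutive R-matrix on `W`: a unitary `R` on `W ⊗ W` with `R² = id` that satisfies
the Yang-Baxter equation `R₁ R₂ R₁ = R₂ R₁ R₂` on `W ⊗ W ⊗ W`. -/
structure RMatrix (W : Inn) where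
  toEquiv : W.tensor W ≃ₗᵢ[ℂ] W.tensor W
  invol : toEquiv * toEquiv = 1
  yangBaxter : RMatrix.actFirst toEquiv * RMatrix.actLast W toEquiv * RMatrix.actFirst toEquiv =
    RMatrix.actLast W toEquiv * RMatrix.actFirst toEquiv * RMatrix.actLast W toEquiv

namespace RMatrix

open Inn

variable {W : Inn}

theorem actLast_tmk (T : Inn) (R : W.tensor W ≃ₗᵢ[ℂ] W.tensor W) (t : T) (x y : W) :
    actLast T R (tmk _ _ (tmk _ _ t x) y) = (tassoc T W W).symm (tmk _ _ t (R (tmk _ _ x y))) :=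
  rfl

theorem actLast_assoc (T : Inn) (R : W.tensor W ≃ₗᵢ[ℂ] W.tensor W) (t : T) (z : W.tensor W) :
    actLast T R ((tassoc T W W).symm (tmk _ _ t z)) = (tassoc T W W).symm (tmk _ _ t (R z)) := by
  simp [actLast]

/-- Two unitaries on `(T ⊗ W) ⊗ W` that agree on elementary tensors are equal. -/
theorem isometry_ext₃ {T W W' X : Inn} {f g : (T.tensor W).tensor W' ≃ₗᵢ[ℂ] X}
    (h : ∀ t x y, f (tmk _ _ (tmk _ _ t x) y) = g (tmk _ _ (tmk _ _ t x) y)) : f = g := by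
  refine isometry_ext fun z y => ?_
  induction z using tensor_induction with
  | zero => simp
  | tmul t x => exact h t x y
  | add a b ha hb => simp [ha, hb]

/-- The map `R_i` on `W ^ ⊗ n` that is `R` on two neighbouring tensor factors, those with index
`i` and `i + 1` when counting starts at `0`; it is only used for `i + 1 < n`. -/
def site (R : W.tensor W ≃ₗᵢ[ℂ] W.tensor W) : (n : ℕ) → ℕ → (W.tpow n ≃ₗᵢ[ℂ] W.tpow n)
  | 0, _ => 1
  | 1, _ => 1
  | n + 2, i => if i = n then actLast (W.tpow n) R else tcongr (site R (n + 1) i) 1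

theorem actLast_mul_self (R : RMatrix W) (T : Inn) :
    actLast T R.toEquiv * actLast T R.toEquiv = 1 := by
  refine isometry_ext₃ fun t x y => ?_
  have := DFunLike.congr_fun R.invol (tmk _ _ x y)
  rw [iso_mul_apply] at this
  rw [iso_mul_apply, actLast_tmk, actLast_assoc, this]
  simp

theorem actLast_comm (R : RMatrix W) (T : Inn) (a : T ≃ₗᵢ[ℂ] T) :
    tcongr (tcongr a 1) 1 * actLast T R.toEquiv =
      actLast T R.toEquiv * tcongr (tcongr a 1) 1 := by
  refine isometry_ext₃ fun t x y => ?_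
  simp only [iso_mul_apply, tcongr_tmk, actLast_tmk]
  simp only [iso_one_apply]
  generalize R.toEquiv (tmk _ _ x y) = z
  induction z using tensor_induction with
  | zero => simp
  | tmul x y => simp
  | add a b ha hb => simp only [map_add, ha, hb]

/-- The map `x ↦ t ⊗ x`, rebracketed, from `(W ⊗ W) ⊗ W` to `((T ⊗ W) ⊗ W) ⊗ W`. -/
def rebracket (T W : Inn) (t : T) :
    (W.tensor W).tensor W →ₗ[ℂ] ((T.tensor W).tensor W).tensor W :=
  tmap ((tassoc T W W).symm.toLinearEquiv.toLinearMap ∘ₗ tmk T (W.tensor W) t) LinearMap.id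

theorem tcongr_actLast_rebracket (R : W.tensor W ≃ₗᵢ[ℂ] W.tensor W) (T : Inn) (t : T)
    (x : (W.tensor W).tensor W) :
    tcongr (actLast T R) 1 (rebracket T W t x) = rebracket T W t (actFirst R x) := by
  induction x using tensor_induction with
  | zero => simp
  | tmul x y => simp [rebracket, actFirst, actLast_assoc]
  | add a b ha hb => simp only [map_add, ha, hb]

theorem actLast_rebracket (R : W.tensor W ≃ₗᵢ[ℂ] W.tensor W) (T : Inn) (t : T)
    (x : (W.tensor W).tensor W) :
    actLast (T.tensor W) R (rebracket T W t x) = rebracket T W t (actLast W R x) := by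
  induction x using tensor_induction with
  | zero => simp
  | tmul x y =>
    induction x using tensor_induction with
    | zero => simp
    | tmul x x' =>
      rw [actLast_tmk]
      simp only [rebracket, tmap_tmk, LinearMap.comp_apply, LinearEquiv.coe_coe,
        LinearIsometryEquiv.coe_toLinearEquiv, tassoc_symm_tmk, LinearMap.id_apply, actLast_tmk]
      generalize R (tmk _ _ x' y) = z
      induction z using tensor_induction with
      | zero => simp
      | tmul x y => simp
      | add a b ha hb => simp only [map_add, ha, hb]
    | add a b ha hb => simp only [map_add, LinearMap.add_apply, ha, hb]
  | add a b ha hb => simp only [map_add, ha, hb]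

theorem actLast_braid (R : RMatrix W) (T : Inn) :
    tcongr (actLast T R.toEquiv) 1 * actLast (T.tensor W) R.toEquiv *
        tcongr (actLast T R.toEquiv) 1 =
      actLast (T.tensor W) R.toEquiv * tcongr (actLast T R.toEquiv) 1 *
        actLast (T.tensor W) R.toEquiv := by
  refine isometry_ext fun x y => ?_
  induction x using tensor_induction with
  | zero => simp
  | tmul x x' =>
    induction x using tensor_induction with
    | zero => simp
    | tmul t x =>
      have h : tmk _ _ (tmk _ _ (tmk _ _ t x) x') y =
        rebracket T W t (tmk _ _ (tmk _ _ x x') y) := by simp [rebracket]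
      simp only [h, iso_mul_apply, tcongr_actLast_rebracket, actLast_rebracket]
      exact congrArg (rebracket T W t) (DFunLike.congr_fun R.yangBaxter _)
    | add a b ha hb => simp only [map_add, LinearMap.add_apply, ha, hb]
  | add a b ha hb => simp only [map_add, LinearMap.add_apply, ha, hb]

theorem site_last (R : W.tensor W ≃ₗᵢ[ℂ] W.tensor W) (n : ℕ) :
    site R (n + 2) n = actLast (W.tpow n) R :=
  if_pos rfl

theorem site_ne (R : W.tensor W ≃ₗᵢ[ℂ] W.tensor W) (n i : ℕ) (h : i ≠ n) :
    site R (n + 2) i = tcongr (site R (n + 1) i) 1 :=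
  if_neg h

theorem site_mul_self (R : RMatrix W) (n i : ℕ) :
    site R.toEquiv (n + 1) i * site R.toEquiv (n + 1) i = 1 := by
  induction n with
  | zero => rfl
  | succ n ih =>
    by_cases h : i = n
    · subst h; rw [site_last]; exact actLast_mul_self R _
    · rw [site_ne _ _ _ h]
      exact (tcongr_mul _ _).symm.trans ((congrArg (tcongr · 1) ih).trans tcongr_one)

theorem site_comm (R : RMatrix W) (n i j : ℕ) (h : i + 1 < j) (hj : j < n) :
    site R.toEquiv (n + 1) i * site R.toEquiv (n + 1) j =
      site R.toEquiv (n + 1) j * site R.toEquiv (n + 1) i := by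
  induction n with
  | zero => omega
  | succ n ih =>
    rw [site_ne _ n i (by omega)]
    by_cases h' : j = n
    · subst h'
      obtain ⟨m, rfl⟩ : ∃ m, j = m + 1 := ⟨j - 1, by omega⟩
      rw [site_last, site_ne _ m i (by omega)]
      exact actLast_comm R _ _
    · rw [site_ne _ n j h']
      exact (tcongr_mul _ _).symm.trans
        ((congrArg (tcongr · 1) (ih (by omega))).trans (tcongr_mul _ _))

theorem site_braid (R : RMatrix W) (n i : ℕ) (h : i + 1 < n) :
    site R.toEquiv (n + 1) i * site R.toEquiv (n + 1) (i + 1) * site R.toEquiv (n + 1) i =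
      site R.toEquiv (n + 1) (i + 1) * site R.toEquiv (n + 1) i *
        site R.toEquiv (n + 1) (i + 1) := by
  induction n with
  | zero => omega
  | succ n ih =>
    rw [site_ne _ n i (by omega)]
    by_cases h' : i + 1 = n
    · subst h'
      rw [site_last, site_last]
      exact actLast_braid R _
    · rw [site_ne _ n (i + 1) h']
      have := congrArg (tcongr · (1 : W ≃ₗᵢ[ℂ] W)) (ih (by omega))
      simp only [tcongr_mul] at this
      exact this

theorem exists_rep (R : RMatrix W) (n : ℕ) :
    ∃ ρ : Equiv.Perm (Fin (n + 1)) →* (W.tpow (n + 1) ≃ₗᵢ[ℂ] W.tpow (n + 1)),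
      ∀ i : Fin n, ρ (Equiv.swap i.castSucc i.succ) = site R.toEquiv (n + 1) i :=
  exists_perm_hom n _ (fun i _ => site_mul_self R n i) (fun i j => site_comm R n i j)
    (fun i => site_braid R n i)

/-- The unitary representation `ρ_R^(n)` of `S_n` on `W ^ ⊗ n`; it is the homomorphism that sends
the transposition of `i` and `i + 1` to `R_i`. -/
def rep (R : RMatrix W) : (n : ℕ) → Equiv.Perm (Fin n) →* (W.tpow n ≃ₗᵢ[ℂ] W.tpow n)
  | 0 => 1
  | n + 1 => (exists_rep R n).choose

theorem rep_swap (R : RMatrix W) (n : ℕ) (i : Fin n) :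
    R.rep (n + 1) (Equiv.swap i.castSucc i.succ) = site R.toEquiv (n + 1) i :=
  (exists_rep R n).choose_spec i

/-- Strong equivalence of R-matrices: there is a unitary `v₁` such that for every `n` the unitary
`v₁ ⊗ ⋯ ⊗ v₁` intertwines the two representations of `S_n`. -/
def StronglyEquivalent {W W' : Inn} (R : RMatrix W) (S : RMatrix W') : Prop :=
  ∃ v₁ : W ≃ₗᵢ[ℂ] W', ∀ (n : ℕ) (σ : Equiv.Perm (Fin n)) (x : W.tpow n),
    tpowMap v₁.toLinearEquiv.toLinearMap n (R.rep n σ x) =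
      S.rep n σ (tpowMap v₁.toLinearEquiv.toLinearMap n x)

/-- The interchange of the two middle factors, `(V ⊗ W) ⊗ (V' ⊗ W') → (V ⊗ V') ⊗ (W ⊗ W')`. -/
def tmid (V W V' W' : Inn) :
    (V.tensor W).tensor (V'.tensor W') ≃ₗᵢ[ℂ] (V.tensor V').tensor (W.tensor W') :=
  ((tassoc V W (V'.tensor W')).trans (tcongr 1 (((tassoc W V' W').symm.trans
    (tcongr (tcomm W V') 1)).trans (tassoc V' W W')))).trans (tassoc V V' (W.tensor W')).symm

@[simp] theorem tmid_tmk {V W V' W' : Inn} (v : V) (w : W) (v' : V') (w' : W') :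
    tmid V W V' W' (tmk _ _ (tmk _ _ v w) (tmk _ _ v' w')) =
      tmk _ _ (tmk _ _ v v') (tmk _ _ w w') := rfl

@[simp] theorem tmid_symm_tmk {V W V' W' : Inn} (v : V) (w : W) (v' : V') (w' : W') :
    (tmid V W V' W').symm (tmk _ _ (tmk _ _ v v') (tmk _ _ w w')) =
      tmk _ _ (tmk _ _ v w) (tmk _ _ v' w') := rfl

/-- The unitary underlying `R ⊠ S`: the unitary `R ⊗ S` on `(W ⊗ W) ⊗ (V ⊗ V)`, regarded as a
unitary on `(W ⊗ V) ⊗ (W ⊗ V)`. -/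
def boxEquiv {W V : Inn} (R : W.tensor W ≃ₗᵢ[ℂ] W.tensor W) (S : V.tensor V ≃ₗᵢ[ℂ] V.tensor V) :
    (W.tensor V).tensor (W.tensor V) ≃ₗᵢ[ℂ] (W.tensor V).tensor (W.tensor V) :=
  ((tmid W V W V).trans (tcongr R S)).trans (tmid W V W V).symm

theorem boxEquiv_tmid {W V : Inn} (R : W.tensor W ≃ₗᵢ[ℂ] W.tensor W)
    (S : V.tensor V ≃ₗᵢ[ℂ] V.tensor V) (a : W.tensor W) (b : V.tensor V) :
    boxEquiv R S ((tmid W V W V).symm (tmk _ _ a b)) = (tmid W V W V).symm (tmk _ _ (R a) (S b)) := by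
  simp [boxEquiv]

/-- The rearrangement `W ^ ⊗ 3 ⊗ V ^ ⊗ 3 → (W ⊗ V) ^ ⊗ 3`. -/
def shuffle (W V : Inn) : ((W.tensor W).tensor W).tensor ((V.tensor V).tensor V) ≃ₗᵢ[ℂ]
    ((W.tensor V).tensor (W.tensor V)).tensor (W.tensor V) :=
  (tmid (W.tensor W) (V.tensor V) W V).symm.trans (tcongr (tmid W V W V).symm 1)

theorem actFirst_shuffle {W V : Inn} (R : W.tensor W ≃ₗᵢ[ℂ] W.tensor W)
    (S : V.tensor V ≃ₗᵢ[ℂ] V.tensor V) (z : (W.tensor W).tensor W) (y : (V.tensor V).tensor V) :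
    actFirst (boxEquiv R S) (shuffle W V (tmk _ _ z y)) =
      shuffle W V (tmk _ _ (actFirst R z) (actFirst S y)) := by
  induction z using tensor_induction with
  | zero => simp
  | tmul a w =>
    induction y using tensor_induction with
    | zero => simp
    | tmul b v => simp [shuffle, actFirst, boxEquiv_tmid]
    | add a b ha hb => simp only [map_add, ha, hb]
  | add a b ha hb => simp only [map_add, LinearMap.add_apply, ha, hb]

theorem shuffle_assoc {W V : Inn} (w : W) (v : V) (a : W.tensor W) (b : V.tensor V) :
    shuffle W V (tmk _ _ ((tassoc W W W).symm (tmk _ _ w a)) ((tassoc V V V).symm (tmk _ _ v b))) =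
      (tassoc _ _ _).symm (tmk _ _ (tmk _ _ w v) ((tmid W V W V).symm (tmk _ _ a b))) := by
  induction a using tensor_induction with
  | zero => simp
  | tmul a w =>
    induction b using tensor_induction with
    | zero => simp
    | tmul b v => simp [shuffle]
    | add a b ha hb => simp only [map_add, ha, hb]
  | add a b ha hb => simp only [map_add, LinearMap.add_apply, ha, hb]

theorem actLast_shuffle {W V : Inn} (R : W.tensor W ≃ₗᵢ[ℂ] W.tensor W)
    (S : V.tensor V ≃ₗᵢ[ℂ] V.tensor V) (z : (W.tensor W).tensor W) (y : (V.tensor V).tensor V) :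
    actLast (W.tensor V) (boxEquiv R S) (shuffle W V (tmk _ _ z y)) =
      shuffle W V (tmk _ _ (actLast W R z) (actLast V S y)) := by
  obtain ⟨z, rfl⟩ := (tassoc W W W).symm.surjective z
  obtain ⟨y, rfl⟩ := (tassoc V V V).symm.surjective y
  induction z using tensor_induction with
  | zero => simp
  | tmul w a =>
    induction y using tensor_induction with
    | zero => simp
    | tmul v b => simp only [shuffle_assoc, actLast_assoc, boxEquiv_tmid]
    | add a b ha hb => simp only [map_add, ha, hb]
  | add a b ha hb => simp only [map_add, LinearMap.add_apply, ha, hb]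

/-- The tensor product `R ⊠ S` of two R-matrices. -/
def boxTensor {W V : Inn} (R : RMatrix W) (S : RMatrix V) : RMatrix (W.tensor V) where
  toEquiv := boxEquiv R.toEquiv S.toEquiv
  invol := by
    ext z
    obtain ⟨z, rfl⟩ := (tmid W V W V).symm.surjective z
    induction z using tensor_induction with
    | zero => simp
    | tmul a b =>
      rw [iso_mul_apply, boxEquiv_tmid, boxEquiv_tmid, ← iso_mul_apply, ← iso_mul_apply, R.invol,
        S.invol]
      rfl
    | add a b ha hb => simp only [map_add, ha, hb]
  yangBaxter := by
    ext z
    obtain ⟨z, rfl⟩ := (shuffle W V).surjective z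
    induction z using tensor_induction with
    | zero => simp
    | tmul a b =>
      have h1 := DFunLike.congr_fun R.yangBaxter a
      have h2 := DFunLike.congr_fun S.yangBaxter b
      simp only [iso_mul_apply] at h1 h2
      simp only [iso_mul_apply, actFirst_shuffle, actLast_shuffle, h1, h2]
    | add a b ha hb => simp only [map_add, ha, hb]

/-- The R-matrix `T` on `V` that interchanges the tensor factors. -/
def flip (V : Inn) : RMatrix V where
  toEquiv := tcomm V V
  invol := isometry_ext fun _ _ => rfl
  yangBaxter := isometry_ext₃ fun x y z => by
    simp [iso_mul_apply, actFirst, actLast_tmk]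

end RMatrix

/-! ### Exponential functors -/

/-- The data of an exponential functor: a functor `F` together with linear maps
`τ : F (V ⊕ W) → F V ⊗ F W` and `ι : F 0 → ℂ`. -/
structure ExpDatum where
  functor : FinInn ⥤ Inn
  tau (V W : FinInn) : functor.obj (V.dsum W) →ₗ[ℂ] (functor.obj V).tensor (functor.obj W)
  iota : functor.obj FinInn.zero →ₗ[ℂ] Inn.unit

namespace ExpDatum

open FinInn Inn

/-- The space `F V`. -/
abbrev obj (F : ExpDatum) (V : FinInn) : Inn := F.functor.obj V

/-- The linear map `F f : F V → F W`. -/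
def map (F : ExpDatum) {V W : FinInn} (f : V →ₗ[ℂ] W) : F.obj V →ₗ[ℂ] F.obj W :=
  F.functor.map (X := V) (Y := W) f

theorem map_id (F : ExpDatum) (V : FinInn) : F.map (LinearMap.id : V →ₗ[ℂ] V) = LinearMap.id :=
  F.functor.map_id V

theorem map_comp (F : ExpDatum) {V W X : FinInn} (g : W →ₗ[ℂ] X) (f : V →ₗ[ℂ] W) :
    F.map (g ∘ₗ f) = F.map g ∘ₗ F.map f :=
  F.functor.map_comp (X := V) (Y := W) (Z := X) f g

/-- A linear map between inner product spaces that is a unitary isomorphism. -/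
def IsUnitary {V W : Inn} (f : V →ₗ[ℂ] W) : Prop :=
  (∀ x, ‖f x‖ = ‖x‖) ∧ Function.Surjective f

/-- `(F, τ, ι)` is a unitary exponential functor from finite-dimensional inner product spaces to
finite-dimensional inner product spaces. -/
structure IsExponential (F : ExpDatum) : Prop where
  finiteDimensional (V : FinInn) : FiniteDimensional ℂ (F.obj V)
  map_adjoint {V W : FinInn} (f : V →ₗ[ℂ] W) (x : F.obj V) (y : F.obj W) :
    inner ℂ (F.map f x) y = inner ℂ x (F.map (LinearMap.adjoint f) y)
  tau_unitary (V W : FinInn) : IsUnitary (F.tau V W)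
  tau_natural {V V' W W' : FinInn} (f : V →ₗ[ℂ] V') (g : W →ₗ[ℂ] W') :
    F.tau V' W' ∘ₗ F.map (dmap f g) = tmap (F.map f) (F.map g) ∘ₗ F.tau V W
  tau_assoc (V W X : FinInn) :
    tmap LinearMap.id (F.tau W X) ∘ₗ F.tau V (W.dsum X) ∘ₗ
        F.map (dassoc V W X).toLinearEquiv.toLinearMap =
      (tassoc (F.obj V) (F.obj W) (F.obj X)).toLinearEquiv.toLinearMap ∘ₗ
        tmap (F.tau V W) LinearMap.id ∘ₗ F.tau (V.dsum W) X
  iota_unitary : IsUnitary F.iota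
  iota_right (V : FinInn) :
    (trid (F.obj V)).toLinearEquiv.toLinearMap ∘ₗ tmap LinearMap.id F.iota ∘ₗ F.tau V zero =
      F.map (drid V).toLinearEquiv.toLinearMap
  iota_left (V : FinInn) :
    (tlid (F.obj V)).toLinearEquiv.toLinearMap ∘ₗ tmap F.iota LinearMap.id ∘ₗ F.tau zero V =
      F.map (dlid V).toLinearEquiv.toLinearMap

/-- `F` is polynomial: `F (λ₁ f₁ + ⋯ + λₙ fₙ)` is a polynomial in `λ₁, …, λₙ` whose coefficients
are linear maps `F V → F W`. -/
def IsPolynomial (F : ExpDatum) : Prop :=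
  ∀ (V W : FinInn) (n : ℕ) (f : Fin n → (V →ₗ[ℂ] W)),
    ∃ c : (Fin n →₀ ℕ) →₀ (F.obj V →ₗ[ℂ] F.obj W), ∀ l : Fin n → ℂ,
      F.map (∑ i, l i • f i) = c.sum fun m a => (∏ i, l i ^ m i) • a

/-- The homogeneous component `F_n V`: the subspace on which `F (λ id)` is multiplication by
`λ ^ n` for all `λ`. -/
def component (F : ExpDatum) (n : ℕ) (V : FinInn) : Submodule ℂ (F.obj V) where
  carrier := {x | ∀ l : ℂ, F.map (l • (LinearMap.id : V →ₗ[ℂ] V)) x = l ^ n • x}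
  add_mem' hx hy l := by rw [_root_.map_add, hx l, hy l, smul_add]
  zero_mem' l := by rw [_root_.map_zero, smul_zero]
  smul_mem' a x hx l := by rw [_root_.map_smul, hx l, smul_comm]

/-- The space `W = F_1 ℂ`. -/
def degOne (F : ExpDatum) : Inn := ⟨F.component 1 line⟩

/-- The inclusion `F_1 ℂ → F ℂ`. -/
def incl (F : ExpDatum) : F.degOne →ₗᵢ[ℂ] F.obj line := (F.component 1 line).subtypeₗᵢ

end ExpDatum

/-- A polynomial exponential functor. -/
structure PolyExpFunctor extends ExpDatum where
  isExponential : toExpDatum.IsExponential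
  isPolynomial : toExpDatum.IsPolynomial

namespace PolyExpFunctor

open FinInn Inn ExpDatum

/-- `F` and `G` are monoidally isomorphic: there are unitaries `v V : F V → G V`, natural in `V`,
that are compatible with `τ`. -/
def MonoidallyIso (F G : PolyExpFunctor) : Prop :=
  ∃ v : ∀ V : FinInn, F.obj V ≃ₗᵢ[ℂ] G.obj V,
    (∀ (V W : FinInn) (f : V →ₗ[ℂ] W) (x : F.obj V), v W (F.map f x) = G.map f (v V x)) ∧
    ∀ (V W : FinInn) (x : F.obj (V.dsum W)),
      G.tau V W (v (V.dsum W) x) = tcongr (v V) (v W) (F.tau V W x)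

end PolyExpFunctor

/-! ### The R-matrix of a polynomial exponential functor -/

namespace PolyExpFunctor

open FinInn Inn ExpDatum

theorem coeff_ext {E : Type*} [AddCommGroup E] [Module ℂ E] (f g : ℕ →₀ E)
    (h : ∀ l : ℂ, (f.sum fun m a => l ^ m • a) = g.sum fun m a => l ^ m • a) : f = g := by
  ext m
  rw [← sub_eq_zero, ← Module.forall_dual_apply_eq_zero_iff ℂ]
  intro φ
  let P : (ℕ →₀ E) → Polynomial ℂ := fun f => f.sum fun m a => Polynomial.monomial m (φ a)
  have hP : ∀ f l, (P f).eval l = φ (f.sum fun m a => l ^ m • a) := by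
    intro f l
    simp [P, Finsupp.sum, Polynomial.eval_finsetSum, mul_comm]
  have hc : ∀ f, (P f).coeff m = φ (f m) := by
    intro f
    simp only [P, Finsupp.sum, Polynomial.finsetSum_coeff, Polynomial.coeff_monomial]
    rw [Finset.sum_ite_eq']
    split_ifs with hm
    · rfl
    · rw [Finsupp.notMem_support_iff.1 hm, map_zero]
  have : P f = P g := Polynomial.funext fun l => by rw [hP, hP, h]
  rw [map_sub, ← hc, ← hc, this, sub_self]

theorem coeff_one {E E' : Type*} [AddCommGroup E] [Module ℂ E] [AddCommGroup E'] [Module ℂ E']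
    (c : ℕ →₀ E) (t : E →ₗ[ℂ] E') (z : E')
    (h : ∀ l : ℂ, t (c.sum fun m a => l ^ m • a) = l • z) : t (c 1) = z := by
  have := coeff_ext (c.mapRange t (_root_.map_zero t)) (Finsupp.single 1 z) fun l => by
    rw [Finsupp.sum_mapRange_index (by simp), Finsupp.sum_single_index (by simp), pow_one, ← h l]
    simp only [Finsupp.sum, map_sum, _root_.map_smul]
  simpa using DFunLike.congr_fun this 1

theorem exists_coeff (F : PolyExpFunctor) (V : FinInn) :
    ∃ c : ℕ →₀ (F.obj V →ₗ[ℂ] F.obj V), ∀ l : ℂ,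
      F.map (l • (LinearMap.id : V →ₗ[ℂ] V)) = c.sum fun m a => l ^ m • a := by
  obtain ⟨c, hc⟩ := F.isPolynomial V V 1 fun _ => LinearMap.id
  refine ⟨c.mapDomain fun m => m 0, fun l => ?_⟩
  have := hc fun _ => l
  simp only [Finset.univ_unique, Finset.sum_singleton, Finset.prod_singleton] at this
  rw [this, Finsupp.sum_mapDomain_index (by simp) (by simp [smul_add])]
  rfl

/-- The coefficient of `l` in `F (l id)` takes values in `F_1 ℂ`. -/
theorem coeff_one_mem (F : PolyExpFunctor) (V : FinInn) (c : ℕ →₀ (F.obj V →ₗ[ℂ] F.obj V))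
    (hc : ∀ l : ℂ, F.map (l • (LinearMap.id : V →ₗ[ℂ] V)) = c.sum fun m a => l ^ m • a)
    (x : F.obj V) : c 1 x ∈ F.component 1 V := by
  intro l
  let t : (F.obj V →ₗ[ℂ] F.obj V) →ₗ[ℂ] (F.obj V →ₗ[ℂ] F.obj V) :=
    LinearMap.llcomp ℂ _ _ _ (F.map (l • LinearMap.id))
  let d : ℕ →₀ (F.obj V →ₗ[ℂ] F.obj V) :=
    Finsupp.onFinset c.support (fun m => l ^ m • c m) fun m hm => by
      rw [Finsupp.mem_support_iff]; rintro h; exact hm (by rw [h, smul_zero])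
  have key : c.mapRange t (_root_.map_zero t) = d := by
    apply coeff_ext
    intro k
    have h1 : (l • (LinearMap.id : V →ₗ[ℂ] V)) ∘ₗ (k • LinearMap.id) =
        (k * l) • LinearMap.id := by
      ext x; simp [smul_smul, mul_comm]
    have h2 : t (F.map (k • LinearMap.id)) = F.map ((k * l) • LinearMap.id) := by
      rw [← h1, map_comp]; rfl
    have h3 : (d.sum fun m a => k ^ m • a) = F.map ((k * l) • LinearMap.id) := by
      rw [hc, Finsupp.onFinset_sum _ (by simp)]
      exact Finset.sum_congr rfl fun m _ => by simp only [smul_smul, mul_pow]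
    rw [Finsupp.sum_mapRange_index (by simp), h3, ← h2, hc k]
    simp only [Finsupp.sum, map_sum, _root_.map_smul]
  exact LinearMap.congr_fun (DFunLike.congr_fun key 1) x

/-- The bilinear map `(f, g) ↦ (f ⊗ g) y`. -/
def tmapEval {V V' W W' : Inn} (y : V.tensor W) :
    (V →ₗ[ℂ] V') →ₗ[ℂ] (W →ₗ[ℂ] W') →ₗ[ℂ] V'.tensor W' :=
  LinearMap.mk₂ ℂ (fun f g => tmap f g y)
    (fun f f' g => LinearMap.congr_fun (TensorProduct.map_add_left f f' g) y)
    (fun r f g => LinearMap.congr_fun (TensorProduct.map_smul_left r f g) y)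
    (fun f g g' => LinearMap.congr_fun (TensorProduct.map_add_right f g g') y)
    (fun r f g => LinearMap.congr_fun (TensorProduct.map_smul_right r f g) y)

theorem tmapEval_apply {V V' W W' : Inn} (y : V.tensor W) (f : V →ₗ[ℂ] V') (g : W →ₗ[ℂ] W') :
    tmapEval y f g = tmap f g y := rfl

/-- There is a linear map `p` onto `F_1 ℂ` such that `p ⊗ p` fixes the elements of
bidegree `(1, 1)`. -/
theorem exists_retraction (F : PolyExpFunctor) :
    ∃ p : F.obj line →ₗ[ℂ] F.degOne, ∀ y : (F.obj line).tensor (F.obj line),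
      (∀ a b : ℂ, tmap (F.map (a • (LinearMap.id : line →ₗ[ℂ] line)))
        (F.map (b • (LinearMap.id : line →ₗ[ℂ] line))) y = (a * b) • y) →
      tmap F.incl.toLinearMap F.incl.toLinearMap (tmap p p y) = y := by
  obtain ⟨c, hc⟩ := F.exists_coeff line
  obtain ⟨p, hp⟩ : ∃ p : F.obj line →ₗ[ℂ] F.degOne, F.incl.toLinearMap ∘ₗ p = c 1 :=
    ⟨LinearMap.codRestrict _ (c 1) (F.coeff_one_mem line c hc), rfl⟩
  refine ⟨p, fun y hy => ?_⟩
  have h0 : tmap F.incl.toLinearMap F.incl.toLinearMap ∘ₗ tmap p p = tmap (c 1) (c 1) :=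
    tensor_ext fun a b => by simp [← hp]
  rw [← LinearMap.comp_apply, h0]
  have h1 : ∀ a : ℂ, tmapEval y (F.map (a • (LinearMap.id : line →ₗ[ℂ] line))) (c 1) = a • y := by
    intro a
    refine coeff_one c (tmapEval y (F.map (a • (LinearMap.id : line →ₗ[ℂ] line)))) _ fun b => ?_
    rw [← hc b, smul_smul, mul_comm, tmapEval_apply]
    exact hy a b
  have h2 : (tmapEval y).flip (c 1) (c 1) = y := by
    refine coeff_one c ((tmapEval y).flip (c 1)) _ fun a => ?_
    rw [← hc a, LinearMap.flip_apply]
    exact h1 a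
  rw [LinearMap.flip_apply, tmapEval_apply] at h2
  exact h2

theorem map_map (F : ExpDatum) {V W X : FinInn} (g : W →ₗ[ℂ] X) (f : V →ₗ[ℂ] W) (x : F.obj V) :
    F.map g (F.map f x) = F.map (g ∘ₗ f) x := by
  rw [map_comp]; rfl

theorem map_isometry (F : PolyExpFunctor) {V W : FinInn} (u : V ≃ₗᵢ[ℂ] W) (x : F.obj V) :
    ‖F.map u.toLinearEquiv.toLinearMap x‖ = ‖x‖ := by
  have h : LinearMap.adjoint u.toLinearEquiv.toLinearMap ∘ₗ u.toLinearEquiv.toLinearMap =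
      LinearMap.id := by
    ext y
    refine ext_inner_right ℂ fun z => ?_
    rw [LinearMap.comp_apply, LinearMap.adjoint_inner_left]
    exact u.inner_map_map y z
  have h1 := F.isExponential.map_adjoint u.toLinearEquiv.toLinearMap x
    (F.map u.toLinearEquiv.toLinearMap x)
  rw [← LinearMap.comp_apply, ← map_comp, h, map_id, LinearMap.id_apply] at h1
  rw [@norm_eq_sqrt_re_inner ℂ, h1, ← @norm_eq_sqrt_re_inner ℂ]

/-- The unitary `F u` for a unitary `u`. -/
def mapUnitary (F : PolyExpFunctor) {V W : FinInn} (u : V ≃ₗᵢ[ℂ] W) : F.obj V ≃ₗᵢ[ℂ] F.obj W where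
  toFun := F.map u.toLinearEquiv.toLinearMap
  invFun := F.map u.symm.toLinearEquiv.toLinearMap
  map_add' := _root_.map_add _
  map_smul' := _root_.map_smul _
  left_inv x := by
    rw [map_map]
    have : u.symm.toLinearEquiv.toLinearMap ∘ₗ u.toLinearEquiv.toLinearMap = LinearMap.id := by
      ext y; simp
    rw [this, map_id]; rfl
  right_inv x := by
    rw [map_map]
    have : u.toLinearEquiv.toLinearMap ∘ₗ u.symm.toLinearEquiv.toLinearMap = LinearMap.id := by
      ext y; simp
    rw [this, map_id]; rfl
  norm_map' := F.map_isometry u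

/-- The unitary `τ : F (V ⊕ W) → F V ⊗ F W`. -/
def tauUnitary (F : PolyExpFunctor) (V W : FinInn) :
    F.obj (V.dsum W) ≃ₗᵢ[ℂ] (F.obj V).tensor (F.obj W) :=
  LinearIsometryEquiv.ofSurjective
    ⟨F.tau V W, (F.isExponential.tau_unitary V W).1⟩ (F.isExponential.tau_unitary V W).2

@[simp] theorem tauUnitary_apply (F : PolyExpFunctor) (V W : FinInn) (x : F.obj (V.dsum W)) :
    F.tauUnitary V W x = F.tau V W x := rfl

/-- The unitary on `F V ⊗ F V` that corresponds under `τ` to the action on `F (V ⊕ V)` of the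
interchange of the two summands. -/
def swapUnitary (F : PolyExpFunctor) (V : FinInn) :
    (F.obj V).tensor (F.obj V) ≃ₗᵢ[ℂ] (F.obj V).tensor (F.obj V) :=
  ((F.tauUnitary V V).symm.trans (F.mapUnitary (dcomm V V))).trans (F.tauUnitary V V)

theorem swapUnitary_tau (F : PolyExpFunctor) (V : FinInn) (x : F.obj (V.dsum V)) :
    F.swapUnitary V (F.tau V V x) =
      F.tau V V (F.map (dcomm V V).toLinearEquiv.toLinearMap x) := by
  rw [← tauUnitary_apply, swapUnitary]
  simp only [LinearIsometryEquiv.trans_apply, LinearIsometryEquiv.symm_apply_apply]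
  rfl

/-- The inclusion `F_1 ℂ ⊗ F_1 ℂ → F ℂ ⊗ F ℂ`. -/
def incl₂ (F : PolyExpFunctor) :
    F.degOne.tensor F.degOne →ₗ[ℂ] (F.obj line).tensor (F.obj line) :=
  tmap F.incl.toLinearMap F.incl.toLinearMap

theorem norm_tmap {V V' W W' : Inn} (f : V →ₗᵢ[ℂ] V') (g : W →ₗᵢ[ℂ] W') (x : V.tensor W) :
    ‖tmap f.toLinearMap g.toLinearMap x‖ = ‖x‖ :=
  TensorProduct.norm_map f g x

theorem tau_natural_apply (F : PolyExpFunctor) {V V' W W' : FinInn} (f : V →ₗ[ℂ] V')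
    (g : W →ₗ[ℂ] W') (x : F.obj (V.dsum W)) :
    F.tau V' W' (F.map (dmap f g) x) = tmap (F.map f) (F.map g) (F.tau V W x) :=
  LinearMap.congr_fun (F.isExponential.tau_natural f g) x

theorem tmap_swapUnitary (F : PolyExpFunctor) (V : FinInn) (f g : V →ₗ[ℂ] V)
    (y : (F.obj V).tensor (F.obj V)) :
    tmap (F.map f) (F.map g) (F.swapUnitary V y) = F.swapUnitary V (tmap (F.map g) (F.map f) y) := by
  obtain ⟨x, rfl⟩ := (F.isExponential.tau_unitary V V).2 y
  rw [swapUnitary_tau, ← tau_natural_apply, ← tau_natural_apply, swapUnitary_tau, map_map,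
    map_map]
  rfl

theorem exists_restriction (F : PolyExpFunctor) (x : F.degOne.tensor F.degOne) :
    F.incl₂ (tmap F.exists_retraction.choose F.exists_retraction.choose
      (F.swapUnitary line (F.incl₂ x))) = F.swapUnitary line (F.incl₂ x) := by
  refine F.exists_retraction.choose_spec _ fun a b => ?_
  rw [tmap_swapUnitary, ← _root_.map_smul]
  congr 1
  induction x using tensor_induction with
  | zero => simp
  | tmul v w =>
    have hv : F.map (b • LinearMap.id) (F.incl v) = b ^ 1 • F.incl v := v.2 b
    have hw : F.map (a • LinearMap.id) (F.incl w) = a ^ 1 • F.incl w := w.2 a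
    simp only [incl₂, tmap_tmk, LinearIsometry.coe_toLinearMap, hv, hw, pow_one,
      _root_.map_smul, LinearMap.smul_apply, smul_smul]
  | add x y hx hy => simp only [_root_.map_add, hx, hy, smul_add]

theorem swapUnitary_mul_self (F : PolyExpFunctor) (V : FinInn) :
    F.swapUnitary V * F.swapUnitary V = 1 := by
  ext y
  obtain ⟨x, rfl⟩ := (F.isExponential.tau_unitary V V).2 y
  rw [iso_mul_apply, swapUnitary_tau, swapUnitary_tau, map_map]
  have : (dcomm V V).toLinearEquiv.toLinearMap ∘ₗ (dcomm V V).toLinearEquiv.toLinearMap =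
    LinearMap.id := rfl
  rw [this, map_id]; rfl

theorem incl₂_injective (F : PolyExpFunctor) : Function.Injective F.incl₂ := by
  refine (injective_iff_map_eq_zero _).2 fun x hx => ?_
  rw [← norm_eq_zero, ← norm_tmap F.incl F.incl x]
  exact norm_eq_zero.2 hx

/-- The restriction of the swap unitary on `F ℂ ⊗ F ℂ` to `F_1 ℂ ⊗ F_1 ℂ`. -/
def rEquiv (F : PolyExpFunctor) : F.degOne.tensor F.degOne ≃ₗᵢ[ℂ] F.degOne.tensor F.degOne where
  toLinearEquiv := LinearEquiv.ofInvolutive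
    (tmap F.exists_retraction.choose F.exists_retraction.choose ∘ₗ
      (F.swapUnitary line).toLinearEquiv.toLinearMap ∘ₗ F.incl₂) fun x => F.incl₂_injective <| by
        change F.incl₂ (tmap _ _ (F.swapUnitary line (F.incl₂ (tmap _ _
          (F.swapUnitary line (F.incl₂ x)))))) = _
        rw [exists_restriction, exists_restriction, ← iso_mul_apply, swapUnitary_mul_self]
        rfl
  norm_map' x := by
    rw [← norm_tmap F.incl F.incl]
    exact (congrArg norm (F.exists_restriction x)).trans
      (((F.swapUnitary line).norm_map _).trans (norm_tmap F.incl F.incl x))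

theorem incl₂_rEquiv (F : PolyExpFunctor) (x : F.degOne.tensor F.degOne) :
    F.incl₂ (F.rEquiv x) = F.swapUnitary line (F.incl₂ x) :=
  F.exists_restriction x

/-- The inclusion `(F_1 ℂ ⊗ F_1 ℂ) ⊗ F_1 ℂ → (F ℂ ⊗ F ℂ) ⊗ F ℂ`. -/
def incl₃ (F : PolyExpFunctor) : (F.degOne.tensor F.degOne).tensor F.degOne →ₗ[ℂ]
    ((F.obj line).tensor (F.obj line)).tensor (F.obj line) :=
  tmap F.incl₂ F.incl.toLinearMap

theorem incl₃_injective (F : PolyExpFunctor) : Function.Injective F.incl₃ := by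
  refine (injective_iff_map_eq_zero _).2 fun x hx => ?_
  rw [← norm_eq_zero, ← norm_tmap ⟨F.incl₂, norm_tmap F.incl F.incl⟩ F.incl x]
  exact norm_eq_zero.2 hx

theorem incl₃_actFirst (F : PolyExpFunctor) (x : (F.degOne.tensor F.degOne).tensor F.degOne) :
    F.incl₃ (RMatrix.actFirst F.rEquiv x) =
      RMatrix.actFirst (F.swapUnitary line) (F.incl₃ x) := by
  induction x using tensor_induction with
  | zero => simp
  | tmul v w => simp [incl₃, RMatrix.actFirst, incl₂_rEquiv]
  | add x y hx hy => simp only [_root_.map_add, hx, hy]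

theorem incl₃_assoc (F : PolyExpFunctor) (v : F.degOne) (z : F.degOne.tensor F.degOne) :
    F.incl₃ ((tassoc _ _ _).symm (tmk _ _ v z)) =
      (tassoc _ _ _).symm (tmk _ _ (F.incl v) (F.incl₂ z)) := by
  induction z using tensor_induction with
  | zero => simp
  | tmul v w => simp [incl₃, incl₂]
  | add x y hx hy => simp only [_root_.map_add, hx, hy]

theorem incl₃_actLast (F : PolyExpFunctor) (x : (F.degOne.tensor F.degOne).tensor F.degOne) :
    F.incl₃ (RMatrix.actLast _ F.rEquiv x) =
      RMatrix.actLast _ (F.swapUnitary line) (F.incl₃ x) := by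
  obtain ⟨x, rfl⟩ := (tassoc _ _ _).symm.surjective x
  induction x using tensor_induction with
  | zero => simp
  | tmul v w => rw [RMatrix.actLast_assoc, incl₃_assoc, incl₃_assoc, RMatrix.actLast_assoc,
      incl₂_rEquiv]
  | add x y hx hy => simp only [_root_.map_add, hx, hy]

/-- The identification `F ((V ⊕ V) ⊕ V) → (F V ⊗ F V) ⊗ F V`. -/
def tau₃ (F : PolyExpFunctor) (V : FinInn) :
    F.obj ((V.dsum V).dsum V) →ₗ[ℂ] ((F.obj V).tensor (F.obj V)).tensor (F.obj V) :=
  tmap (F.tau V V) LinearMap.id ∘ₗ F.tau (V.dsum V) V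

theorem tau₃_surjective (F : PolyExpFunctor) (V : FinInn) : Function.Surjective (F.tau₃ V) :=
  (tcongr (F.tauUnitary V V) 1).surjective.comp (F.isExponential.tau_unitary _ _).2

theorem actFirst_tau₃ (F : PolyExpFunctor) (V : FinInn) (x : F.obj ((V.dsum V).dsum V)) :
    RMatrix.actFirst (F.swapUnitary V) (F.tau₃ V x) =
      F.tau₃ V (F.map (dmap (dcomm V V).toLinearEquiv.toLinearMap LinearMap.id) x) := by
  rw [tau₃, LinearMap.comp_apply, LinearMap.comp_apply, tau_natural_apply, map_id]
  generalize F.tau (V.dsum V) V x = y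
  induction y using tensor_induction with
  | zero => simp
  | tmul v w => simp [RMatrix.actFirst, swapUnitary_tau]
  | add x y hx hy => simp only [_root_.map_add, hx, hy]

theorem assoc_tau₃ (F : PolyExpFunctor) (V : FinInn) (x : F.obj ((V.dsum V).dsum V)) :
    tassoc _ _ _ (F.tau₃ V x) = tmap LinearMap.id (F.tau V V)
      (F.tau V (V.dsum V) (F.map (dassoc V V V).toLinearEquiv.toLinearMap x)) :=
  (LinearMap.congr_fun (F.isExponential.tau_assoc V V V) x).symm

/-- The interchange of the last two summands of `(V ⊕ V) ⊕ V`. -/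
def dcommLast (V : FinInn) : (V.dsum V).dsum V →ₗ[ℂ] (V.dsum V).dsum V :=
  (dassoc V V V).symm.toLinearEquiv.toLinearMap ∘ₗ
    dmap LinearMap.id (dcomm V V).toLinearEquiv.toLinearMap ∘ₗ
      (dassoc V V V).toLinearEquiv.toLinearMap

theorem actLast_tau₃ (F : PolyExpFunctor) (V : FinInn) (x : F.obj ((V.dsum V).dsum V)) :
    RMatrix.actLast _ (F.swapUnitary V) (F.tau₃ V x) = F.tau₃ V (F.map (dcommLast V) x) := by
  apply (tassoc _ _ _).injective
  rw [assoc_tau₃, map_map]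
  have h : (dassoc V V V).toLinearEquiv.toLinearMap ∘ₗ dcommLast V =
      dmap LinearMap.id (dcomm V V).toLinearEquiv.toLinearMap ∘ₗ
        (dassoc V V V).toLinearEquiv.toLinearMap := rfl
  rw [h, map_comp, LinearMap.comp_apply, tau_natural_apply, map_id]
  have h2 : tassoc _ _ _ (RMatrix.actLast _ (F.swapUnitary V) (F.tau₃ V x)) =
      tcongr 1 (F.swapUnitary V) (tassoc _ _ _ (F.tau₃ V x)) := by
    simp [RMatrix.actLast]
  rw [h2, assoc_tau₃]
  generalize F.tau V (V.dsum V) (F.map (dassoc V V V).toLinearEquiv.toLinearMap x) = y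
  induction y using tensor_induction with
  | zero => simp
  | tmul v w => simp [swapUnitary_tau]
  | add x y hx hy => simp only [_root_.map_add, hx, hy]

/-- The R-matrix of `F`: the restriction to `F_1 ℂ ⊗ F_1 ℂ`, regarded by means of `τ` as a subspace
of `F (ℂ ⊕ ℂ)`, of the action of the interchange of the two summands of `ℂ ⊕ ℂ`. -/
def rMatrix (F : PolyExpFunctor) : RMatrix F.degOne where
  toEquiv := F.rEquiv
  invol := by
    ext x
    apply F.incl₂_injective
    rw [iso_mul_apply, incl₂_rEquiv, incl₂_rEquiv, ← iso_mul_apply, swapUnitary_mul_self]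
    rfl
  yangBaxter := by
    ext x
    apply F.incl₃_injective
    simp only [iso_mul_apply, incl₃_actFirst, incl₃_actLast]
    obtain ⟨y, hy⟩ := F.tau₃_surjective line (F.incl₃ x)
    simp only [← hy, actFirst_tau₃, actLast_tau₃, map_map]
    rfl

end PolyExpFunctor

/-! ### The functor constructed from an R-matrix -/

namespace Inn

section DirectSum

open Classical in
/-- The inner product on an algebraic direct sum. -/
abbrev directSumCore (X : ℕ → Inn) : InnerProductSpace.Core ℂ (DirectSum ℕ fun n => X n) where
  inner x y := ∑ n ∈ x.support, inner ℂ (x n) (y n)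
  conj_inner_symm x y := by
    have h : ∀ x y : DirectSum ℕ fun n => X n, ∑ n ∈ x.support, inner ℂ (x n) (y n) =
        ∑ n ∈ x.support ∪ y.support, inner ℂ (x n) (y n) := fun x y =>
      Finset.sum_subset Finset.subset_union_left fun n _ hn => by
        rw [DFinsupp.notMem_support_iff.1 hn, inner_zero_left]
    rw [h x y, h y x, map_sum, Finset.union_comm]
    exact Finset.sum_congr rfl fun n _ => inner_conj_symm _ _
  re_inner_nonneg x := by
    rw [map_sum]
    exact Finset.sum_nonneg fun n _ => inner_self_nonneg
  add_left x y z := by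
    have h : ∀ (x : DirectSum ℕ fun n => X n) (s : Finset ℕ), x.support ⊆ s →
        ∑ n ∈ x.support, inner ℂ (x n) (z n) = ∑ n ∈ s, inner ℂ (x n) (z n) := fun x s hs =>
      Finset.sum_subset hs fun n _ hn => by
        rw [DFinsupp.notMem_support_iff.1 hn, inner_zero_left]
    rw [h (x + y) _ DFinsupp.support_add, h x _ Finset.subset_union_left,
      h y _ Finset.subset_union_right, ← Finset.sum_add_distrib]
    exact Finset.sum_congr rfl fun n _ => inner_add_left _ _ _
  smul_left x y r := by
    rw [Finset.mul_sum, Finset.sum_subset (DFinsupp.support_smul r x) fun n _ hn => by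
        rw [DFinsupp.notMem_support_iff.1 hn, inner_zero_left]]
    exact Finset.sum_congr rfl fun n _ => inner_smul_left _ _ _
  definite x hx := by
    ext n
    by_contra hn
    have h0 : ∑ n ∈ x.support, RCLike.re (inner ℂ (x n) (x n)) = 0 := by
      rw [← map_sum, hx, map_zero]
    have h1 := (Finset.sum_eq_zero_iff_of_nonneg fun n _ => inner_self_nonneg).1 h0 n
      (DFinsupp.mem_support_iff.2 hn)
    refine hn (inner_self_eq_zero (𝕜 := ℂ).1 ?_)
    rw [← inner_self_ofReal_re, h1, RCLike.ofReal_zero]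

/-- The (algebraic, orthogonal) direct sum of inner product spaces. -/
def directSum (X : ℕ → Inn) : Inn :=
  letI := (directSumCore X).toNormedAddCommGroup
  { carrier := DirectSum ℕ fun n => X n
    ips := InnerProductSpace.ofCore (directSumCore X).toCore }

/-- The inclusion of the `n`-th summand into a direct sum. -/
def dsLof (X : ℕ → Inn) (n : ℕ) : X n →ₗ[ℂ] directSum X :=
  DirectSum.lof ℂ ℕ (fun n => X n) n

/-- The projection onto the `n`-th summand. -/
def dsComponent (X : ℕ → Inn) (n : ℕ) : directSum X →ₗ[ℂ] X n :=
  DirectSum.component ℂ ℕ (fun n => X n) n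

/-- The linear map on a direct sum given by its restrictions to the summands. -/
def dsLift {X : ℕ → Inn} {E : Type*} [AddCommGroup E] [Module ℂ E] (f : ∀ n, X n →ₗ[ℂ] E) :
    directSum X →ₗ[ℂ] E :=
  DirectSum.toModule ℂ ℕ E f

/-- The direct sum of linear maps. -/
def dsMap {X Y : ℕ → Inn} (f : ∀ n, X n →ₗ[ℂ] Y n) : directSum X →ₗ[ℂ] directSum Y :=
  DirectSum.lmap f

theorem dsMap_id (X : ℕ → Inn) : dsMap (fun n => (LinearMap.id : X n →ₗ[ℂ] X n)) = LinearMap.id :=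
  DirectSum.lmap_id

theorem dsMap_comp {X Y Z : ℕ → Inn} (g : ∀ n, Y n →ₗ[ℂ] Z n) (f : ∀ n, X n →ₗ[ℂ] Y n) :
    dsMap (fun n => g n ∘ₗ f n) = dsMap g ∘ₗ dsMap f :=
  DirectSum.lmap_comp _ _

theorem tpowMap_id (V : Inn) (n : ℕ) :
    tpowMap (LinearMap.id : V →ₗ[ℂ] V) n = LinearMap.id := by
  induction n with
  | zero => rfl
  | succ n ih => rw [tpowMap, ih]; exact tensor_ext fun _ _ => rfl

theorem tpowMap_comp {V W X : Inn} (g : W →ₗ[ℂ] X) (f : V →ₗ[ℂ] W) (n : ℕ) :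
    tpowMap (g ∘ₗ f) n = tpowMap g n ∘ₗ tpowMap f n := by
  induction n with
  | zero => rfl
  | succ n ih => rw [tpowMap, ih]; exact tensor_ext fun _ _ => rfl

end DirectSum

end Inn

namespace RMatrix

open Inn FinInn

theorem actLast_naturality {T T' W W' : Inn} (R : W.tensor W ≃ₗᵢ[ℂ] W.tensor W)
    (S : W'.tensor W' ≃ₗᵢ[ℂ] W'.tensor W') (h : T →ₗ[ℂ] T') (g : W →ₗ[ℂ] W')
    (hg : ∀ x, tmap g g (R x) = S (tmap g g x)) (x : (T.tensor W).tensor W) :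
    tmap (tmap h g) g (actLast T R x) = actLast T' S (tmap (tmap h g) g x) := by
  have h1 : ∀ (t : T) (z : W.tensor W), tmap (tmap h g) g ((tassoc T W W).symm (tmk _ _ t z)) =
      (tassoc T' W' W').symm (tmk _ _ (h t) (tmap g g z)) := by
    intro t z
    induction z using tensor_induction with
    | zero => simp
    | tmul x y => simp
    | add a b ha hb => simp only [map_add, ha, hb]
  obtain ⟨x, rfl⟩ := (tassoc T W W).symm.surjective x
  induction x using tensor_induction with
  | zero => simp
  | tmul t z => rw [actLast_assoc, h1, h1, hg, actLast_assoc]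
  | add a b ha hb => simp only [map_add, ha, hb]

theorem tcongr_naturality {T T' W W' : Inn} (a : T ≃ₗᵢ[ℂ] T) (b : T' ≃ₗᵢ[ℂ] T')
    (h : T →ₗ[ℂ] T') (g : W →ₗ[ℂ] W') (hh : ∀ x, h (a x) = b (h x)) (x : T.tensor W) :
    tmap h g (tcongr a 1 x) = tcongr b 1 (tmap h g x) := by
  induction x using tensor_induction with
  | zero => simp
  | tmul x y => simp [hh]
  | add a b ha hb => simp only [map_add, ha, hb]

theorem site_naturality {W W' : Inn} (R : W.tensor W ≃ₗᵢ[ℂ] W.tensor W)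
    (S : W'.tensor W' ≃ₗᵢ[ℂ] W'.tensor W') (g : W →ₗ[ℂ] W')
    (hg : ∀ x, tmap g g (R x) = S (tmap g g x)) (n i : ℕ) (x : W.tpow (n + 1)) :
    tpowMap g (n + 1) (site R (n + 1) i x) = site S (n + 1) i (tpowMap g (n + 1) x) := by
  induction n with
  | zero => rfl
  | succ n ih =>
    by_cases h : i = n
    · subst h
      rw [site_last, site_last]
      exact actLast_naturality R S (tpowMap g i) g hg x
    · rw [site_ne _ _ _ h, site_ne _ _ _ h]
      exact tcongr_naturality _ _ (tpowMap g (n + 1)) g ih x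

/-- A linear map `g` with `(g ⊗ g) R = S (g ⊗ g)` has tensor powers that intertwine the associated
representations. -/
theorem rep_naturality {W W' : Inn} (R : RMatrix W) (S : RMatrix W') (g : W →ₗ[ℂ] W')
    (hg : ∀ x, tmap g g (R.toEquiv x) = S.toEquiv (tmap g g x)) (n : ℕ)
    (σ : Equiv.Perm (Fin n)) (x : W.tpow n) :
    tpowMap g n (R.rep n σ x) = S.rep n σ (tpowMap g n x) := by
  cases n with
  | zero => rfl
  | succ n =>
    have hσ : σ ∈ Submonoid.closure
        (Set.range fun i : Fin n => Equiv.swap i.castSucc i.succ) := by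
      rw [Equiv.Perm.mclosure_swap_castSucc_succ]; trivial
    induction hσ using Submonoid.closure_induction_left generalizing x with
    | one => rw [map_one, map_one]; rfl
    | mul_left a ha b hb ih =>
      obtain ⟨i, rfl⟩ := ha
      rw [map_mul, map_mul, iso_mul_apply, iso_mul_apply, rep_swap, rep_swap, ← ih]
      exact site_naturality _ _ g hg n i _

variable {W : Inn}

/-- The R-matrix `R ⊠ T` on `W ⊗ V`, where `T` interchanges the factors of `V ⊗ V`. -/
def boxFlip (R : RMatrix W) (V : FinInn) : RMatrix (W.tensor V.toInn) :=
  R.boxTensor (flip V.toInn)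

/-- The space of invariants `((W ⊗ V) ^ ⊗ n) ^ {S_n}`, where `S_n` acts by the representation
associated to `R ⊠ T`. -/
def invariants (R : RMatrix W) (V : FinInn) (n : ℕ) :
    Submodule ℂ ((W.tensor V.toInn).tpow n) where
  carrier := {x | ∀ σ, (R.boxFlip V).rep n σ x = x}
  add_mem' hx hy σ := by rw [map_add, hx σ, hy σ]
  zero_mem' σ := map_zero _
  smul_mem' a x hx σ := by rw [map_smul, hx σ]

/-- The homogeneous component `F^R_n V = ((W ⊗ V) ^ ⊗ n) ^ {S_n}`. -/
def expComponent (R : RMatrix W) (V : FinInn) (n : ℕ) : Inn := ⟨R.invariants V n⟩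

/-- The inclusion of the invariants. -/
def expIncl (R : RMatrix W) (V : FinInn) (n : ℕ) :
    R.expComponent V n →ₗ[ℂ] (W.tensor V.toInn).tpow n :=
  (R.invariants V n).subtype

theorem tpowMap_mem (R : RMatrix W) {V V' : FinInn} (f : V →ₗ[ℂ] V') (n : ℕ)
    (x : R.expComponent V n) :
    tpowMap (tmap LinearMap.id f : W.tensor V.toInn →ₗ[ℂ] W.tensor V'.toInn) n (R.expIncl V n x) ∈
      R.invariants V' n := by
  intro σ
  rw [← rep_naturality (R.boxFlip V)]
  · exact congrArg _ (x.2 σ)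
  · intro x
    obtain ⟨x, rfl⟩ := (tmid W V.toInn W V.toInn).symm.surjective x
    have h : ∀ x, tmap (tmap LinearMap.id f) (tmap LinearMap.id f)
        ((tmid W V.toInn W V.toInn).symm x) =
        (tmid W V'.toInn W V'.toInn).symm (tmap LinearMap.id (tmap f f) x) := by
      intro x
      induction x using tensor_induction with
      | zero => simp
      | tmul a b =>
        induction a using tensor_induction with
        | zero => simp
        | tmul w w' =>
          induction b using tensor_induction with
          | zero => simp
          | tmul v v' => rw [tmid_symm_tmk]; simp
          | add a b ha hb => simp only [map_add, ha, hb]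
        | add a b ha hb => simp only [map_add, LinearMap.add_apply, ha, hb]
      | add a b ha hb => simp only [map_add, ha, hb]
    have h' : ∀ y, tmap f f (tcomm V.toInn V.toInn y) = tcomm V'.toInn V'.toInn (tmap f f y) := by
      intro y
      induction y using tensor_induction with
      | zero => simp
      | tmul v v' => simp
      | add a b ha hb => simp only [map_add, ha, hb]
    induction x using tensor_induction with
    | zero => simp
    | tmul a b =>
      simp only [boxFlip, boxTensor, flip, boxEquiv_tmid, h, tmap_tmk, h', LinearMap.id_apply]
    | add a b ha hb => simp only [map_add, ha, hb]

/-- The map `F^R_n f : F^R_n V → F^R_n V'`, the restriction of `(id ⊗ f) ^ ⊗ n`. -/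
def expComponentMap (R : RMatrix W) {V V' : FinInn} (f : V →ₗ[ℂ] V') (n : ℕ) :
    R.expComponent V n →ₗ[ℂ] R.expComponent V' n :=
  LinearMap.codRestrict (R.invariants V' n)
    (tpowMap (tmap LinearMap.id f : W.tensor V.toInn →ₗ[ℂ] W.tensor V'.toInn) n ∘ₗ R.expIncl V n)
    (R.tpowMap_mem f n)

theorem expIncl_injective (R : RMatrix W) (V : FinInn) (n : ℕ) :
    Function.Injective (R.expIncl V n) :=
  Subtype.val_injective

theorem expIncl_map (R : RMatrix W) {V V' : FinInn} (f : V →ₗ[ℂ] V') (n : ℕ)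
    (x : R.expComponent V n) :
    R.expIncl V' n (R.expComponentMap f n x) =
      tpowMap (tmap LinearMap.id f : W.tensor V.toInn →ₗ[ℂ] W.tensor V'.toInn) n
        (R.expIncl V n x) := rfl

/-- The functor `F^R V = ⨁ n, ((W ⊗ V) ^ ⊗ n) ^ {S_n}`. -/
def expFunctor (R : RMatrix W) : FinInn ⥤ Inn where
  obj V := directSum (R.expComponent V)
  map f := dsMap (R.expComponentMap f)
  map_id V := by
    have h : R.expComponentMap (LinearMap.id : V →ₗ[ℂ] V) = fun n => LinearMap.id := by
      ext n x
      apply R.expIncl_injective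
      have : (tmap LinearMap.id LinearMap.id : W.tensor V.toInn →ₗ[ℂ] W.tensor V.toInn) =
        LinearMap.id := tensor_ext fun _ _ => rfl
      rw [expIncl_map, this, tpowMap_id]
      rfl
    exact (congrArg dsMap h).trans (dsMap_id _)
  map_comp {V V' V''} f g := by
    have h : R.expComponentMap ((g : V' →ₗ[ℂ] V'') ∘ₗ (f : V →ₗ[ℂ] V')) =
        fun n => R.expComponentMap g n ∘ₗ R.expComponentMap f n := by
      ext n x
      apply R.expIncl_injective
      have : (tmap LinearMap.id ((g : V' →ₗ[ℂ] V'') ∘ₗ (f : V →ₗ[ℂ] V')) :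
          W.tensor V.toInn →ₗ[ℂ] W.tensor V''.toInn) =
        tmap LinearMap.id (g : V' →ₗ[ℂ] V'') ∘ₗ tmap LinearMap.id (f : V →ₗ[ℂ] V') :=
          tensor_ext fun _ _ => rfl
      rw [LinearMap.comp_apply, expIncl_map, expIncl_map, expIncl_map, this, tpowMap_comp]
      rfl
    exact (congrArg dsMap h).trans (dsMap_comp _ _)

/-- The embedding `(W ⊗ V₁) ^ ⊗ i ⊗ (W ⊗ V₂) ^ ⊗ j → (W ⊗ (V₁ ⊕ V₂)) ^ ⊗ (i + j)` induced by the
inclusions of `V₁` and `V₂` into `V₁ ⊕ V₂`. -/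
def iotaMap (W : Inn) (V₁ V₂ : FinInn) (i j : ℕ) :
    ((W.tensor V₁.toInn).tpow i).tensor ((W.tensor V₂.toInn).tpow j) →ₗ[ℂ]
      (W.tensor (V₁.dsum V₂).toInn).tpow (i + j) :=
  tpowMul (W.tensor (V₁.dsum V₂).toInn) i j ∘ₗ
    tmap (tpowMap (tmap LinearMap.id (dinl V₁ V₂)) i) (tpowMap (tmap LinearMap.id (dinr V₁ V₂)) j)

open scoped Nat in
/-- The map `φ_{i,j}`: with `n = i + j` and `N = n! / (i! j!)` it is `N ^ (-1/2)` times the sum of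
`σ · iotaMap x` over representatives `σ` of the cosets in `S_n / (S_i × S_j)`. It is only applied
to elements `x` that are invariant under `S_i × S_j`, and for these every coset contributes `i! j!`
times the same vector to the sum over all of `S_n`, which leads to the factor
`N ^ (-1/2) / (i! j!) = (n! i! j!) ^ (-1/2)`. -/
def phiMap (R : RMatrix W) (V₁ V₂ : FinInn) (i j : ℕ) :
    ((W.tensor V₁.toInn).tpow i).tensor ((W.tensor V₂.toInn).tpow j) →ₗ[ℂ]
      (W.tensor (V₁.dsum V₂).toInn).tpow (i + j) :=
  ((Real.sqrt ((i + j)! * i ! * j ! : ℕ) : ℝ) : ℂ)⁻¹ •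
    ∑ σ : Equiv.Perm (Fin (i + j)),
      ((R.boxFlip (V₁.dsum V₂)).rep (i + j) σ).toLinearEquiv.toLinearMap ∘ₗ iotaMap W V₁ V₂ i j

theorem phiMap_mem (R : RMatrix W) (V₁ V₂ : FinInn) (i j : ℕ)
    (x : ((W.tensor V₁.toInn).tpow i).tensor ((W.tensor V₂.toInn).tpow j)) :
    R.phiMap V₁ V₂ i j x ∈ R.invariants (V₁.dsum V₂) (i + j) := by
  intro σ
  simp only [phiMap, LinearMap.smul_apply, LinearMap.sum_apply, LinearMap.comp_apply]
  rw [map_smul, map_sum]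
  congr 1
  refine Fintype.sum_equiv (Equiv.mulLeft σ) _ _ fun τ => ?_
  rw [Equiv.coe_mulLeft, map_mul]
  rfl

/-- The restriction `F^R_i V₁ ⊗ F^R_j V₂ → F^R_{i + j} (V₁ ⊕ V₂)` of `φ_{i,j}` to invariants. -/
def kappaComponent (R : RMatrix W) (V₁ V₂ : FinInn) (i j : ℕ) :
    (R.expComponent V₁ i).tensor (R.expComponent V₂ j) →ₗ[ℂ]
      R.expComponent (V₁.dsum V₂) (i + j) :=
  LinearMap.codRestrict (R.invariants (V₁.dsum V₂) (i + j))
    (R.phiMap V₁ V₂ i j ∘ₗ tmap (R.expIncl V₁ i) (R.expIncl V₂ j))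
    fun _ => R.phiMap_mem V₁ V₂ i j _

/-- The map `κ : F^R V₁ ⊗ F^R V₂ → F^R (V₁ ⊕ V₂)`, the sum of all the maps `kappaComponent`. -/
def kappa (R : RMatrix W) (V₁ V₂ : FinInn) :
    (directSum (R.expComponent V₁)).tensor (directSum (R.expComponent V₂)) →ₗ[ℂ]
      directSum (R.expComponent (V₁.dsum V₂)) :=
  tlift (dsLift fun i => LinearMap.flip (dsLift fun j => LinearMap.flip (LinearMap.compr₂
    (tmk (R.expComponent V₁ i) (R.expComponent V₂ j))
    (dsLof (R.expComponent (V₁.dsum V₂)) (i + j) ∘ₗ R.kappaComponent V₁ V₂ i j))))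

open Classical in
/-- The exponential functor `F^R` built from an R-matrix: the functor `F^R`, the inverse `τ` of
`κ` (where `κ` is bijective, otherwise `0`), and the projection `ι : F^R 0 → F^R_0 0 = ℂ`. -/
def expDatum (R : RMatrix W) : ExpDatum where
  functor := R.expFunctor
  tau V₁ V₂ := if h : Function.Bijective (R.kappa V₁ V₂) then
    (LinearEquiv.ofBijective (R.kappa V₁ V₂) h).symm.toLinearMap else 0
  iota := R.expIncl zero 0 ∘ₗ dsComponent (R.expComponent zero) 0

end RMatrix

end

/-! From left to right the equivalence is formal. A monoidal isomorphism respects degrees, `τ` and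
the action of the swap of `ℂ ⊕ ℂ`, so it restricts to a unitary from `F_1 ℂ` to `G_1 ℂ` that
intertwines the R-matrices (`MonoidallyIso.stronglyEquivalent`).

Everything else follows from one comparison. Let `u : W → F_1 ℂ` be a unitary that carries `R` to
the R-matrix of `F` (`Intertwines`). Then `F^R` is unitarily isomorphic to `F`, naturally and
compatibly with `τ` and `ι`. With `u = id` this gives the claim about `F^R`, whose axioms are
transported from `F` (`isExponential_of_iso`, `isPolynomial_of_iso`). With the same `R` and two
different targets it shows that strongly equivalent R-matrices come from isomorphic functors, since
both functors are isomorphic to `F^R`.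

For the comparison, `F V` is treated as a Fock space. The codiagonal and the diagonal of `V` make it
an algebra and a coalgebra whose structure maps are adjoint. It is the sum of its mutually
orthogonal homogeneous components, and the component of degree one is `W ⊗ V` by way of `gen`.
Multiplying `n` generators gives `prodGen` from the `n`-th tensor power of `W ⊗ V` to `F_n V`. The
codiagonal does not see the swap of its two summands, so `prodGen` is invariant under the
representation of `R ⊠ T` (`prodGen_rep`).

Multiplication by a generator is a creation operator, and its adjoint annihilates: it takes the part
of the coproduct whose second leg has degree one. Two relations carry the proof. `create_annihilate`
says that annihilation followed by creation is `n` on degree `n`, hence products of generators span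
(`exists_prodGen`). `annihilate_create` is a canonical commutation relation twisted by `R ⊠ T`; by
induction it shows that on invariants `prodGen` multiplies inner products by `n!`
(`inner_prodGen_prodGen`). Both come from differentiating a polynomial identity at `t = 0`, because
the derivative of `F (t id)` there is the projection onto degree one (`hasDerivAt_map_smul_id`).

Dividing by the square root of `n!` therefore gives a unitary `fock` from `F^R V` to `F V`. Since
the inverse of `τ` is a product of images under the two inclusions, `fock` turns `κ` into the
inverse of `τ` (`tau_fock_kappa`). So `κ` is bijective and `F^R` inherits the structure of `F`. -/

open CategoryTheory

noncomputable section

/-! ### Elementary maps of direct sums and points of a space -/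

namespace FinInn

variable {V V' W W' X : FinInn}

/-- The diagonal map `V → V ⊕ V`. -/
def ddiag (V : FinInn) : V →ₗ[ℂ] V.dsum V :=
  dinl V V + dinr V V

/-- The first projection `V ⊕ W → V`. -/
def dfst (V W : FinInn) : V.dsum W →ₗ[ℂ] V :=
  LinearMap.fst ℂ V W ∘ₗ (WithLp.linearEquiv 2 ℂ (V × W)).toLinearMap

/-- The second projection `V ⊕ W → W`. -/
def dsnd (V W : FinInn) : V.dsum W →ₗ[ℂ] W :=
  LinearMap.snd ℂ V W ∘ₗ (WithLp.linearEquiv 2 ℂ (V × W)).toLinearMap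

/-- The codiagonal map `V ⊕ V → V`. -/
def dcodiag (V : FinInn) : V.dsum V →ₗ[ℂ] V :=
  dfst V V + dsnd V V

/-- The linear map `ℂ → V` with value `v` at `1`. -/
def pt (v : V) : line →ₗ[ℂ] V :=
  LinearMap.toSpanSingleton ℂ V v

@[simp] theorem dfst_dpair (v : V) (w : W) : dfst V W (dpair v w) = v := rfl

@[simp] theorem dsnd_dpair (v : V) (w : W) : dsnd V W (dpair v w) = w := rfl

theorem dpair_add (v v' : V) (w w' : W) : dpair v w + dpair v' w' = dpair (v + v') (w + w') := rfl

theorem smul_dpair (l : ℂ) (v : V) (w : W) : l • dpair v w = dpair (l • v) (l • w) := rfl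

@[simp] theorem ddiag_apply (v : V) : ddiag V v = dpair v v := by
  rw [ddiag, LinearMap.add_apply, dinl_apply, dinr_apply, dpair_add, add_zero, zero_add]

@[simp] theorem dcodiag_dpair (v w : V) : dcodiag V (dpair v w) = v + w := rfl

theorem dsum_ext {f g : V.dsum W →ₗ[ℂ] X} (h : ∀ v w, f (dpair v w) = g (dpair v w)) : f = g :=
  LinearMap.ext fun x => by obtain ⟨v, w, rfl⟩ := exists_dpair x; exact h v w

theorem inner_dpair (v v' : V) (w w' : W) :
    inner ℂ (dpair v w) (dpair v' w') = inner ℂ v v' + inner ℂ w w' :=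
  WithLp.prod_inner_apply (𝕜 := ℂ) (WithLp.toLp 2 (v, w)) (WithLp.toLp 2 (v', w'))

/-- As `F` preserves adjoints, this is what makes the product and the coproduct of `F V` adjoint to
each other. -/
theorem adjoint_ddiag (V : FinInn) : LinearMap.adjoint (ddiag V) = dcodiag V := by
  symm
  rw [LinearMap.eq_adjoint_iff]
  intro x y
  obtain ⟨v, w, rfl⟩ := exists_dpair x
  rw [ddiag_apply, dcodiag_dpair, inner_dpair, inner_add_left]

theorem comp_pt (f : V →ₗ[ℂ] W) (v : V) : f ∘ₗ pt v = pt (f v) :=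
  LinearMap.ext fun l => f.map_smul (show ℂ from l) v

theorem pt_add (v w : V) : pt (v + w) = pt v + pt w :=
  LinearMap.ext fun l => smul_add (show ℂ from l) v w

theorem pt_smul (l : ℂ) (v : V) : pt (l • v) = l • pt v :=
  LinearMap.ext fun k => smul_comm (show ℂ from k) l v

/-- The scalar acts on elements of degree one of `F ℂ` as itself, which is how the inner product of
`V` enters that of `F V`. -/
theorem adjoint_pt_comp_pt (v w : V) :
    LinearMap.adjoint (pt v) ∘ₗ pt w = inner ℂ v w • LinearMap.id := by
  have key : ∀ k l : line, inner ℂ k (LinearMap.adjoint (pt v) (pt w l)) =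
      inner ℂ k (inner ℂ v w • l) := by
    intro k l
    rw [LinearMap.adjoint_inner_right]
    change inner ℂ ((show ℂ from k) • v) ((show ℂ from l) • w) = _
    rw [inner_smul_left, inner_smul_right, inner_smul_right]
    change _ = _ * ((show ℂ from l) * (starRingEnd ℂ) (show ℂ from k))
    ring
  exact LinearMap.ext fun l => ext_inner_left ℂ fun k => key k l

end FinInn

/-! ### Tensor products of linear maps, and tensors expanded in a basis -/

namespace Inn

variable {V V' V'' W W' W'' X Z : Inn}

theorem tmap_id : tmap (LinearMap.id : V →ₗ[ℂ] V) (LinearMap.id : W →ₗ[ℂ] W) = LinearMap.id :=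
  tensor_ext fun _ _ => rfl

theorem tmap_comp (f' : V' →ₗ[ℂ] V'') (f : V →ₗ[ℂ] V') (g' : W' →ₗ[ℂ] W'') (g : W →ₗ[ℂ] W') :
    tmap (f' ∘ₗ f) (g' ∘ₗ g) = tmap f' g' ∘ₗ tmap f g :=
  tensor_ext fun _ _ => rfl

theorem tmap_tmap (f' : V' →ₗ[ℂ] V'') (f : V →ₗ[ℂ] V') (g' : W' →ₗ[ℂ] W'') (g : W →ₗ[ℂ] W')
    (z : V.tensor W) : tmap f' g' (tmap f g z) = tmap (f' ∘ₗ f) (g' ∘ₗ g) z := by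
  rw [tmap_comp, LinearMap.comp_apply]

theorem inner_tmk (v₁ v₂ : V) (w₁ w₂ : W) :
    inner ℂ (tmk V W v₁ w₁) (tmk V W v₂ w₂) = inner ℂ v₁ v₂ * inner ℂ w₁ w₂ :=
  TensorProduct.inner_tmul ℂ v₁ v₂ w₁ w₂

/-- Adjoint maps have adjoint tensor products. -/
theorem inner_tmap {f : V →ₗ[ℂ] V'} {f' : V' →ₗ[ℂ] V} {g : W →ₗ[ℂ] W'} {g' : W' →ₗ[ℂ] W}
    (hf : ∀ x y, inner ℂ (f x) y = inner ℂ x (f' y))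
    (hg : ∀ x y, inner ℂ (g x) y = inner ℂ x (g' y)) (x : V.tensor W) (y : V'.tensor W') :
    inner ℂ (tmap f g x) y = inner ℂ x (tmap f' g' y) := by
  induction x using tensor_induction with
  | zero => simp
  | tmul v w =>
    induction y using tensor_induction with
    | zero => simp
    | tmul v' w' => simp only [tmap_tmk, inner_tmk, hf, hg]
    | add a b ha hb => simp only [map_add, inner_add_right, ha, hb]
  | add a b ha hb => simp only [map_add, inner_add_left, ha, hb]

instance [FiniteDimensional ℂ V] [FiniteDimensional ℂ W] : FiniteDimensional ℂ (V.tensor W) :=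
  inferInstanceAs (FiniteDimensional ℂ (TensorProduct ℂ V W))

instance : FiniteDimensional ℂ unit := inferInstanceAs (FiniteDimensional ℂ ℂ)

/-- Every element of `V ⊗ W` is a sum `∑ xₖ ⊗ bₖ` for a given basis `b` of `W`. -/
theorem exists_eq_sum_tmk {ι : Type*} [Fintype ι] (b : Module.Basis ι ℂ W) (y : V.tensor W) :
    ∃ x : ι → V, y = ∑ k, tmk V W (x k) (b k) := by
  induction y using tensor_induction with
  | zero => exact ⟨0, by simp⟩
  | tmul v w =>
    refine ⟨fun k => b.repr w k • v, ?_⟩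
    conv_lhs => rw [← b.sum_repr w]
    simp only [map_sum, map_smul, LinearMap.smul_apply]
  | add p q hp hq =>
    obtain ⟨x, rfl⟩ := hp
    obtain ⟨x', rfl⟩ := hq
    exact ⟨x + x', by simp [Finset.sum_add_distrib]⟩

/-- Contracting the second factor with a coordinate functional recovers each coefficient. -/
theorem sum_tmk_injective {ι : Type*} [Fintype ι] (b : Module.Basis ι ℂ W) {x x' : ι → V}
    (h : ∑ k, tmk V W (x k) (b k) = ∑ k, tmk V W (x' k) (b k)) : x = x' := by
  classical
  funext k
  -- The contraction of the second factor with the `k`-th coordinate picks out `x k`.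
  have hk : ∀ x : ι → V, tlift (LinearMap.lsmul ℂ V ∘ₗ b.coord k).flip (∑ k, tmk V W (x k) (b k)) =
      x k := by
    intro x
    rw [map_sum, Finset.sum_eq_single k]
    · simp
    · intro l _ hl
      simp [hl]
    · simp
  rw [← hk x, h, hk]

/-- Two maps that agree on the vectors fixed by a family of isometries have tensor products with
the identity that agree on the tensors fixed by this family. -/
theorem tmap_eq_of_fixed {ι : Sort*} [FiniteDimensional ℂ W] (s : ι → (V ≃ₗᵢ[ℂ] V))
    (f g : V →ₗ[ℂ] V') (h : ∀ x, (∀ i, s i x = x) → f x = g x) (y : V.tensor W)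
    (hy : ∀ i, tcongr (s i) 1 y = y) :
    tmap f (LinearMap.id : W →ₗ[ℂ] W) y = tmap g LinearMap.id y := by
  obtain ⟨x, rfl⟩ := exists_eq_sum_tmk (Module.finBasis ℂ W) y
  have hx : ∀ i k, s i (x k) = x k := by
    intro i k
    have := hy i
    rw [map_sum] at this
    exact congrFun (sum_tmk_injective (x := fun k => s i (x k)) _ this) k
  simp only [map_sum, tmap_tmk]
  exact Finset.sum_congr rfl fun k _ => by rw [h _ fun i => hx i k]

end Inn

namespace PolyExpFunctor

open FinInn Inn ExpDatum

variable (F : PolyExpFunctor) {V W X : FinInn}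

instance : FiniteDimensional ℂ (F.obj V) := F.isExponential.finiteDimensional V

instance : FiniteDimensional ℂ F.degOne :=
  inferInstanceAs (FiniteDimensional ℂ (F.component 1 line))

/-! ### The algebra `F V` -/

/-- The multiplication `F V ⊗ F V → F V` induced by the codiagonal map `V ⊕ V → V`. -/
def mul (V : FinInn) : (F.obj V).tensor (F.obj V) →ₗ[ℂ] F.obj V :=
  F.map (dcodiag V) ∘ₗ (F.tauUnitary V V).symm.toLinearEquiv.toLinearMap

/-- The comultiplication `F V → F V ⊗ F V` induced by the diagonal map `V → V ⊕ V`. -/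
def comul (V : FinInn) : F.obj V →ₗ[ℂ] (F.obj V).tensor (F.obj V) :=
  F.tau V V ∘ₗ F.map (ddiag V)

theorem mul_tau (x : F.obj (V.dsum V)) : F.mul V (F.tau V V x) = F.map (dcodiag V) x :=
  congrArg (F.map (dcodiag V)) ((F.tauUnitary V V).symm_apply_apply x)

theorem tau_surjective (V W : FinInn) : Function.Surjective (F.tau V W) :=
  (F.isExponential.tau_unitary V W).2

theorem tau_injective (V W : FinInn) : Function.Injective (F.tau V W) :=
  (F.tauUnitary V W).injective

/-- The map `τ` is unitary, `F` preserves adjoints, and the codiagonal is the adjoint of the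
diagonal. -/
theorem inner_mul (z : (F.obj V).tensor (F.obj V)) (a : F.obj V) :
    inner ℂ (F.mul V z) a = inner ℂ z (F.comul V a) := by
  obtain ⟨x, rfl⟩ := F.tau_surjective V V z
  rw [mul_tau, comul, ← adjoint_ddiag, F.isExponential.map_adjoint, LinearMap.adjoint_adjoint]
  exact ((F.tauUnitary V V).inner_map_map _ _).symm

theorem map_mul (f : V →ₗ[ℂ] W) (z : (F.obj V).tensor (F.obj V)) :
    F.map f (F.mul V z) = F.mul W (tmap (F.map f) (F.map f) z) := by
  obtain ⟨x, rfl⟩ := F.tau_surjective V V z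
  rw [mul_tau, ← tau_natural_apply, mul_tau, map_map, map_map]
  congr 2
  exact dsum_ext fun v w => by simp

theorem mul_map_map {X : FinInn} (f : V →ₗ[ℂ] X) (g : W →ₗ[ℂ] X) (x : F.obj (V.dsum W)) :
    F.mul X (tmap (F.map f) (F.map g) (F.tau V W x)) = F.map (dcodiag X ∘ₗ dmap f g) x := by
  rw [← tau_natural_apply, mul_tau, map_map]

/-- The sum of the two inclusions, as a map out of `V ⊕ W`, is the identity. This expresses the
inverse of `τ` by the product alone, the form in which `τ` is later compared with `κ`. -/
theorem tau_mul_inl_inr (z : (F.obj V).tensor (F.obj W)) :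
    F.tau V W (F.mul (V.dsum W) (tmap (F.map (dinl V W)) (F.map (dinr V W)) z)) = z := by
  obtain ⟨x, rfl⟩ := F.tau_surjective V W z
  rw [mul_map_map]
  have : dcodiag (V.dsum W) ∘ₗ dmap (dinl V W) (dinr V W) = LinearMap.id :=
    dsum_ext fun v w => by simp [dpair_add]
  rw [this, map_id, LinearMap.id_apply]

/-- The coherence of `τ` turns both sides into `F` of the map `((v, v'), w) ↦ v + v' + w`. -/
theorem mul_assoc_apply (z : ((F.obj V).tensor (F.obj V)).tensor (F.obj V)) :
    F.mul V (tmap (F.mul V) LinearMap.id z) =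
      F.mul V (tmap LinearMap.id (F.mul V) (tassoc _ _ _ z)) := by
  obtain ⟨x, rfl⟩ := F.tau₃_surjective V z
  have h : F.mul V ∘ₗ F.tau V V = F.map (dcodiag V) := LinearMap.ext fun x => F.mul_tau x
  rw [assoc_tau₃, tmap_tmap, h, LinearMap.id_comp, tau₃, LinearMap.comp_apply, tmap_tmap, h,
    LinearMap.id_comp, ← map_id, mul_map_map, mul_map_map, map_map]
  congr 2
  refine dsum_ext fun v w => ?_
  obtain ⟨v, v', rfl⟩ := exists_dpair v
  simp [add_assoc]

/-- The element of `F 0` that corresponds to `1`. -/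
def vacuum : F.obj zero := (F.isExponential.iota_unitary.2 (1 : ℂ)).choose

theorem iota_vacuum : F.iota F.vacuum = (1 : ℂ) :=
  (F.isExponential.iota_unitary.2 (1 : ℂ)).choose_spec

theorem iota_injective : Function.Injective F.iota := by
  refine (injective_iff_map_eq_zero _).2 fun x hx => ?_
  rw [← norm_eq_zero, ← F.isExponential.iota_unitary.1, hx, norm_zero]

/-- Since `ι` is a bijection onto `ℂ`, the space `F 0` is a line. -/
theorem eq_smul_vacuum (x : F.obj zero) : x = (show ℂ from F.iota x) • F.vacuum := by
  apply F.iota_injective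
  rw [map_smul, iota_vacuum]
  exact (mul_one (show ℂ from F.iota x)).symm

/-- The unit of the algebra `F V`. -/
def one (V : FinInn) : F.obj V := F.map (0 : zero →ₗ[ℂ] V) F.vacuum

theorem map_one (f : V →ₗ[ℂ] W) : F.map f (F.one V) = F.one W := by
  rw [one, map_map, LinearMap.comp_zero, one]

theorem mul_one (a : F.obj V) : F.mul V (tmk _ _ a (F.one V)) = a := by
  obtain ⟨x, hx⟩ := F.tau_surjective V zero (tmk _ _ a F.vacuum)
  have h : tmk _ _ a (F.one V) = tmap (F.map LinearMap.id) (F.map (0 : zero →ₗ[ℂ] V))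
      (tmk _ _ a F.vacuum) := by rw [tmap_tmk, map_id]; rfl
  have h1 : dcodiag V ∘ₗ dmap LinearMap.id (0 : zero →ₗ[ℂ] V) =
      (drid V).toLinearEquiv.toLinearMap := dsum_ext fun v w => by simp
  rw [h, ← hx, mul_map_map, h1, ← F.isExponential.iota_right]
  simp only [LinearMap.comp_apply, hx, tmap_tmk, iota_vacuum]
  exact one_smul ℂ a

theorem tau_one (V W : FinInn) : F.tau V W (F.one (V.dsum W)) = tmk _ _ (F.one V) (F.one W) := by
  have h := F.tau_mul_inl_inr (V := V) (W := W) (tmk _ _ (F.one V) (F.one W))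
  rwa [tmap_tmk, map_one, map_one, mul_one] at h

theorem inner_map_map_adjoint {f : V →ₗ[ℂ] X} {g : W →ₗ[ℂ] X} (x : F.obj V) (y : F.obj W) :
    inner ℂ (F.map f x) (F.map g y) = inner ℂ x (F.map (LinearMap.adjoint f ∘ₗ g) y) := by
  rw [F.isExponential.map_adjoint, map_map]

end PolyExpFunctor

namespace PolyExpFunctor

open FinInn Inn ExpDatum

variable (F : PolyExpFunctor) {V W X : FinInn}

/-! ### Homogeneous components -/

/-- The hypothesis that `F` is polynomial enters the arguments with derivatives through this lemma.
-/
theorem differentiable_map (n : ℕ) (f : Fin n → (V →ₗ[ℂ] W)) (x : F.obj V) :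
    Differentiable ℂ fun l : Fin n → ℂ => F.map (∑ i, l i • f i) x := by
  obtain ⟨c, hc⟩ := F.isPolynomial V W n f
  have : (fun l : Fin n → ℂ => F.map (∑ i, l i • f i) x) =
      fun l => ∑ m ∈ c.support, (∏ i, l i ^ m i) • c m x := by
    funext l
    rw [hc, Finsupp.sum, LinearMap.sum_apply]
    rfl
  rw [this]
  fun_prop

theorem differentiable_map_affine (f g : V →ₗ[ℂ] W) (x : F.obj V) :
    Differentiable ℂ fun t : ℂ => F.map (f + t • g) x := by
  have h := (F.differentiable_map 2 ![f, g] x).comp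
    (show Differentiable ℂ fun t : ℂ => ![1, t] by
      rw [differentiable_pi]; intro i; fin_cases i <;> simp)
  simpa [Function.comp_def, Fin.sum_univ_two] using h

/-- A differentiable function that is homogeneous of degree one is additive. -/
theorem _root_.map_add_of_homogeneous {E E' : Type*} [NormedAddCommGroup E] [NormedSpace ℂ E]
    [NormedAddCommGroup E'] [NormedSpace ℂ E'] {g : E → E'} (hd : DifferentiableAt ℂ g 0)
    (hg : ∀ (s : ℂ) x, g (s • x) = s • g x) (x y : E) : g (x + y) = g x + g y := by
  -- By homogeneity `s ↦ g (s x)` is `s ↦ s g x`, with derivative `g x` at `0`. By the chain rule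
  -- this is also the derivative of `g` at `0` applied to `x`, which is linear in `x`.
  have key : ∀ x, g x = fderiv ℂ g 0 x := by
    intro x
    have h1 : HasDerivAt (fun s : ℂ => s • x) x 0 := by
      simpa using (hasDerivAt_id (0 : ℂ)).smul_const x
    have h2 : HasDerivAt (fun s : ℂ => g (s • x)) (fderiv ℂ g 0 x) 0 :=
      HasFDerivAt.comp_hasDerivAt (0 : ℂ) (by simpa using hd.hasFDerivAt) h1
    simp only [hg] at h2
    exact (by simpa using (hasDerivAt_id (0 : ℂ)).smul_const (g x) :
      HasDerivAt (fun s : ℂ => s • g x) (g x) 0).unique h2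
  rw [key, key x, key y, map_add]

/-- If `F (h + a f + b g) x` is homogeneous of degree one in `(a, b)` then it is additive. -/
theorem map_add_of_homogeneous (h f g : V →ₗ[ℂ] W) (x : F.obj V)
    (H : ∀ s a b : ℂ, F.map (h + (s * a) • f + (s * b) • g) x = s • F.map (h + a • f + b • g) x)
    (a b : ℂ) :
    F.map (h + a • f + b • g) x = F.map (h + a • f) x + F.map (h + b • g) x := by
  have hd : Differentiable ℂ fun p : ℂ × ℂ => F.map (h + p.1 • f + p.2 • g) x := by
    have h := (F.differentiable_map 3 ![h, f, g] x).comp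
      (show Differentiable ℂ fun p : ℂ × ℂ => ![1, p.1, p.2] by
        rw [differentiable_pi]; intro i; fin_cases i
        exacts [differentiable_const 1, differentiable_fst, differentiable_snd])
    simpa [Function.comp_def, Fin.sum_univ_three] using h
  simpa using _root_.map_add_of_homogeneous (hd 0) (fun s p => H s p.1 p.2) (a, 0) (0, b)

theorem map_smul_id_of_mem {n : ℕ} {x : F.obj V} (hx : x ∈ F.component n V) (l : ℂ) :
    F.map (l • (LinearMap.id : V →ₗ[ℂ] V)) x = l ^ n • x := hx l

theorem map_smul_of_mem {n : ℕ} {x : F.obj V} (hx : x ∈ F.component n V) (l : ℂ)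
    (f : V →ₗ[ℂ] W) : F.map (l • f) x = l ^ n • F.map f x := by
  have : l • f = f ∘ₗ (l • LinearMap.id) := by rw [LinearMap.comp_smul, LinearMap.comp_id]
  rw [this, ← map_map, F.map_smul_id_of_mem hx, map_smul]

theorem map_mem_component {n : ℕ} {x : F.obj V} (hx : x ∈ F.component n V) (f : V →ₗ[ℂ] W) :
    F.map f x ∈ F.component n W := by
  intro l
  rw [map_map, LinearMap.smul_comp, LinearMap.id_comp, F.map_smul_of_mem hx]

/-- Both sides are continuous in `l`, and the nonzero numbers are dense. The value `l = 0` has to be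
recovered like this where the argument divides by `l`. -/
theorem mem_component_of_ne_zero {n : ℕ} {x : F.obj V}
    (hx : ∀ l : ℂ, l ≠ 0 → F.map (l • (LinearMap.id : V →ₗ[ℂ] V)) x = l ^ n • x) :
    x ∈ F.component n V := by
  have h1 : Continuous fun l : ℂ => F.map (l • (LinearMap.id : V →ₗ[ℂ] V)) x := by
    simpa using (F.differentiable_map_affine 0 LinearMap.id x).continuous
  have h2 : Continuous fun l : ℂ => l ^ n • x := by fun_prop
  exact congrFun (Continuous.ext_on (dense_compl_singleton (0 : ℂ)) h1 h2 fun l hl => hx l hl)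

/-- On elements of degree one, `F f` is linear in `f`. -/
def mapOne {x : F.obj V} (hx : x ∈ F.component 1 V) (W : FinInn) : (V →ₗ[ℂ] W) →ₗ[ℂ] F.obj W where
  toFun f := F.map f x
  map_add' f g := by
    have := F.map_add_of_homogeneous 0 f g x (fun s a b => by
      rw [zero_add, zero_add, mul_smul, mul_smul, ← smul_add, F.map_smul_of_mem hx, pow_one]) 1 1
    simpa using this
  map_smul' l f := by rw [F.map_smul_of_mem hx, pow_one]; rfl

/-- The map `F (2 id)` is self-adjoint and has the distinct eigenvalues `2 ^ m` and `2 ^ n` on the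
two elements. -/
theorem inner_eq_zero_of_mem {m n : ℕ} (h : m ≠ n) {x y : F.obj V} (hx : x ∈ F.component m V)
    (hy : y ∈ F.component n V) : inner ℂ x y = 0 := by
  have h1 := F.isExponential.map_adjoint ((2 : ℂ) • (LinearMap.id : V →ₗ[ℂ] V)) x y
  have h2 : LinearMap.adjoint ((2 : ℂ) • (LinearMap.id : V →ₗ[ℂ] V)) = (2 : ℂ) • LinearMap.id := by
    rw [map_smulₛₗ, LinearMap.adjoint_id, Complex.conj_ofNat]
  rw [h2, F.map_smul_id_of_mem hx, F.map_smul_id_of_mem hy, inner_smul_left, inner_smul_right,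
    map_pow, Complex.conj_ofNat] at h1
  by_contra h0
  have h3 := mul_right_cancel₀ h0 h1
  exact h (Nat.pow_right_injective le_rfl (by exact_mod_cast h3))

/-- The coefficient of `l ^ m` in `F (l id)` takes values in `F_m V`. -/
theorem coeff_mem (c : ℕ →₀ (F.obj V →ₗ[ℂ] F.obj V))
    (hc : ∀ l : ℂ, F.map (l • (LinearMap.id : V →ₗ[ℂ] V)) = c.sum fun m a => l ^ m • a)
    (m : ℕ) (x : F.obj V) : c m x ∈ F.component m V := by
  intro l
  let t : (F.obj V →ₗ[ℂ] F.obj V) →ₗ[ℂ] (F.obj V →ₗ[ℂ] F.obj V) :=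
    LinearMap.llcomp ℂ _ _ _ (F.map (l • LinearMap.id))
  let d : ℕ →₀ (F.obj V →ₗ[ℂ] F.obj V) :=
    Finsupp.onFinset c.support (fun m => l ^ m • c m) fun m hm => by
      rw [Finsupp.mem_support_iff]; rintro h; exact hm (by rw [h, smul_zero])
  -- Compare the coefficients of `k ^ m` in `F (l id) F (k id) = F (k l id)`.
  have key : c.mapRange t (_root_.map_zero t) = d := by
    apply coeff_ext
    intro k
    have h1 : (l • (LinearMap.id : V →ₗ[ℂ] V)) ∘ₗ (k • LinearMap.id) =
        (k * l) • LinearMap.id := by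
      ext x; simp [smul_smul, mul_comm]
    have h2 : t (F.map (k • LinearMap.id)) = F.map ((k * l) • LinearMap.id) := by
      rw [← h1, map_comp]; rfl
    have h3 : (d.sum fun m a => k ^ m • a) = F.map ((k * l) • LinearMap.id) := by
      rw [hc, Finsupp.onFinset_sum _ (by simp)]
      exact Finset.sum_congr rfl fun m _ => by simp only [smul_smul, mul_pow]
    rw [Finsupp.sum_mapRange_index (by simp), h3, ← h2, hc k]
    simp only [Finsupp.sum, map_sum, _root_.map_smul]
  exact LinearMap.congr_fun (DFunLike.congr_fun key m) x

/-- Every element of `F V` is a sum of homogeneous elements. -/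
theorem iSup_component : ⨆ n, F.component n V = ⊤ := by
  refine eq_top_iff.2 fun x _ => ?_
  obtain ⟨c, hc⟩ := F.exists_coeff V
  have h := LinearMap.congr_fun (hc 1) x
  rw [one_smul, map_id, LinearMap.id_apply, Finsupp.sum, LinearMap.sum_apply] at h
  rw [h]
  refine Submodule.sum_mem _ fun m _ => Submodule.mem_iSup_of_mem m ?_
  simpa using F.coeff_mem c hc m x

/-- The elements of degree zero are the multiples of the unit. -/
theorem exists_smul_one {x : F.obj V} (hx : x ∈ F.component 0 V) : ∃ l : ℂ, x = l • F.one V := by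
  have h := F.map_smul_id_of_mem hx 0
  rw [pow_zero, one_smul, zero_smul] at h
  -- On degree zero `F 0` is the identity, and the zero map factors through the zero space, whose
  -- image under `F` is the line of the vacuum.
  have h0 : (0 : V →ₗ[ℂ] V) = (0 : zero →ₗ[ℂ] V) ∘ₗ (0 : V →ₗ[ℂ] zero) := rfl
  rw [h0, ← map_map, F.eq_smul_vacuum (F.map 0 x), map_smul] at h
  exact ⟨_, h.symm⟩

theorem one_mem_component : F.one V ∈ F.component 0 V := fun l => by
  rw [map_one, pow_zero, one_smul]

end PolyExpFunctor

namespace PolyExpFunctor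

open FinInn Inn ExpDatum

variable (F : PolyExpFunctor) {V V' : FinInn} {W : Inn} (u : W ≃ₗᵢ[ℂ] F.degOne)

/-! ### Generators of degree one -/

/-- The map `W ⊗ V → F V` that sends `w ⊗ v` to `F (v) w`, where `v` is regarded as a linear map
`ℂ → V` and `w` as an element of `F_1 ℂ` by means of the unitary `u`. -/
def gen (V : FinInn) : W.tensor V.toInn →ₗ[ℂ] F.obj V :=
  tlift (LinearMap.mk₂ ℂ (fun w v => F.map (pt v) (F.incl (u w)))
    (fun w w' v => by rw [_root_.map_add, _root_.map_add, _root_.map_add])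
    (fun l w v => by rw [_root_.map_smul, _root_.map_smul, _root_.map_smul])
    (fun w v v' => by rw [pt_add]; exact (F.mapOne (u w).2 V).map_add _ _)
    (fun l w v => by rw [pt_smul]; exact (F.mapOne (u w).2 V).map_smul _ _))

@[simp] theorem gen_tmk (w : W) (v : V) : F.gen u V (tmk _ _ w v) = F.map (pt v) (F.incl (u w)) :=
  rfl

theorem gen_mem (a : W.tensor V.toInn) : F.gen u V a ∈ F.component 1 V := by
  induction a using tensor_induction with
  | zero => rw [_root_.map_zero]; exact zero_mem _
  | tmul w v => exact F.map_mem_component (u w).2 (pt v)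
  | add a b ha hb => rw [_root_.map_add]; exact add_mem ha hb

theorem map_gen (f : V →ₗ[ℂ] V') (a : W.tensor V.toInn) :
    F.map f (F.gen u V a) = F.gen u V' (tmap LinearMap.id f a) := by
  induction a using tensor_induction with
  | zero => simp
  | tmul w v => rw [gen_tmk, map_map, comp_pt]; rfl
  | add a b ha hb => simp only [_root_.map_add, ha, hb]

/-- Moving one point map across the inner product leaves the scalar `⟨v, v'⟩` times the identity of
`ℂ`. On degree one, `F` of it is multiplication by that scalar. -/
theorem inner_gen (a b : W.tensor V.toInn) :
    inner ℂ (F.gen u V a) (F.gen u V b) = inner ℂ a b := by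
  induction a using tensor_induction with
  | zero => simp
  | tmul w v =>
    induction b using tensor_induction with
    | zero => simp
    | tmul w' v' =>
      have hm : F.incl (u w') ∈ F.component 1 line := (u w').2
      rw [gen_tmk, gen_tmk, inner_map_map_adjoint, adjoint_pt_comp_pt,
        F.map_smul_id_of_mem hm, inner_tmk, inner_smul_right, F.incl.inner_map_map,
        u.inner_map_map, pow_one, mul_comm]
    | add a b ha hb => simp only [_root_.map_add, inner_add_right, ha, hb]
  | add a b ha hb => simp only [_root_.map_add, inner_add_left, ha, hb]

/-- An orthonormal basis writes the identity of `V` as a sum of maps that factor through `ℂ`, and `F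
f x` is linear in `f` when `x` has degree one. -/
theorem exists_gen {x : F.obj V} (hx : x ∈ F.component 1 V) : ∃ a, F.gen u V a = x := by
  let b := stdOrthonormalBasis ℂ V
  let φ : _ → (V →ₗ[ℂ] line) := fun i => (innerSL ℂ (b i)).toLinearMap
  have hφ : ∑ i, pt (b i) ∘ₗ φ i = LinearMap.id := LinearMap.ext fun v => by
    rw [LinearMap.sum_apply]
    exact b.sum_repr' v
  have hw : ∀ i, ∃ w, F.incl (u w) = F.map (φ i) x := fun i =>
    ⟨u.symm (show F.degOne from ⟨F.map (φ i) x, F.map_mem_component hx _⟩),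
      congrArg F.incl (u.apply_symm_apply _)⟩
  choose w hw using hw
  refine ⟨∑ i, tmk _ _ (w i) (b i), ?_⟩
  have h := _root_.map_sum (F.mapOne hx V) (fun i => pt (b i) ∘ₗ φ i) Finset.univ
  rw [hφ] at h
  rw [_root_.map_sum]
  refine Eq.trans (Finset.sum_congr rfl fun i _ => ?_)
    (h.symm.trans (LinearMap.congr_fun (F.map_id V) x))
  rw [gen_tmk, hw]
  exact map_map _ _ _ x

/-! ### Creation and annihilation operators -/

/-- The creation operator `F V ⊗ (W ⊗ V) → F V`, multiplication by generators. -/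
def create (V : FinInn) : (F.obj V).tensor (W.tensor V.toInn) →ₗ[ℂ] F.obj V :=
  F.mul V ∘ₗ tmap LinearMap.id (F.gen u V)

theorem map_create (f : V →ₗ[ℂ] V') (z : (F.obj V).tensor (W.tensor V.toInn)) :
    F.map f (F.create u V z) = F.create u V' (tmap (F.map f) (tmap LinearMap.id f) z) := by
  have h : F.map f ∘ₗ F.gen u V = F.gen u V' ∘ₗ tmap LinearMap.id f :=
    LinearMap.ext fun a => F.map_gen u f a
  rw [create, LinearMap.comp_apply, map_mul, tmap_tmap, h, create, LinearMap.comp_apply, tmap_tmap]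
  rfl

theorem comul_map (f : V →ₗ[ℂ] V') (a : F.obj V) :
    F.comul V' (F.map f a) = tmap (F.map f) (F.map f) (F.comul V a) := by
  rw [comul, comul, LinearMap.comp_apply, LinearMap.comp_apply, ← tau_natural_apply, map_map,
    map_map]
  congr 3
  exact LinearMap.ext fun v => by simp

/-- Scaling the second leg of the coproduct gives a family in `t` whose derivative at `t = 0` is the
part of degree one in that leg, that is, the annihilation operator followed by `gen`. -/
theorem tmap_smul_id_comul (t : ℂ) (a : F.obj V) :
    tmap LinearMap.id (F.map (t • LinearMap.id)) (F.comul V a) =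
      F.tau V V (F.map (dinl V V + t • dinr V V) a) := by
  rw [← map_id, comul, LinearMap.comp_apply, ← tau_natural_apply, map_map]
  congr 3
  exact LinearMap.ext fun v => by simp [smul_dpair, dpair_add]

variable [FiniteDimensional ℂ W]

/-- The adjoint `F V → W ⊗ V` of `gen`. -/
def cogen (V : FinInn) : F.obj V →ₗ[ℂ] W.tensor V.toInn :=
  LinearMap.adjoint (F.gen u V)

theorem inner_gen_left (a : W.tensor V.toInn) (x : F.obj V) :
    inner ℂ (F.gen u V a) x = inner ℂ a (F.cogen u V x) :=
  (LinearMap.adjoint_inner_right _ _ _).symm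

theorem cogen_gen (a : W.tensor V.toInn) : F.cogen u V (F.gen u V a) = a :=
  ext_inner_left ℂ fun b => by rw [← inner_gen_left, inner_gen]

theorem cogen_of_mem {n : ℕ} (hn : n ≠ 1) {x : F.obj V} (hx : x ∈ F.component n V) :
    F.cogen u V x = 0 :=
  ext_inner_left ℂ fun b => by
    rw [← inner_gen_left, inner_zero_right]
    exact F.inner_eq_zero_of_mem hn.symm (F.gen_mem u b) hx

/-- Taking adjoints replaces `l` by its conjugate, which acts on generators as a scalar. Conjugating
once more restores `l`. -/
theorem cogen_map_smul_id (l : ℂ) (x : F.obj V) :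
    F.cogen u V (F.map (l • LinearMap.id) x) = l • F.cogen u V x := by
  refine ext_inner_left ℂ fun b => ?_
  have h2 : (l • LinearMap.id : V →ₗ[ℂ] V) =
      LinearMap.adjoint (starRingEnd ℂ l • (LinearMap.id : V →ₗ[ℂ] V)) := by
    rw [map_smulₛₗ, LinearMap.adjoint_id, Complex.conj_conj]
  rw [← inner_gen_left, h2, ← F.isExponential.map_adjoint, F.map_smul_id_of_mem (F.gen_mem u b),
    pow_one, inner_smul_left, Complex.conj_conj, inner_smul_right, inner_gen_left]

/-- The derivative of `F (t id)` at `t = 0` is the projection onto the elements of degree one. -/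
theorem hasDerivAt_map_smul_id (y : F.obj V) :
    HasDerivAt (fun t : ℂ => F.map (t • LinearMap.id) y) (F.gen u V (F.cogen u V y)) 0 := by
  have hy : y ∈ ⨆ n, F.component n V := by rw [iSup_component]; trivial
  induction hy using Submodule.iSup_induction' with
  | mem n y hy =>
    -- On degree `n` the function is `t ^ n y`, whose derivative at `0` vanishes unless `n = 1`.
    simp only [F.map_smul_id_of_mem hy]
    by_cases hn : n = 1
    · subst hn
      obtain ⟨a, rfl⟩ := F.exists_gen u hy
      rw [cogen_gen]
      simpa using (hasDerivAt_id (0 : ℂ)).smul_const (F.gen u V a)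
    · rw [F.cogen_of_mem u hn hy, _root_.map_zero]
      have := (hasDerivAt_pow n (0 : ℂ)).smul_const y
      rcases n with _ | _ | n
      · simpa using this
      · exact absurd rfl hn
      · simpa using this
  | zero => simpa using hasDerivAt_const (0 : ℂ) (0 : F.obj V)
  | add x y _ _ hx hy => simpa only [_root_.map_add] using hx.fun_add hy

theorem hasDerivAt_tmap_map_smul_id {A : Inn} (z : A.tensor (F.obj V)) :
    HasDerivAt (fun t : ℂ => tmap LinearMap.id (F.map (t • LinearMap.id)) z)
      (tmap LinearMap.id (F.gen u V) (tmap LinearMap.id (F.cogen u V) z)) 0 := by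
  induction z using tensor_induction with
  | zero => simpa using hasDerivAt_const (0 : ℂ) (0 : A.tensor (F.obj V))
  | tmul a y =>
    exact (LinearMap.toContinuousLinearMap (tmk A (F.obj V) a)).hasFDerivAt.comp_hasDerivAt (0 : ℂ)
      (F.hasDerivAt_map_smul_id u y)
  | add x y hx hy => simpa only [_root_.map_add] using hx.fun_add hy

/-- The annihilation operator `F V → F V ⊗ (W ⊗ V)`, the adjoint of the creation operator. -/
def annihilate (V : FinInn) : F.obj V →ₗ[ℂ] (F.obj V).tensor (W.tensor V.toInn) :=
  tmap LinearMap.id (F.cogen u V) ∘ₗ F.comul V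

theorem inner_create (z : (F.obj V).tensor (W.tensor V.toInn)) (a : F.obj V) :
    inner ℂ (F.create u V z) a = inner ℂ z (F.annihilate u V a) := by
  rw [create, LinearMap.comp_apply, inner_mul,
    inner_tmap (f' := LinearMap.id) (fun _ _ => rfl) (F.inner_gen_left u)]
  rfl

/-- The second leg has degree one and accounts for the factor `l`, so annihilation lowers the degree
by one. Keeping `l` on the right avoids a division. -/
theorem annihilate_map_smul_id (l : ℂ) (a : F.obj V) :
    F.annihilate u V (F.map (l • LinearMap.id) a) =
      l • tmap (F.map (l • LinearMap.id)) LinearMap.id (F.annihilate u V a) := by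
  have h : F.cogen u V ∘ₗ F.map (l • LinearMap.id) = l • F.cogen u V :=
    LinearMap.ext fun a => F.cogen_map_smul_id u l a
  rw [annihilate, LinearMap.comp_apply, comul_map, tmap_tmap, h, LinearMap.comp_apply, tmap_tmap]
  generalize F.comul V a = z
  induction z using tensor_induction with
  | zero => simp
  | tmul x y => simp
  | add x y hx hy => simp only [_root_.map_add, smul_add, hx, hy]

theorem annihilate_one : F.annihilate u V (F.one V) = 0 := by
  have h : F.comul V (F.one V) = tmk _ _ (F.one V) (F.one V) := by
    rw [comul, LinearMap.comp_apply, map_one, tau_one]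
  rw [annihilate, LinearMap.comp_apply, h, tmap_tmk, F.cogen_of_mem u zero_ne_one
    F.one_mem_component, _root_.map_zero]

/-- On elements of degree `n`, annihilation followed by creation is multiplication by `n`. -/
theorem create_annihilate {n : ℕ} {x : F.obj V} (hx : x ∈ F.component n V) :
    F.create u V (F.annihilate u V x) = (n : ℂ) • x := by
  have h1 := (LinearMap.toContinuousLinearMap (F.mul V)).hasFDerivAt.comp_hasDerivAt (0 : ℂ)
    (F.hasDerivAt_tmap_map_smul_id u (F.comul V x))
  -- The diagonal, a scaling of the second summand by `t` and the codiagonal compose to `1 + t`. The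
  -- derivative of this identity at `t = 0` is the claim.
  have h2 : ∀ t : ℂ, F.mul V (tmap LinearMap.id (F.map (t • LinearMap.id)) (F.comul V x)) =
      (1 + t) ^ n • x := by
    intro t
    rw [tmap_smul_id_comul, mul_tau, map_map, ← F.map_smul_id_of_mem hx]
    congr 2
    exact LinearMap.ext fun v => by simp [smul_dpair, dpair_add, add_smul]
  have h3 : HasDerivAt (fun t : ℂ => (1 + t) ^ n • x) ((n : ℂ) • x) 0 := by
    have := (((hasDerivAt_id (0 : ℂ)).const_add 1).pow n).smul_const x
    simpa using this
  refine HasDerivAt.unique (f := fun t : ℂ => (1 + t) ^ n • x) (x := (0 : ℂ)) ?_ h3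
  simp only [← h2]
  exact h1

end PolyExpFunctor

namespace PolyExpFunctor

open FinInn Inn ExpDatum

variable (F : PolyExpFunctor) {V V' V'' : FinInn} {W : Inn} (u : W ≃ₗᵢ[ℂ] F.degOne)

/-! ### The commutation relation -/

theorem swapUnitary_tmap (f g : V →ₗ[ℂ] V') (y : (F.obj V).tensor (F.obj V)) :
    F.swapUnitary V' (tmap (F.map f) (F.map g) y) =
      tmap (F.map g) (F.map f) (F.swapUnitary V y) := by
  obtain ⟨x, rfl⟩ := F.tau_surjective V V y
  rw [swapUnitary_tau, ← tau_natural_apply, ← tau_natural_apply, swapUnitary_tau, map_map,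
    map_map]
  rfl

/-- The codiagonal absorbs the swap because addition is commutative. This braided commutativity is
the source of all the invariance under the symmetric groups. -/
theorem mul_swapUnitary (y : (F.obj V).tensor (F.obj V)) :
    F.mul V (F.swapUnitary V y) = F.mul V y := by
  obtain ⟨x, rfl⟩ := F.tau_surjective V V y
  rw [swapUnitary_tau, mul_tau, mul_tau, map_map]
  congr 2
  exact dsum_ext fun v w => add_comm w v

theorem tmap_gen_tmid (a : W.tensor W) (v v' : V) :
    tmap (F.gen u V) (F.gen u V) ((RMatrix.tmid W V.toInn W V.toInn).symm
        (tmk _ _ a (tmk V.toInn V.toInn v v'))) =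
      tmap (F.map (pt v)) (F.map (pt v')) (F.incl₂ (tmap u.toLinearEquiv.toLinearMap
        u.toLinearEquiv.toLinearMap a)) := by
  induction a using tensor_induction with
  | zero => simp
  | tmul w w' => rfl
  | add a b ha hb => simp only [_root_.map_add, LinearMap.add_apply, ha, hb]

/-- The unitary `u` is an equivalence between `R` and the R-matrix of `F`. -/
def Intertwines (R : RMatrix W) : Prop :=
  ∀ x, tmap u.toLinearEquiv.toLinearMap u.toLinearEquiv.toLinearMap (R.toEquiv x) =
    F.rMatrix.toEquiv (tmap u.toLinearEquiv.toLinearMap u.toLinearEquiv.toLinearMap x)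

variable {R : RMatrix W}

/-- Generators at `v` and `v'` are images of elements of `F_1 ℂ` under point maps. The swap
exchanges the two point maps, which gives the factor `T`, and acts on `F_1 ℂ ⊗ F_1 ℂ` by the
R-matrix of `F`, which corresponds to `R`. -/
theorem swapUnitary_gen (hu : F.Intertwines u R)
    (z : (W.tensor V.toInn).tensor (W.tensor V.toInn)) :
    F.swapUnitary V (tmap (F.gen u V) (F.gen u V) z) =
      tmap (F.gen u V) (F.gen u V) ((R.boxFlip V).toEquiv z) := by
  obtain ⟨z, rfl⟩ := (RMatrix.tmid W V.toInn W V.toInn).symm.surjective z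
  induction z using tensor_induction with
  | zero => simp
  | tmul a b =>
    have h : (R.boxFlip V).toEquiv ((RMatrix.tmid W V.toInn W V.toInn).symm (tmk _ _ a b)) =
      (RMatrix.tmid W V.toInn W V.toInn).symm (tmk _ _ (R.toEquiv a) (tcomm _ _ b)) :=
      RMatrix.boxEquiv_tmid _ _ a b
    rw [h]
    induction b using tensor_induction with
    | zero => simp
    | tmul v v' =>
      rw [tcomm_tmk, tmap_gen_tmid, tmap_gen_tmid, swapUnitary_tmap, hu a, ← incl₂_rEquiv]
      rfl
    | add a b ha hb =>
      simp only [_root_.map_add]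
      rw [ha (RMatrix.boxEquiv_tmid _ _ _ _), hb (RMatrix.boxEquiv_tmid _ _ _ _)]
  | add a b ha hb => simp only [_root_.map_add, ha, hb]

theorem create_create_assoc (a : F.obj V) (b : (W.tensor V.toInn).tensor (W.tensor V.toInn)) :
    F.create u V (tmap (F.create u V) LinearMap.id ((tassoc _ _ _).symm (tmk _ _ a b))) =
      F.mul V (tmk _ _ a (F.mul V (tmap (F.gen u V) (F.gen u V) b))) := by
  induction b using tensor_induction with
  | zero => simp
  | tmul x y =>
    exact F.mul_assoc_apply (tmk _ _ (tmk _ _ a (F.gen u V x)) (F.gen u V y))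
  | add a b ha hb => simp only [_root_.map_add, ha, hb]

/-- By associativity the two generators can be multiplied first, and their product does not change
under the swap. -/
theorem create_create_actLast (hu : F.Intertwines u R)
    (z : ((F.obj V).tensor (W.tensor V.toInn)).tensor (W.tensor V.toInn)) :
    F.create u V (tmap (F.create u V) LinearMap.id
        (RMatrix.actLast (F.obj V) (R.boxFlip V).toEquiv z)) =
      F.create u V (tmap (F.create u V) LinearMap.id z) := by
  obtain ⟨z, rfl⟩ := (tassoc _ _ _).symm.surjective z
  induction z using tensor_induction with
  | zero => simp
  | tmul a b =>
    rw [RMatrix.actLast_assoc, create_create_assoc, create_create_assoc,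
      ← F.swapUnitary_gen u hu, mul_swapUnitary]
  | add a b ha hb => simp only [_root_.map_add, ha, hb]

/-- The map inside `F` is `(v, w) ↦ (v + w, v)`, factored as doubling `v`, swapping the last two of
the three summands, and adding the first two. It is the exchange term of the commutation relation.
-/
theorem tau_map_shear (x : F.obj (V.dsum V)) :
    F.tau V V (F.map (dmap (dcodiag V) LinearMap.id ∘ₗ dcommLast V ∘ₗ
        dmap (ddiag V) LinearMap.id) x) =
      tmap (F.mul V) LinearMap.id (RMatrix.actLast _ (F.swapUnitary V)
        (tmap (F.comul V) LinearMap.id (F.tau V V x))) := by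
  have h : F.mul V ∘ₗ F.tau V V = F.map (dcodiag V) := LinearMap.ext fun x => F.mul_tau x
  have h1 : tmap (F.comul V) LinearMap.id (F.tau V V x) =
      F.tau₃ V (F.map (dmap (ddiag V) LinearMap.id) x) := by
    rw [tau₃, LinearMap.comp_apply, tau_natural_apply, map_id, tmap_tmap, LinearMap.id_comp]
    rfl
  rw [h1, actLast_tau₃, tau₃, LinearMap.comp_apply, tmap_tmap, h, LinearMap.id_comp, map_map,
    ← map_id, ← tau_natural_apply, map_map]

variable [FiniteDimensional ℂ W]

theorem tmap_cogen_gen {A : Inn} (z : A.tensor (W.tensor V.toInn)) :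
    tmap LinearMap.id (F.cogen u V) (tmap LinearMap.id (F.gen u V) z) = z := by
  have h : F.cogen u V ∘ₗ F.gen u V = LinearMap.id := LinearMap.ext (F.cogen_gen u)
  rw [tmap_tmap, h, LinearMap.id_comp, tmap_id, LinearMap.id_apply]

/-- The swap exchanges degrees. Only the part of `q` of degree one survives projecting the second
leg of the result onto degree one, and on that part the swap is `R ⊠ T`. -/
theorem cogen_swapUnitary (hu : F.Intertwines u R) (q : F.obj V) (y : W.tensor V.toInn) :
    tmap LinearMap.id (F.cogen u V) (F.swapUnitary V (tmk _ _ q (F.gen u V y))) =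
      tmap (F.gen u V) LinearMap.id ((R.boxFlip V).toEquiv (tmk _ _ (F.cogen u V q) y)) := by
  have hq : q ∈ ⨆ n, F.component n V := by rw [iSup_component]; trivial
  induction hq using Submodule.iSup_induction' with
  | mem n q hq =>
    by_cases hn : n = 1
    · subst hn
      obtain ⟨a, rfl⟩ := F.exists_gen u hq
      have h : F.cogen u V ∘ₗ F.gen u V = LinearMap.id := LinearMap.ext (F.cogen_gen u)
      rw [cogen_gen, ← tmap_tmk (F.gen u V) (F.gen u V), F.swapUnitary_gen u hu, tmap_tmap, h,
        LinearMap.id_comp]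
    · rw [F.cogen_of_mem u hn hq]
      simp only [_root_.map_zero, LinearMap.zero_apply]
      set s := F.swapUnitary V (tmk _ _ q (F.gen u V y)) with hs
      -- The second leg of `s` has degree `n`. Scaling it by `2` multiplies `s` by `2 ^ n`, but
      -- multiplies its image under `cogen` by `2`, so this image vanishes for `n ≠ 1`.
      have h1 : tmap LinearMap.id (F.map ((2 : ℂ) • LinearMap.id)) s = (2 : ℂ) ^ n • s := by
        rw [hs, ← map_id, tmap_swapUnitary, tmap_tmk, map_id, F.map_smul_id_of_mem hq]
        simp only [_root_.map_smul, LinearMap.smul_apply]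
        rfl
      have h2 : ∀ s : (F.obj V).tensor (F.obj V), tmap LinearMap.id (F.cogen u V)
          (tmap LinearMap.id (F.map ((2 : ℂ) • LinearMap.id)) s) =
            (2 : ℂ) • tmap LinearMap.id (F.cogen u V) s := by
        intro s
        induction s using tensor_induction with
        | zero => simp
        | tmul a b => simp [cogen_map_smul_id]
        | add a b ha hb => simp only [_root_.map_add, smul_add, ha, hb]
      have h3 := h2 s
      rw [h1, _root_.map_smul, ← sub_eq_zero, ← sub_smul] at h3
      refine (smul_eq_zero.1 h3).resolve_left fun h0 => hn ?_
      have h4 : (2 : ℂ) ^ n = 2 ^ 1 := by rw [pow_one]; exact sub_eq_zero.1 h0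
      exact Nat.pow_right_injective le_rfl (by exact_mod_cast h4)
  | zero => simp
  | add a b _ _ ha hb => simp only [_root_.map_add, LinearMap.add_apply, ha, hb]

theorem cogen_mul_actLast (hu : F.Intertwines u R) (c : (F.obj V).tensor (F.obj V))
    (y : W.tensor V.toInn) :
    tmap LinearMap.id (F.cogen u V) (tmap (F.mul V) LinearMap.id
        (RMatrix.actLast _ (F.swapUnitary V) (tmk _ _ c (F.gen u V y)))) =
      tmap (F.create u V) LinearMap.id (RMatrix.actLast _ (R.boxFlip V).toEquiv
        (tmk _ _ (tmap LinearMap.id (F.cogen u V) c) y)) := by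
  induction c using tensor_induction with
  | zero => simp
  | tmul p q =>
    have h1 : ∀ t, tmap LinearMap.id (F.cogen u V) (tmap (F.mul V) LinearMap.id
        ((tassoc _ _ _).symm (tmk _ _ p t))) =
        tmap (F.mul V ∘ₗ tmk _ _ p) LinearMap.id (tmap LinearMap.id (F.cogen u V) t) := by
      intro t
      induction t using tensor_induction with
      | zero => simp
      | tmul a b => rfl
      | add a b ha hb => simp only [_root_.map_add, ha, hb]
    have h2 : ∀ t, tmap (F.create u V) LinearMap.id ((tassoc _ _ _).symm (tmk _ _ p t)) =
        tmap (F.mul V ∘ₗ tmk _ _ p) LinearMap.id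
          (tmap (F.gen u V) (LinearMap.id : W.tensor V.toInn →ₗ[ℂ] W.tensor V.toInn) t) := by
      intro t
      induction t using tensor_induction with
      | zero => simp
      | tmul a b => rfl
      | add a b ha hb => simp only [_root_.map_add, ha, hb]
    rw [tmap_tmk, LinearMap.id_apply, RMatrix.actLast_tmk, RMatrix.actLast_tmk, h1, h2,
      F.cogen_swapUnitary u hu]
  | add a b ha hb => simp only [_root_.map_add, LinearMap.add_apply, ha, hb]

/-- A generator is linear in its variable. Hence the coproduct of `a` times a generator splits
according to the leg that receives the generator. If it is the first leg, the degree-one part of the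
second leg comes from `a`; if it is the second, that part is the generator itself and `a` stays
behind. -/
theorem gen_cogen_comul_mul {x : F.obj (V.dsum V)} {a : F.obj V} {y : W.tensor V.toInn}
    (hx : F.tau V V x = tmk _ _ a (F.gen u V y)) :
    tmap LinearMap.id (F.gen u V) (tmap LinearMap.id (F.cogen u V)
        (F.comul V (F.mul V (F.tau V V x)))) =
      tmap LinearMap.id (F.gen u V) (tmap LinearMap.id (F.cogen u V)
        (F.tau V V (F.map (dmap (dcodiag V) LinearMap.id ∘ₗ dcommLast V ∘ₗ
          dmap (ddiag V) LinearMap.id) x))) + F.tau V V x := by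
  set N : V.dsum V →ₗ[ℂ] V.dsum V := dmap (dcodiag V) LinearMap.id ∘ₗ dcommLast V ∘ₗ
    dmap (ddiag V) LinearMap.id
  have hN : ∀ v w, N (dpair v w) = dpair (v + w) v := fun v w => by
    have : N (dpair v w) = dmap (dcodiag V) LinearMap.id (dcommLast V
      (dmap (ddiag V) LinearMap.id (dpair v w))) := rfl
    rw [this, dmap_dpair, ddiag_apply]
    rfl
  -- The second leg of `τ x` is a generator, so `x` is homogeneous of degree one in the second
  -- summand.
  have hom : ∀ (s : ℂ) (f : V.dsum V →ₗ[ℂ] V.dsum V),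
      F.map (f ∘ₗ dmap LinearMap.id (s • LinearMap.id)) x = s • F.map f x := by
    intro s f
    rw [← map_map, ← _root_.map_smul]
    congr 1
    apply F.tau_injective
    rw [tau_natural_apply, hx, tmap_tmk, map_id, F.map_smul_id_of_mem (F.gen_mem u y), pow_one,
      _root_.map_smul, _root_.map_smul, hx, LinearMap.id_apply]
  -- With scaling by `t`, the coproduct of the product is `F` of `(v, w) ↦ (v + w, t (v + w))`. `H
  -- t` is the part of this map in `v`; `E₁` and `t E₂` send `w` to the two legs.
  let E₁ : V.dsum V →ₗ[ℂ] V.dsum V := dinl V V ∘ₗ dsnd V V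
  let E₂ : V.dsum V →ₗ[ℂ] V.dsum V := dinr V V ∘ₗ dsnd V V
  let H : ℂ → (V.dsum V →ₗ[ℂ] V.dsum V) := fun t =>
    dinl V V ∘ₗ dfst V V + t • (dinr V V ∘ₗ dfst V V)
  have key : ∀ t : ℂ, tmap LinearMap.id (F.map (t • LinearMap.id))
      (F.comul V (F.mul V (F.tau V V x))) =
      tmap LinearMap.id (F.map (t • LinearMap.id)) (F.tau V V (F.map N x)) +
        t • F.tau V V (F.map (LinearMap.id + t • (dinr V V ∘ₗ dfst V V)) x) := by
    intro t
    have h1 := F.map_add_of_homogeneous (H t) E₁ E₂ x (fun s a b => by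
      rw [← hom]
      congr 2
      exact dsum_ext fun v w => by simp [H, E₁, E₂, smul_dpair, dpair_add, smul_smul, mul_comm])
      1 t
    have h2 : (dinl V V + t • dinr V V) ∘ₗ dcodiag V = H t + (1 : ℂ) • E₁ + t • E₂ :=
      dsum_ext fun v w => by simp [H, E₁, E₂, smul_dpair, dpair_add]
    have h3 : dmap LinearMap.id (t • LinearMap.id) ∘ₗ N = H t + (1 : ℂ) • E₁ :=
      dsum_ext fun v w => by simp [H, E₁, hN, smul_dpair, dpair_add]
    -- This map is `(v, w) ↦ (v, t v + t w)`. Homogeneity in `w` extracts a factor `t` and leaves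
    -- `(v, w) ↦ (v, t v + w)`.
    have h4 : H t + t • E₂ = (LinearMap.id + t • (dinr V V ∘ₗ dfst V V)) ∘ₗ
        dmap LinearMap.id (t • LinearMap.id) :=
      dsum_ext fun v w => by simp [H, E₂, smul_dpair, dpair_add, add_comm]
    rw [tmap_smul_id_comul, mul_tau, map_map, h2, h1, h4, hom, _root_.map_add, _root_.map_smul,
      ← h3, ← map_id, ← tau_natural_apply, map_map]
  have d1 := F.hasDerivAt_tmap_map_smul_id u (F.comul V (F.mul V (F.tau V V x)))
  have d2 := F.hasDerivAt_tmap_map_smul_id u (F.tau V V (F.map N x))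
  -- Because of the factor `t`, the derivative at `0` is the value of the other factor there, where
  -- the map inside `F` is the identity.
  have d3 : HasDerivAt (fun t : ℂ =>
      t • F.tau V V (F.map (LinearMap.id + t • (dinr V V ∘ₗ dfst V V)) x)) (F.tau V V x) 0 := by
    have h := (F.differentiable_map_affine LinearMap.id (dinr V V ∘ₗ dfst V V) x
      (0 : ℂ)).hasDerivAt
    have h' := (LinearMap.toContinuousLinearMap (F.tau V V)).hasFDerivAt.comp_hasDerivAt (0 : ℂ) h
    have h'' := (hasDerivAt_id (0 : ℂ)).fun_smul h'
    simpa [map_id] using h''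
  simp only [key] at d1
  exact d1.unique (d2.fun_add d3)

/-- The commutation relation between creation and annihilation operators. -/
theorem annihilate_create (hu : F.Intertwines u R) (z : (F.obj V).tensor (W.tensor V.toInn)) :
    F.annihilate u V (F.create u V z) = z + tmap (F.create u V) LinearMap.id
      (RMatrix.actLast _ (R.boxFlip V).toEquiv (tmap (F.annihilate u V) LinearMap.id z)) := by
  induction z using tensor_induction with
  | zero => simp
  | tmul a y =>
    obtain ⟨x, hx⟩ := F.tau_surjective V V (tmk _ _ a (F.gen u V y))
    have h := congrArg (tmap LinearMap.id (F.cogen u V)) (F.gen_cogen_comul_mul u hx)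
    rw [tau_map_shear, _root_.map_add, tmap_cogen_gen, tmap_cogen_gen, hx, tmap_tmk,
      LinearMap.id_apply, F.cogen_mul_actLast u hu, tmap_tmk, cogen_gen, add_comm] at h
    exact h
  | add a b ha hb =>
    simp only [_root_.map_add, ha, hb]
    abel

end PolyExpFunctor

namespace PolyExpFunctor

open FinInn Inn ExpDatum

variable (F : PolyExpFunctor) {V V' : FinInn} {W : Inn} (u : W ≃ₗᵢ[ℂ] F.degOne)

/-! ### Products of generators -/

/-- The extension `A ⊗ (W ⊗ V) → F V` of a map `g : A → F V`, which multiplies its values by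
generators. -/
def extend {A : Inn} (g : A →ₗ[ℂ] F.obj V) : A.tensor (W.tensor V.toInn) →ₗ[ℂ] F.obj V :=
  F.create u V ∘ₗ tmap g LinearMap.id

section extend

variable {A A' B C : Inn}

theorem extend_tmk (g : A →ₗ[ℂ] F.obj V) (a : A) (y : W.tensor V.toInn) :
    F.extend u g (tmk _ _ a y) = F.mul V (tmk _ _ (g a) (F.gen u V y)) := rfl

theorem extend_apply (g : A →ₗ[ℂ] F.obj V) (z : A.tensor (W.tensor V.toInn)) :
    F.extend u g z = F.create u V (tmap g LinearMap.id z) := rfl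

theorem map_extend {f : V →ₗ[ℂ] V'} {g : A →ₗ[ℂ] F.obj V} {g' : A' →ₗ[ℂ] F.obj V'}
    {k : A →ₗ[ℂ] A'} (h : ∀ x, F.map f (g x) = g' (k x)) (z : A.tensor (W.tensor V.toInn)) :
    F.map f (F.extend u g z) = F.extend u g' (tmap k (tmap LinearMap.id f) z) := by
  have h' : F.map f ∘ₗ g = g' ∘ₗ k := LinearMap.ext h
  rw [extend_apply, map_create, tmap_tmap, h', extend_apply, tmap_tmap]
  rfl

theorem extend_mem {n : ℕ} {g : A →ₗ[ℂ] F.obj V} (hg : ∀ x, g x ∈ F.component n V)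
    (z : A.tensor (W.tensor V.toInn)) : F.extend u g z ∈ F.component (n + 1) V := by
  induction z using tensor_induction with
  | zero => rw [_root_.map_zero]; exact zero_mem _
  | tmul a y =>
    intro l
    rw [extend_tmk, map_mul, tmap_tmk, F.map_smul_id_of_mem (hg a),
      F.map_smul_id_of_mem (F.gen_mem u y), pow_one, pow_succ, mul_smul]
    simp only [_root_.map_smul, LinearMap.smul_apply]
    rw [smul_comm]
  | add a b ha hb => rw [_root_.map_add]; exact add_mem ha hb

/-- Associativity of the product in the form of the induction step that makes `prodGen` turn
concatenation into multiplication. -/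
theorem extend_tassoc_symm {g : A →ₗ[ℂ] F.obj V} {h : B →ₗ[ℂ] F.obj V}
    {m : A.tensor B →ₗ[ℂ] C} {k : C →ₗ[ℂ] F.obj V}
    (hk : ∀ z, k (m z) = F.mul V (tmap g h z)) (z : A.tensor (B.tensor (W.tensor V.toInn))) :
    F.extend u k (tmap m LinearMap.id ((tassoc _ _ _).symm z)) =
      F.mul V (tmap g (F.extend u h) z) := by
  obtain ⟨z, rfl⟩ := (tassoc _ _ _).surjective z
  rw [LinearIsometryEquiv.symm_apply_apply]
  induction z using tensor_induction with
  | zero => simp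
  | tmul a y =>
    rw [tmap_tmk, extend_tmk, hk]
    refine (F.mul_assoc_apply (tmk _ _ _ _)).trans (congrArg (F.mul V) ?_)
    induction a using tensor_induction with
    | zero => simp
    | tmul p q => rfl
    | add a b ha hb => simp only [_root_.map_add, LinearMap.add_apply, ha, hb]
  | add a b ha hb => simp only [_root_.map_add, ha, hb]

theorem extend_tcongr {g : A →ₗ[ℂ] F.obj V} {s : A ≃ₗᵢ[ℂ] A} (h : ∀ x, g (s x) = g x)
    (z : A.tensor (W.tensor V.toInn)) : F.extend u g (tcongr s 1 z) = F.extend u g z := by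
  induction z using tensor_induction with
  | zero => simp
  | tmul a y => rw [tcongr_tmk, extend_tmk, extend_tmk, h]; rfl
  | add a b ha hb => simp only [_root_.map_add, ha, hb]

theorem extend_extend (g : A →ₗ[ℂ] F.obj V)
    (z : (A.tensor (W.tensor V.toInn)).tensor (W.tensor V.toInn)) :
    F.extend u (F.extend u g) z = F.create u V (tmap (F.create u V) LinearMap.id
      (tmap (tmap g LinearMap.id) LinearMap.id z)) := by
  rw [tmap_tmap, LinearMap.id_comp]
  rfl

variable {R : RMatrix W}

theorem actLast_tmap (g : A →ₗ[ℂ] B)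
    (z : (A.tensor (W.tensor V.toInn)).tensor (W.tensor V.toInn)) :
    tmap (tmap g LinearMap.id) LinearMap.id (RMatrix.actLast A (R.boxFlip V).toEquiv z) =
      RMatrix.actLast B (R.boxFlip V).toEquiv (tmap (tmap g LinearMap.id) LinearMap.id z) :=
  RMatrix.actLast_naturality (R.boxFlip V).toEquiv (R.boxFlip V).toEquiv g LinearMap.id
    (fun x => by rw [tmap_id]; rfl) z

theorem extend_actLast (hu : F.Intertwines u R) (g : A →ₗ[ℂ] F.obj V)
    (z : (A.tensor (W.tensor V.toInn)).tensor (W.tensor V.toInn)) :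
    F.extend u (F.extend u g) (RMatrix.actLast A (R.boxFlip V).toEquiv z) =
      F.extend u (F.extend u g) z := by
  rw [extend_extend, actLast_tmap, F.create_create_actLast u hu, extend_extend]

variable [FiniteDimensional ℂ W]

/-- Annihilation maps degree `n + 1` into degree `n` tensored with the generators; the degree is
read off coefficientwise in a basis. -/
theorem exists_annihilate_eq_sum {n : ℕ} {ι : Type*} [Fintype ι]
    (b : Module.Basis ι ℂ (W.tensor V.toInn)) {x : F.obj V} (hx : x ∈ F.component (n + 1) V) :
    ∃ a : ι → F.obj V, (∀ k, a k ∈ F.component n V) ∧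
      F.annihilate u V x = ∑ k, tmk _ _ (a k) (b k) := by
  obtain ⟨a, ha⟩ := exists_eq_sum_tmk b (F.annihilate u V x)
  refine ⟨a, fun k => F.mem_component_of_ne_zero fun l hl => ?_, ha⟩
  have h := F.annihilate_map_smul_id u l x
  rw [F.map_smul_id_of_mem hx, _root_.map_smul, ha, map_sum, pow_succ', mul_smul] at h
  have h' := smul_right_injective _ hl h
  rw [Finset.smul_sum] at h'
  refine (congrFun (sum_tmk_injective (x := fun k => l ^ n • a k)
    (x' := fun k => F.map (l • LinearMap.id) (a k)) b ?_) k).symm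
  simp only [_root_.map_smul, LinearMap.smul_apply]
  exact h'

/-- Up to the factor `n + 1`, an element of degree `n + 1` is recovered by creation from its
annihilation, whose coefficients have degree `n`. -/
theorem exists_extend {n : ℕ} {g : A →ₗ[ℂ] F.obj V}
    (hg : ∀ x ∈ F.component n V, ∃ y, g y = x) {x : F.obj V} (hx : x ∈ F.component (n + 1) V) :
    ∃ z, F.extend u g z = x := by
  obtain ⟨a, ha, h⟩ := F.exists_annihilate_eq_sum u (Module.finBasis ℂ (W.tensor V.toInn)) hx
  choose y hy using fun k => hg _ (ha k)
  have h1 := F.create_annihilate u hx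
  refine ⟨((n + 1 : ℕ) : ℂ)⁻¹ • ∑ k, tmk _ _ (y k) (Module.finBasis ℂ (W.tensor V.toInn) k), ?_⟩
  rw [_root_.map_smul, extend_apply, map_sum]
  simp only [tmap_tmk, hy, LinearMap.id_apply]
  rw [← h, h1, smul_smul, inv_mul_cancel₀ (by exact_mod_cast n.succ_ne_zero), one_smul]

theorem annihilate_extend (hu : F.Intertwines u R) {g : A →ₗ[ℂ] F.obj V}
    (hg : ∀ x, F.annihilate u V (g x) = 0) (z : A.tensor (W.tensor V.toInn)) :
    F.annihilate u V (F.extend u g z) = tmap g LinearMap.id z := by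
  have h : F.annihilate u V ∘ₗ g = 0 := LinearMap.ext hg
  have h0 : tmap (0 : A →ₗ[ℂ] (F.obj V).tensor (W.tensor V.toInn))
      (LinearMap.id : W.tensor V.toInn →ₗ[ℂ] W.tensor V.toInn) = 0 :=
    tensor_ext fun a b => by simp
  rw [extend_apply, F.annihilate_create u hu, tmap_tmap, h, LinearMap.id_comp, h0]
  simp

theorem tmap_smul_id (c : ℂ) (g : A →ₗ[ℂ] A') :
    tmap (c • g) (LinearMap.id : B →ₗ[ℂ] B) = c • tmap g LinearMap.id :=
  tensor_ext fun a b => by simp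

/-- The commutation relation contributes one copy of the expected result, plus an exchange term that
is `c` copies of it with `R ⊠ T` applied to the last two factors. That twist disappears because `z`
is fixed by it. The isometries `s` stand for the earlier neighbouring exchanges, for which the
formula with `c` is assumed. -/
theorem annihilate_extend_extend (hu : F.Intertwines u R) {g : A →ₗ[ℂ] F.obj V} {ι : Sort*}
    (s : ι → (A.tensor (W.tensor V.toInn) ≃ₗᵢ[ℂ] A.tensor (W.tensor V.toInn))) (c : ℂ)
    (hg : ∀ x, (∀ i, s i x = x) → F.annihilate u V (F.extend u g x) = c • tmap g LinearMap.id x)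
    {z : (A.tensor (W.tensor V.toInn)).tensor (W.tensor V.toInn)}
    (hs : ∀ i, tcongr (s i) 1 z = z) (hz : RMatrix.actLast A (R.boxFlip V).toEquiv z = z) :
    F.annihilate u V (F.extend u (F.extend u g) z) =
      (c + 1) • tmap (F.extend u g) LinearMap.id z := by
  have h1 : tmap (F.annihilate u V) LinearMap.id (tmap (F.extend u g) LinearMap.id z) =
      c • tmap (tmap g LinearMap.id) LinearMap.id z := by
    rw [tmap_tmap, LinearMap.id_comp, tmap_eq_of_fixed s _ (c • tmap g LinearMap.id) hg z hs,
      tmap_smul_id]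
    rfl
  rw [extend_apply, F.annihilate_create u hu, h1, _root_.map_smul, ← actLast_tmap, hz,
    _root_.map_smul, tmap_tmap, LinearMap.id_comp, add_smul, one_smul, add_comm]
  rfl

theorem tmap_comp_eq_smul {X : Inn} [FiniteDimensional ℂ X] {ι : Sort*} (s : ι → (A ≃ₗᵢ[ℂ] A))
    {g : A →ₗ[ℂ] B} {g' : B →ₗ[ℂ] A} (c : ℂ) (hg : ∀ x, (∀ i, s i x = x) → g' (g x) = c • x)
    {z : A.tensor X} (hs : ∀ i, tcongr (s i) 1 z = z) :
    tmap g' LinearMap.id (tmap g LinearMap.id z) = c • z := by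
  rw [tmap_tmap, LinearMap.id_comp,
    tmap_eq_of_fixed s (g' ∘ₗ g) (c • LinearMap.id) hg z hs, tmap_smul_id, tmap_id]
  rfl

end extend

/-- The map `(W ⊗ V) ^ ⊗ n → F V` that multiplies generators. -/
def prodGen (V : FinInn) : (n : ℕ) → (W.tensor V.toInn).tpow n →ₗ[ℂ] F.obj V
  | 0 => LinearMap.toSpanSingleton ℂ (F.obj V) (F.one V)
  | n + 1 => F.extend u (prodGen V n)

theorem map_prodGen (f : V →ₗ[ℂ] V') (n : ℕ) (x : (W.tensor V.toInn).tpow n) :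
    F.map f (F.prodGen u V n x) = F.prodGen u V' n (tpowMap (tmap LinearMap.id f) n x) := by
  induction n with
  | zero =>
    change F.map f ((show ℂ from x) • F.one V) = (show ℂ from x) • F.one V'
    rw [_root_.map_smul, map_one]
  | succ n ih => exact F.map_extend u ih x

theorem prodGen_mem (n : ℕ) (x : (W.tensor V.toInn).tpow n) :
    F.prodGen u V n x ∈ F.component n V := by
  induction n with
  | zero => exact Submodule.smul_mem _ (show ℂ from x) F.one_mem_component
  | succ n ih => exact F.extend_mem u ih x

theorem prodGen_tpowMul (i j : ℕ)
    (z : ((W.tensor V.toInn).tpow i).tensor ((W.tensor V.toInn).tpow j)) :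
    F.prodGen u V (i + j) (tpowMul (W.tensor V.toInn) i j z) =
      F.mul V (tmap (F.prodGen u V i) (F.prodGen u V j) z) := by
  induction j with
  | zero =>
    have : F.prodGen u V i ∘ₗ tpowMul (W.tensor V.toInn) i 0 =
        F.mul V ∘ₗ tmap (F.prodGen u V i) (F.prodGen u V 0) := tensor_ext fun x l => by
      change F.prodGen u V i ((show ℂ from l) • x) =
        F.mul V (tmk _ _ (F.prodGen u V i x) ((show ℂ from l) • F.one V))
      rw [_root_.map_smul, _root_.map_smul, _root_.map_smul, mul_one]
    exact LinearMap.congr_fun this z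
  | succ j ih => exact F.extend_tassoc_symm u ih z

variable {R : RMatrix W}

theorem tcongr_site_of_fixed {n : ℕ} {y : (W.tensor V.toInn).tpow (n + 1)}
    (hy : ∀ i, i + 1 < n + 1 → RMatrix.site (R.boxFlip V).toEquiv (n + 1) i y = y)
    {i : ℕ} (hi : i + 1 < n) :
    tcongr (RMatrix.site (R.boxFlip V).toEquiv n i) (1 : W.tensor V.toInn ≃ₗᵢ[ℂ] _) y = y := by
  obtain ⟨m, rfl⟩ : ∃ m, n = m + 1 := ⟨n - 1, by omega⟩
  have := hy i (by omega)
  rwa [RMatrix.site_ne _ _ _ (by omega)] at this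

theorem prodGen_site (hu : F.Intertwines u R) (n i : ℕ) (x : (W.tensor V.toInn).tpow (n + 1)) :
    F.prodGen u V (n + 1) (RMatrix.site (R.boxFlip V).toEquiv (n + 1) i x) =
      F.prodGen u V (n + 1) x := by
  induction n with
  | zero => rfl
  | succ n ih =>
    by_cases h : i = n
    · subst h
      rw [RMatrix.site_last]
      exact F.extend_actLast u hu (F.prodGen u V i) x
    · rw [RMatrix.site_ne _ _ _ h]
      exact F.extend_tcongr u ih x

theorem prodGen_rep (hu : F.Intertwines u R) (n : ℕ) (σ : Equiv.Perm (Fin n))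
    (x : (W.tensor V.toInn).tpow n) :
    F.prodGen u V n ((R.boxFlip V).rep n σ x) = F.prodGen u V n x := by
  cases n with
  | zero => rfl
  | succ n =>
    have hσ : σ ∈ Submonoid.closure
        (Set.range fun i : Fin n => Equiv.swap i.castSucc i.succ) := by
      rw [Equiv.Perm.mclosure_swap_castSucc_succ]; trivial
    induction hσ using Submonoid.closure_induction_left generalizing x with
    | one => rw [_root_.map_one]; rfl
    | mul_left a ha b hb ih =>
      obtain ⟨i, rfl⟩ := ha
      rw [_root_.map_mul, iso_mul_apply, RMatrix.rep_swap, F.prodGen_site u hu, ih]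

/-- Averaging over the symmetric group does not change the product of the generators. -/
theorem exists_invariant_prodGen (hu : F.Intertwines u R) (n : ℕ)
    (x : (W.tensor V.toInn).tpow n) :
    ∃ y ∈ R.invariants V n, F.prodGen u V n y = F.prodGen u V n x := by
  refine ⟨((n.factorial : ℂ))⁻¹ • ∑ σ, (R.boxFlip V).rep n σ x, fun σ => ?_, ?_⟩
  · rw [_root_.map_smul, map_sum]
    congr 1
    refine Fintype.sum_equiv (Equiv.mulLeft σ) _ _ fun τ => ?_
    rw [Equiv.coe_mulLeft, _root_.map_mul]
    rfl
  · rw [_root_.map_smul, map_sum, Finset.sum_congr rfl fun σ _ => F.prodGen_rep u hu n σ x,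
      Finset.sum_const, Finset.card_univ, Fintype.card_perm, Fintype.card_fin,
      ← Nat.cast_smul_eq_nsmul ℂ, smul_smul,
      inv_mul_cancel₀ (by exact_mod_cast n.factorial_ne_zero),
      one_smul]

theorem inner_one_one : inner ℂ (F.one V) (F.one V) = (1 : ℂ) := by
  have h : LinearMap.adjoint (0 : zero →ₗ[ℂ] V) ∘ₗ (0 : zero →ₗ[ℂ] V) = LinearMap.id :=
    LinearMap.ext fun _ => rfl
  have h1 : ‖F.vacuum‖ = 1 := by
    rw [← F.isExponential.iota_unitary.1, iota_vacuum]
    exact norm_one (α := ℂ)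
  rw [one, inner_map_map_adjoint, h, map_id, LinearMap.id_apply, inner_self_eq_norm_sq_to_K, h1]
  simp

variable [FiniteDimensional ℂ W]

/-- The adjoint of `prodGen`, an iterated annihilation operator. -/
def coprodGen (V : FinInn) : (n : ℕ) → F.obj V →ₗ[ℂ] (W.tensor V.toInn).tpow n
  | 0 => (innerSL ℂ (F.one V)).toLinearMap
  | n + 1 => tmap (coprodGen V n) LinearMap.id ∘ₗ F.annihilate u V

theorem inner_prodGen (n : ℕ) (x : (W.tensor V.toInn).tpow n) (a : F.obj V) :
    inner ℂ (F.prodGen u V n x) a = inner ℂ x (F.coprodGen u V n a) := by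
  induction n generalizing a with
  | zero =>
    change inner ℂ ((show ℂ from x) • F.one V) a =
      inner ℂ (F.one V) a * starRingEnd ℂ (show ℂ from x)
    rw [inner_smul_left, mul_comm]
  | succ n ih =>
    exact (F.inner_create u _ a).trans (inner_tmap (g' := LinearMap.id) ih (fun _ _ => rfl) x _)

/-- The homogeneous components of `F V` are spanned by products of generators. -/
theorem exists_prodGen (n : ℕ) {x : F.obj V} (hx : x ∈ F.component n V) :
    ∃ y, F.prodGen u V n y = x := by
  induction n generalizing x with
  | zero =>
    obtain ⟨l, rfl⟩ := F.exists_smul_one hx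
    exact ⟨l, rfl⟩
  | succ n ih => exact F.exists_extend u (fun x hx => ih hx) hx

/-- On an invariant tensor each of the `n + 1` factors is as good as the last, so annihilation
removes the last factor with multiplicity `n + 1`. -/
theorem annihilate_prodGen (hu : F.Intertwines u R) (n : ℕ)
    (y : (W.tensor V.toInn).tpow (n + 1))
    (hy : ∀ i, i + 1 < n + 1 → RMatrix.site (R.boxFlip V).toEquiv (n + 1) i y = y) :
    F.annihilate u V (F.prodGen u V (n + 1) y) =
      ((n : ℂ) + 1) • tmap (F.prodGen u V n) LinearMap.id y := by
  induction n with
  | zero =>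
    have := F.annihilate_extend u hu (g := F.prodGen u V 0) (fun l => by
      change F.annihilate u V ((show ℂ from l) • F.one V) = 0
      rw [_root_.map_smul, annihilate_one, smul_zero]) y
    exact this.trans ((one_smul ℂ _).symm.trans (congrArg (fun c : ℂ => c • _) (by simp)))
  | succ n ih =>
    rw [Nat.cast_succ]
    have hl := hy n (by omega)
    rw [RMatrix.site_last] at hl
    exact F.annihilate_extend_extend u hu
      (fun i : {i : ℕ // i + 1 < n + 1} => RMatrix.site (R.boxFlip V).toEquiv (n + 1) i) _
      (fun x hx => ih x fun i hi => hx ⟨i, hi⟩) (fun i => tcongr_site_of_fixed hy i.2) hl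

/-- Annihilating the factors one after another produces the multiplicities `n, n - 1, …, 1`. -/
theorem coprodGen_prodGen (hu : F.Intertwines u R) (n : ℕ) (y : (W.tensor V.toInn).tpow n)
    (hy : ∀ i, i + 1 < n → RMatrix.site (R.boxFlip V).toEquiv n i y = y) :
    F.coprodGen u V n (F.prodGen u V n y) = (n.factorial : ℂ) • y := by
  induction n with
  | zero =>
    change inner ℂ (F.one V) ((show ℂ from y) • F.one V) = ((1 : ℕ) : ℂ) * (show ℂ from y)
    rw [inner_smul_right, inner_one_one, Nat.cast_one, one_mul]
    exact _root_.mul_one (show ℂ from y)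
  | succ n ih =>
    have h : F.coprodGen u V (n + 1) (F.prodGen u V (n + 1) y) =
      tmap (F.coprodGen u V n) LinearMap.id (F.annihilate u V (F.prodGen u V (n + 1) y)) := rfl
    have h1 := tmap_comp_eq_smul
      (fun i : {i : ℕ // i + 1 < n} => RMatrix.site (R.boxFlip V).toEquiv n i) _
      (fun x hx => ih x fun i hi => hx ⟨i, hi⟩)
      (fun i => tcongr_site_of_fixed (R := R) (V := V) hy i.2)
    rw [h, F.annihilate_prodGen u hu n y hy, _root_.map_smul]
    exact (congrArg (fun z => ((n : ℂ) + 1) • z) h1).trans ((smul_smul (_ : ℂ) _ y).trans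
      (congrArg (fun c : ℂ => c • y) (by push_cast [Nat.factorial_succ]; ring)))

/-- On invariants, products of generators of degree `n` multiply inner products by `n!`. -/
theorem inner_prodGen_prodGen (hu : F.Intertwines u R) (n : ℕ) (x : (W.tensor V.toInn).tpow n)
    {y : (W.tensor V.toInn).tpow n} (hy : y ∈ R.invariants V n) :
    inner ℂ (F.prodGen u V n x) (F.prodGen u V n y) = (n.factorial : ℂ) * inner ℂ x y := by
  rw [inner_prodGen, F.coprodGen_prodGen u hu n y, inner_smul_right]
  intro i hi
  obtain ⟨m, rfl⟩ : ∃ m, n = m + 1 := ⟨n - 1, by omega⟩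
  have := hy (Equiv.swap (⟨i, by omega⟩ : Fin m).castSucc (⟨i, by omega⟩ : Fin m).succ)
  rwa [RMatrix.rep_swap] at this

end PolyExpFunctor

namespace Inn

/-! ### Direct sums -/

variable {X Y : ℕ → Inn}

theorem directSum_induction {p : directSum X → Prop} (z : directSum X) (zero : p 0)
    (lof : ∀ n x, p (dsLof X n x)) (add : ∀ x y, p x → p y → p (x + y)) : p z :=
  DirectSum.induction_on (motive := p) z zero lof add

@[simp] theorem dsLift_dsLof {E : Type*} [AddCommGroup E] [Module ℂ E] (f : ∀ n, X n →ₗ[ℂ] E)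
    (n : ℕ) (x : X n) : dsLift f (dsLof X n x) = f n x :=
  DirectSum.toModule_lof ℂ (M := fun n => X n) (φ := f) n x

@[simp] theorem dsMap_dsLof (f : ∀ n, X n →ₗ[ℂ] Y n) (n : ℕ) (x : X n) :
    dsMap f (dsLof X n x) = dsLof Y n (f n x) :=
  DirectSum.lmap_lof f n x

theorem dsComponent_dsLof_self (n : ℕ) (x : X n) : dsComponent X n (dsLof X n x) = x :=
  DirectSum.component.lof_self ℂ (M := fun n => X n) n x

theorem dsComponent_dsLof_of_ne {m n : ℕ} (h : m ≠ n) (x : X m) :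
    dsComponent X n (dsLof X m x) = 0 :=
  (DirectSum.component.of ℂ (M := fun n => X n) n m x).trans (dif_neg h)

theorem inner_dsLof (n : ℕ) (x : X n) (y : directSum X) :
    inner ℂ (dsLof X n x) y = inner ℂ x (dsComponent X n y) := by
  classical
  have h : inner ℂ (dsLof X n x) y =
    inner ℂ (dsComponent X n (dsLof X n x)) (dsComponent X n y) := by
    refine (Finset.sum_subset (s₂ := {n}) DFinsupp.support_single_subset fun m _ hm => ?_).trans
      (Finset.sum_singleton _ _)
    have h0 : dsComponent X m (dsLof X n x) = 0 := DFinsupp.notMem_support_iff.1 hm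
    exact (congrArg (fun a => inner ℂ a (dsComponent X m y)) h0).trans (inner_zero_left _)
  rw [h, dsComponent_dsLof_self]

theorem linearMap_ext_dsLof {E : Type*} [AddCommGroup E] [Module ℂ E] {f g : directSum X →ₗ[ℂ] E}
    (h : ∀ n x, f (dsLof X n x) = g (dsLof X n x)) : f = g :=
  LinearMap.ext fun z => by
    induction z using directSum_induction with
    | zero => simp
    | lof n x => exact h n x
    | add x y hx hy => simp [hx, hy]

end Inn

namespace PolyExpFunctor

open FinInn Inn ExpDatum

variable (F : PolyExpFunctor) {V V' : FinInn} {W : Inn} (u : W ≃ₗᵢ[ℂ] F.degOne)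
  (R : RMatrix W)

/-! ### The comparison of `F^R` with `F` -/

/-- The map `F^R V → F V` that is `(n!) ^ (-1/2)` times the multiplication of generators in
degree `n`. -/
def fock (V : FinInn) : directSum (R.expComponent V) →ₗ[ℂ] F.obj V :=
  dsLift fun n => ((Real.sqrt (n.factorial : ℕ) : ℝ) : ℂ)⁻¹ • (F.prodGen u V n ∘ₗ R.expIncl V n)

theorem fock_dsLof (n : ℕ) (x : R.expComponent V n) :
    F.fock u R V (dsLof _ n x) =
      ((Real.sqrt (n.factorial : ℕ) : ℝ) : ℂ)⁻¹ • F.prodGen u V n (R.expIncl V n x) := by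
  rw [fock, dsLift_dsLof]; rfl

theorem fock_dsLof_mem (n : ℕ) (x : R.expComponent V n) :
    F.fock u R V (dsLof _ n x) ∈ F.component n V := by
  rw [fock_dsLof]
  exact Submodule.smul_mem _ _ (F.prodGen_mem u n _)

theorem fock_natural (f : V →ₗ[ℂ] V') (x : directSum (R.expComponent V)) :
    F.fock u R V' (dsMap (R.expComponentMap f) x) = F.map f (F.fock u R V x) := by
  induction x using directSum_induction with
  | zero => simp
  | lof n x => rw [dsMap_dsLof, fock_dsLof, fock_dsLof, RMatrix.expIncl_map, _root_.map_smul,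
      map_prodGen]
  | add x y hx hy => simp only [_root_.map_add, hx, hy]

/-- In degree zero both sides read off the scalar. In positive degree both vanish, because `F 0` has
no elements of positive degree. -/
theorem fock_iota (x : directSum (R.expComponent zero)) :
    F.iota (F.fock u R zero x) = R.expDatum.iota x := by
  have key : ∀ n (x : R.expComponent zero n), F.iota (F.fock u R zero (dsLof _ n x)) =
      R.expIncl zero 0 (dsComponent (R.expComponent zero) 0 (dsLof _ n x)) := by
    intro n x
    cases n with
    | zero =>
      have h0 : F.one zero = F.vacuum := by
        have : (0 : zero →ₗ[ℂ] zero) = LinearMap.id := LinearMap.ext fun _ => rfl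
        rw [one, this, map_id, LinearMap.id_apply]
      have h1 : F.prodGen u zero 0 (R.expIncl zero 0 x) =
        (show ℂ from R.expIncl zero 0 x) • F.one zero := rfl
      rw [dsComponent_dsLof_self, fock_dsLof, h1, h0, _root_.map_smul, _root_.map_smul,
        iota_vacuum, Nat.factorial_zero, Nat.cast_one, Real.sqrt_one, Complex.ofReal_one, inv_one,
        one_smul]
      exact _root_.mul_one (show ℂ from R.expIncl zero 0 x)
    | succ n =>
      -- On the zero space `0 • id` is the identity, but it acts by `0 ^ (n + 1) = 0` in degree `n +
      -- 1`.
      have h := F.map_smul_id_of_mem (F.fock_dsLof_mem u R (V := zero) (n + 1) x) 0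
      have : ((0 : ℂ) • LinearMap.id : zero →ₗ[ℂ] zero) = LinearMap.id := LinearMap.ext fun _ => rfl
      rw [this, map_id, zero_pow n.succ_ne_zero, zero_smul, LinearMap.id_apply] at h
      rw [h, dsComponent_dsLof_of_ne n.succ_ne_zero, _root_.map_zero, _root_.map_zero]
      rfl
  exact LinearMap.congr_fun (linearMap_ext_dsLof (f := F.iota ∘ₗ F.fock u R zero)
    (g := R.expIncl zero 0 ∘ₗ dsComponent (R.expComponent zero) 0) key) x

variable {R}

/-- All `(i + j)!` summands of `φ_{i,j}` have the same product of generators, and `τ` separates the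
generators at `V` from those at `V'`. -/
theorem prodGen_phiMap (hu : F.Intertwines u R) (V V' : FinInn) (i j : ℕ)
    (z : ((W.tensor V.toInn).tpow i).tensor ((W.tensor V'.toInn).tpow j)) :
    F.tau V V' (F.prodGen u (V.dsum V') (i + j) (R.phiMap V V' i j z)) =
      (((Real.sqrt ((i + j).factorial * i.factorial * j.factorial : ℕ) : ℝ) : ℂ)⁻¹ *
        (i + j).factorial) • tmap (F.prodGen u V i) (F.prodGen u V' j) z := by
  have h1 : F.tau V V' (F.prodGen u (V.dsum V') (i + j) (RMatrix.iotaMap W V V' i j z)) =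
      tmap (F.prodGen u V i) (F.prodGen u V' j) z := by
    have h2 : F.prodGen u (V.dsum V') i ∘ₗ tpowMap (tmap LinearMap.id (dinl V V')) i =
        F.map (dinl V V') ∘ₗ F.prodGen u V i :=
      LinearMap.ext fun x => (F.map_prodGen u (dinl V V') i x).symm
    have h3 : F.prodGen u (V.dsum V') j ∘ₗ tpowMap (tmap LinearMap.id (dinr V V')) j =
        F.map (dinr V V') ∘ₗ F.prodGen u V' j :=
      LinearMap.ext fun x => (F.map_prodGen u (dinr V V') j x).symm
    rw [RMatrix.iotaMap, LinearMap.comp_apply, prodGen_tpowMul, tmap_tmap, h2, h3, ← tmap_tmap,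
      tau_mul_inl_inr]
  have h2 : ∀ σ, F.prodGen u (V.dsum V') (i + j)
      (((R.boxFlip (V.dsum V')).rep (i + j) σ).toLinearEquiv.toLinearMap
        (RMatrix.iotaMap W V V' i j z)) =
      F.prodGen u (V.dsum V') (i + j) (RMatrix.iotaMap W V V' i j z) := fun σ =>
    F.prodGen_rep u hu (i + j) σ _
  simp only [RMatrix.phiMap, LinearMap.smul_apply, LinearMap.sum_apply, LinearMap.comp_apply]
  rw [_root_.map_smul, map_sum, Finset.sum_congr rfl fun σ _ => h2 σ,
    Finset.sum_const, Finset.card_univ, Fintype.card_perm, Fintype.card_fin,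
    ← Nat.cast_smul_eq_nsmul ℂ, smul_smul, _root_.map_smul, h1]

theorem kappa_dsLof (V V' : FinInn) (i j : ℕ) (x : R.expComponent V i) (y : R.expComponent V' j) :
    R.kappa V V' (tmk _ _ (dsLof _ i x) (dsLof _ j y)) =
      dsLof _ (i + j) (R.kappaComponent V V' i j (tmk _ _ x y)) := by
  rw [RMatrix.kappa, tlift_tmk, dsLift_dsLof, LinearMap.flip_apply, dsLift_dsLof]
  rfl

theorem expIncl_kappaComponent (V V' : FinInn) (i j : ℕ)
    (z : (R.expComponent V i).tensor (R.expComponent V' j)) :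
    R.expIncl (V.dsum V') (i + j) (R.kappaComponent V V' i j z) =
      R.phiMap V V' i j (tmap (R.expIncl V i) (R.expIncl V' j) z) := rfl

/-- The normalizations of `fock` in degree `i + j` and of `φ_{i,j}`, times the order of the
symmetric group, give the product of the normalizations of `fock` in degrees `i` and `j`. -/
theorem factorial_sqrt_identity (i j : ℕ) :
    ((Real.sqrt ((i + j).factorial : ℕ) : ℝ) : ℂ)⁻¹ *
      (((Real.sqrt ((i + j).factorial * i.factorial * j.factorial : ℕ) : ℝ) : ℂ)⁻¹ *
        (i + j).factorial) =
    ((Real.sqrt (i.factorial : ℕ) : ℝ) : ℂ)⁻¹ * ((Real.sqrt (j.factorial : ℕ) : ℝ) : ℂ)⁻¹ := by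
  have h : Real.sqrt ((i + j).factorial : ℕ) * Real.sqrt ((i + j).factorial : ℕ) =
      (i + j).factorial := Real.mul_self_sqrt (Nat.cast_nonneg _)
  have h0 : Real.sqrt ((i + j).factorial : ℕ) ≠ 0 :=
    (Real.sqrt_pos.2 (by exact_mod_cast (i + j).factorial_pos)).ne'
  rw [Nat.cast_mul, Nat.cast_mul, Real.sqrt_mul (by positivity), Real.sqrt_mul (by positivity)]
  norm_cast
  set a := Real.sqrt ((i + j).factorial : ℕ)
  rw [← h]
  field_simp

theorem tau_fock_kappa (hu : F.Intertwines u R) (V V' : FinInn)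
    (z : (directSum (R.expComponent V)).tensor (directSum (R.expComponent V'))) :
    F.tau V V' (F.fock u R (V.dsum V') (R.kappa V V' z)) =
      tmap (F.fock u R V) (F.fock u R V') z := by
  induction z using tensor_induction with
  | zero => simp
  | tmul a b =>
    induction a using directSum_induction with
    | zero => simp
    | lof i x =>
      induction b using directSum_induction with
      | zero => simp
      | lof j y =>
        rw [kappa_dsLof, fock_dsLof, expIncl_kappaComponent, _root_.map_smul,
          F.prodGen_phiMap u hu, smul_smul, factorial_sqrt_identity, tmap_tmk, tmap_tmk, tmap_tmk,
          fock_dsLof, fock_dsLof, _root_.map_smul, _root_.map_smul, LinearMap.smul_apply, smul_smul,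
          mul_comm]
      | add a b ha hb => simp only [_root_.map_add, ha, hb]
    | add a b ha hb => simp only [_root_.map_add, LinearMap.add_apply, ha, hb]
  | add a b ha hb => simp only [_root_.map_add, ha, hb]

variable [FiniteDimensional ℂ W]

/-- Different degrees are orthogonal on both sides; in degree `n` the two normalizing factors cancel
the `n!` of `inner_prodGen_prodGen`. -/
theorem inner_fock (hu : F.Intertwines u R) (V : FinInn) (x y : directSum (R.expComponent V)) :
    inner ℂ (F.fock u R V x) (F.fock u R V y) = inner ℂ x y := by
  induction x using directSum_induction with
  | zero => simp
  | lof n a =>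
    induction y using directSum_induction with
    | zero => simp
    | lof m b =>
      rw [inner_dsLof]
      by_cases h : m = n
      · subst h
        have h0 : ((Real.sqrt (m.factorial : ℕ) : ℝ) : ℂ) * Real.sqrt (m.factorial : ℕ) =
            m.factorial := by
          rw [← Complex.ofReal_mul, Real.mul_self_sqrt (Nat.cast_nonneg _), Complex.ofReal_natCast]
        have h1 : (m.factorial : ℂ) ≠ 0 := by exact_mod_cast m.factorial_ne_zero
        rw [dsComponent_dsLof_self, fock_dsLof, fock_dsLof, inner_smul_left, inner_smul_right,
          F.inner_prodGen_prodGen u hu m _ (y := R.expIncl V m b) b.2, map_inv₀, Complex.conj_ofReal,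
          ← mul_assoc, ← mul_assoc, ← mul_inv, h0, inv_mul_cancel₀ h1, one_mul]
        rfl
      · rw [dsComponent_dsLof_of_ne h, inner_zero_right]
        exact F.inner_eq_zero_of_mem (Ne.symm h) (F.fock_dsLof_mem u R n a)
          (F.fock_dsLof_mem u R m b)
    | add a b ha hb => simp only [_root_.map_add, inner_add_right, ha, hb]
  | add a b ha hb => simp only [_root_.map_add, inner_add_left, ha, hb]

/-- Products of generators span every homogeneous component, and averaging allows the tensors to be
taken invariant. -/
theorem fock_surjective (hu : F.Intertwines u R) (V : FinInn) :
    Function.Surjective (F.fock u R V) := by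
  rw [← LinearMap.range_eq_top, eq_top_iff, ← F.iSup_component]
  refine iSup_le fun n x hx => ?_
  obtain ⟨y, rfl⟩ := F.exists_prodGen u n hx
  obtain ⟨y', hy', h⟩ := F.exists_invariant_prodGen u hu n y
  rw [← h]
  have h0 : ((Real.sqrt (n.factorial : ℕ) : ℝ) : ℂ) ≠ 0 := by
    exact_mod_cast (Real.sqrt_pos.2 (by exact_mod_cast n.factorial_pos)).ne'
  refine ⟨((Real.sqrt (n.factorial : ℕ) : ℝ) : ℂ) •
    dsLof _ n (show R.expComponent V n from ⟨y', hy'⟩), ?_⟩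
  rw [_root_.map_smul, fock_dsLof, smul_smul, mul_inv_cancel₀ h0, one_smul]
  rfl

/-- The unitary `F^R V → F V`. -/
def fockUnitary (hu : F.Intertwines u R) (V : FinInn) :
    directSum (R.expComponent V) ≃ₗᵢ[ℂ] F.obj V :=
  LinearIsometryEquiv.ofSurjective ((F.fock u R V).isometryOfInner (F.inner_fock u hu V))
    (F.fock_surjective u hu V)

/-- By `tau_fock_kappa`, `κ` is a composite of unitaries: `fock ⊗ fock`, then the inverses of `τ`
and of `fock`. -/
theorem kappa_bijective (hu : F.Intertwines u R) (V V' : FinInn) :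
    Function.Bijective (R.kappa V V') := by
  let e := tcongr (F.fockUnitary u hu V) (F.fockUnitary u hu V')
  have h : ∀ z, R.kappa V V' z = (F.fockUnitary u hu (V.dsum V')).symm
      ((F.tauUnitary V V').symm (e z)) := by
    intro z
    rw [LinearIsometryEquiv.eq_symm_apply, LinearIsometryEquiv.eq_symm_apply]
    exact F.tau_fock_kappa u hu V V' z
  rw [funext h]
  exact ((e.trans (F.tauUnitary V V').symm).trans (F.fockUnitary u hu (V.dsum V')).symm).bijective

theorem tau_fockUnitary (hu : F.Intertwines u R) (V V' : FinInn)
    (x : directSum (R.expComponent (V.dsum V'))) :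
    F.tau V V' (F.fockUnitary u hu (V.dsum V') x) =
      tcongr (F.fockUnitary u hu V) (F.fockUnitary u hu V') (R.expDatum.tau V V' x) := by
  have hb := F.kappa_bijective u hu V V'
  obtain ⟨z, rfl⟩ := hb.2 x
  have h : R.expDatum.tau V V' (R.kappa V V' z) = z := by
    -- Bijectivity of `κ` selects the branch of the definition in which `τ` is its inverse rather
    -- than zero.
    have h' : R.expDatum.tau V V' =
      (LinearEquiv.ofBijective (R.kappa V V') hb).symm.toLinearMap := dif_pos hb
    rw [h']
    exact (LinearEquiv.ofBijective (R.kappa V V') hb).symm_apply_apply z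
  refine (F.tau_fock_kappa u hu V V' z).trans ?_
  exact congrArg (tmap (F.fock u R V) (F.fock u R V')) h.symm

end PolyExpFunctor

namespace ExpDatum

open FinInn Inn

/-! ### Transport of structure -/

section transport

variable {D : ExpDatum} {F : PolyExpFunctor} (v : ∀ V : FinInn, D.obj V ≃ₗᵢ[ℂ] F.obj V)

theorem tcongr_tmap {A A' B B' C C' E E' : Inn} {f : A →ₗ[ℂ] A'} {g : B →ₗ[ℂ] B'}
    {f' : C →ₗ[ℂ] C'} {g' : E →ₗ[ℂ] E'} {a : A ≃ₗᵢ[ℂ] C} {a' : A' ≃ₗᵢ[ℂ] C'} {b : B ≃ₗᵢ[ℂ] E}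
    {b' : B' ≃ₗᵢ[ℂ] E'} (hf : ∀ x, a' (f x) = f' (a x)) (hg : ∀ x, b' (g x) = g' (b x))
    (z : A.tensor B) : tcongr a' b' (tmap f g z) = tmap f' g' (tcongr a b z) := by
  induction z using tensor_induction with
  | zero => simp
  | tmul x y => simp only [tmap_tmk, tcongr_tmk, hf, hg]
  | add x y hx hy => simp only [_root_.map_add, hx, hy]

theorem tcongr_tassoc {A A' B B' C C' : Inn} (a : A ≃ₗᵢ[ℂ] A') (b : B ≃ₗᵢ[ℂ] B')
    (c : C ≃ₗᵢ[ℂ] C') (z : (A.tensor B).tensor C) :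
    tcongr a (tcongr b c) (tassoc _ _ _ z) = tassoc _ _ _ (tcongr (tcongr a b) c z) := by
  induction z using tensor_induction with
  | zero => simp
  | tmul x y =>
    induction x using tensor_induction with
    | zero => simp
    | tmul x x' => rfl
    | add x x' hx hy => simp only [_root_.map_add, LinearMap.add_apply, hx, hy]
  | add x y hx hy => simp only [_root_.map_add, hx, hy]

/-- The polynomiality of a functor is invariant under isomorphism. -/
theorem isPolynomial_of_iso
    (hn : ∀ (V W : FinInn) (f : V →ₗ[ℂ] W) (x : D.obj V),
      v W (D.map f x) = F.map f (v V x)) :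
    D.IsPolynomial := by
  intro V W n f
  obtain ⟨c, hc⟩ := F.isPolynomial V W n f
  let e : (F.obj V →ₗ[ℂ] F.obj W) ≃ₗ[ℂ] (D.obj V →ₗ[ℂ] D.obj W) :=
    LinearEquiv.arrowCongr (v V).symm.toLinearEquiv (v W).symm.toLinearEquiv
  refine ⟨c.mapRange e (_root_.map_zero e), fun l => ?_⟩
  have h : D.map (∑ i, l i • f i) = e (F.map (∑ i, l i • f i)) := LinearMap.ext fun x => by
    apply (v W).injective
    rw [hn]
    exact ((v W).apply_symm_apply _).symm
  rw [h, hc, Finsupp.sum_mapRange_index (by simp)]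
  simp only [Finsupp.sum, map_sum, _root_.map_smul]

/-- A datum that is unitarily isomorphic to an exponential functor is an exponential functor. -/
theorem isExponential_of_iso
    (hn : ∀ (V W : FinInn) (f : V →ₗ[ℂ] W) (x : D.obj V),
      v W (D.map f x) = F.map f (v V x))
    (ht : ∀ (V W : FinInn) (x : D.obj (V.dsum W)),
      F.tau V W (v (V.dsum W) x) = tcongr (v V) (v W) (D.tau V W x))
    (hi : ∀ x, F.iota (v zero x) = D.iota x) :
    D.IsExponential where
  finiteDimensional V := (v V).symm.toLinearEquiv.finiteDimensional
  map_adjoint f x y := by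
    rw [← (v _).inner_map_map, hn, F.isExponential.map_adjoint, ← hn, (v _).inner_map_map]
  tau_unitary V W := by
    constructor
    · intro x
      rw [← (tcongr (v V) (v W)).norm_map, ← ht, (F.isExponential.tau_unitary V W).1,
        (v _).norm_map]
    · intro z
      obtain ⟨y, hy⟩ := F.tau_surjective V W (tcongr (v V) (v W) z)
      refine ⟨(v _).symm y, (tcongr (v V) (v W)).injective ?_⟩
      rw [← ht, (v _).apply_symm_apply, hy]
  tau_natural {V V' W W'} f g := LinearMap.ext fun x => by
    apply (tcongr (v V') (v W')).injective
    rw [LinearMap.comp_apply, LinearMap.comp_apply, ← ht, hn, F.tau_natural_apply, ht,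
      tcongr_tmap (hn _ _ f) (hn _ _ g)]
  tau_assoc V W X := LinearMap.ext fun x => by
    apply (tcongr (v V) (tcongr (v W) (v X))).injective
    have h1 : ∀ y, tcongr (v V) (tcongr (v W) (v X)) (tmap LinearMap.id (D.tau W X) y) =
        tmap LinearMap.id (F.tau W X) (tcongr (v V) (v (W.dsum X)) y) :=
      tcongr_tmap (fun _ => rfl) fun x => (ht W X x).symm
    have h2 : ∀ y, tcongr (tcongr (v V) (v W)) (v X) (tmap (D.tau V W) LinearMap.id y) =
        tmap (F.tau V W) LinearMap.id (tcongr (v (V.dsum W)) (v X) y) :=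
      tcongr_tmap (fun x => (ht V W x).symm) (fun _ => rfl)
    simp only [LinearMap.comp_apply, LinearEquiv.coe_coe, LinearIsometryEquiv.coe_toLinearEquiv]
    rw [h1, ← ht, hn, tcongr_tassoc, h2, ← ht]
    exact LinearMap.congr_fun (F.isExponential.tau_assoc V W X) (v _ x)
  iota_unitary := by
    constructor
    · intro x
      rw [← hi, F.isExponential.iota_unitary.1, (v _).norm_map]
    · intro l
      obtain ⟨y, hy⟩ := F.isExponential.iota_unitary.2 l
      exact ⟨(v _).symm y, by rw [← hi, (v _).apply_symm_apply, hy]⟩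
  iota_right V := LinearMap.ext fun x => by
    apply (v V).injective
    have h1 : ∀ y, v V (trid _ (tmap LinearMap.id D.iota y)) =
        trid _ (tmap LinearMap.id F.iota (tcongr (v V) (v zero) y)) := by
      intro y
      induction y using tensor_induction with
      | zero => simp
      | tmul a b =>
        rw [tmap_tmk, tcongr_tmk, tmap_tmk, hi]
        exact (v V).map_smul (show ℂ from D.iota b) a
      | add a b ha hb => simp only [_root_.map_add, ha, hb]
    simp only [LinearMap.comp_apply, LinearEquiv.coe_coe, LinearIsometryEquiv.coe_toLinearEquiv]
    rw [h1, ← ht, hn]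
    exact LinearMap.congr_fun (F.isExponential.iota_right V) (v _ x)
  iota_left V := LinearMap.ext fun x => by
    apply (v V).injective
    have h1 : ∀ y, v V (tlid _ (tmap D.iota LinearMap.id y)) =
        tlid _ (tmap F.iota LinearMap.id (tcongr (v zero) (v V) y)) := by
      intro y
      induction y using tensor_induction with
      | zero => simp
      | tmul a b =>
        rw [tmap_tmk, tcongr_tmk, tmap_tmk, hi]
        exact (v V).map_smul (show ℂ from D.iota a) b
      | add a b ha hb => simp only [_root_.map_add, ha, hb]
    simp only [LinearMap.comp_apply, LinearEquiv.coe_coe, LinearIsometryEquiv.coe_toLinearEquiv]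
    rw [h1, ← ht, hn]
    exact LinearMap.congr_fun (F.isExponential.iota_left V) (v _ x)

end transport

end ExpDatum

/-! ### Monoidal isomorphisms, and `F^R` as a polynomial exponential functor -/

namespace PolyExpFunctor

open FinInn Inn ExpDatum

variable {F G H : PolyExpFunctor}

theorem MonoidallyIso.symm (h : F.MonoidallyIso G) : G.MonoidallyIso F := by
  obtain ⟨v, hn, ht⟩ := h
  refine ⟨fun V => (v V).symm, fun V W f x => ?_, fun V W x => ?_⟩
  · rw [LinearIsometryEquiv.symm_apply_eq, hn, (v V).apply_symm_apply]
  · apply (tcongr (v V) (v W)).injective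
    rw [← ht, (v _).apply_symm_apply]
    have : ∀ z, tcongr (v V) (v W) (tcongr (v V).symm (v W).symm z) = z := fun z =>
      DFunLike.congr_fun (isometry_ext
        (f := (tcongr (v V).symm (v W).symm).trans (tcongr (v V) (v W))) (g := 1) fun a b => by
          simp [iso_one_apply]) z
    rw [this]

theorem MonoidallyIso.trans (h : F.MonoidallyIso G) (h' : G.MonoidallyIso H) :
    F.MonoidallyIso H := by
  obtain ⟨v, hn, ht⟩ := h
  obtain ⟨v', hn', ht'⟩ := h'
  refine ⟨fun V => (v V).trans (v' V), fun V W f x => ?_, fun V W x => ?_⟩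
  · simp only [LinearIsometryEquiv.trans_apply, hn, hn']
  · simp only [LinearIsometryEquiv.trans_apply, ht', ht]
    generalize F.tau V W x = z
    induction z using tensor_induction with
    | zero => simp
    | tmul a b => rfl
    | add a b ha hb => simp only [_root_.map_add, ha, hb]

section expFunctor

variable {W : Inn} [FiniteDimensional ℂ W] {R : RMatrix W} {u : W ≃ₗᵢ[ℂ] F.degOne}

theorem fockUnitary_natural (hu : F.Intertwines u R) (V V' : FinInn) (f : V →ₗ[ℂ] V')
    (x : R.expDatum.obj V) :
    F.fockUnitary u hu V' (R.expDatum.map f x) = F.map f (F.fockUnitary u hu V x) :=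
  F.fock_natural u R f x

/-- The polynomial exponential functor `F^R`, where `R` is equivalent to the R-matrix of `F`. -/
def ofRMatrix (hu : F.Intertwines u R) : PolyExpFunctor where
  toExpDatum := R.expDatum
  isExponential := isExponential_of_iso (F.fockUnitary u hu) (fockUnitary_natural hu)
    (F.tau_fockUnitary u hu) (F.fock_iota u R)
  isPolynomial := isPolynomial_of_iso (F.fockUnitary u hu) (fockUnitary_natural hu)

theorem ofRMatrix_monoidallyIso (hu : F.Intertwines u R) : (ofRMatrix hu).MonoidallyIso F :=
  ⟨F.fockUnitary u hu, fockUnitary_natural hu, F.tau_fockUnitary u hu⟩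

end expFunctor

theorem intertwines_refl (F : PolyExpFunctor) :
    F.Intertwines (LinearIsometryEquiv.refl ℂ F.degOne) F.rMatrix := by
  have h : ∀ x : F.degOne.tensor F.degOne,
      tmap (LinearIsometryEquiv.refl ℂ F.degOne).toLinearEquiv.toLinearMap
        (LinearIsometryEquiv.refl ℂ F.degOne).toLinearEquiv.toLinearMap x = x := fun x =>
    LinearMap.congr_fun (tmap_id (V := F.degOne) (W := F.degOne)) x
  intro x
  rw [h, h]

/-- A monoidal isomorphism restricts to a unitary between the spaces `F_1 ℂ` and `G_1 ℂ`. -/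
theorem exists_degOne_unitary (v : ∀ V : FinInn, F.obj V ≃ₗᵢ[ℂ] G.obj V)
    (hn : ∀ (V W : FinInn) (f : V →ₗ[ℂ] W) (x : F.obj V), v W (F.map f x) = G.map f (v V x)) :
    ∃ u : F.degOne ≃ₗᵢ[ℂ] G.degOne, ∀ x, G.incl (u x) = v line (F.incl x) := by
  have hmem : ∀ x : F.degOne, v line (F.incl x) ∈ G.component 1 line := fun x l => by
    have hx : F.incl x ∈ F.component 1 line := x.2
    rw [← hn, F.map_smul_id_of_mem hx, _root_.map_smul]
  let f : F.degOne →ₗ[ℂ] G.degOne := LinearMap.codRestrict (G.component 1 line)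
    ((v line).toLinearEquiv.toLinearMap ∘ₗ F.incl.toLinearMap) hmem
  have hf : ∀ x, G.incl (f x) = v line (F.incl x) := fun _ => rfl
  refine ⟨LinearIsometryEquiv.ofSurjective ⟨f, fun x => ?_⟩ fun y => ?_, hf⟩
  · rw [← G.incl.norm_map, hf, (v line).norm_map, F.incl.norm_map]
  · have hy : G.incl y ∈ G.component 1 line := y.2
    have hy' : (v line).symm (G.incl y) ∈ F.component 1 line := fun l => by
      apply (v line).injective
      rw [hn, (v line).apply_symm_apply, G.map_smul_id_of_mem hy, _root_.map_smul,
        (v line).apply_symm_apply]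
    refine ⟨(show F.degOne from ⟨_, hy'⟩), G.incl.injective ?_⟩
    exact (hf _).trans ((v line).apply_symm_apply _)

/-- Naturality and compatibility with `τ` make the isomorphism commute with the swap unitaries on `F
ℂ ⊗ F ℂ` and `G ℂ ⊗ G ℂ`. Restricting to degree one gives the relation for two factors, which
suffices for all `n` since adjacent transpositions generate `S_n`. -/
theorem MonoidallyIso.stronglyEquivalent (h : F.MonoidallyIso G) :
    F.rMatrix.StronglyEquivalent G.rMatrix := by
  obtain ⟨v, hn, ht⟩ := h
  obtain ⟨u, hu⟩ := exists_degOne_unitary v hn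
  refine ⟨u, RMatrix.rep_naturality _ _ _ fun x => G.incl₂_injective ?_⟩
  have h1 : ∀ y, G.incl₂ (tmap u.toLinearEquiv.toLinearMap u.toLinearEquiv.toLinearMap y) =
      tcongr (v line) (v line) (F.incl₂ y) := by
    intro y
    induction y using tensor_induction with
    | zero => simp
    | tmul a b =>
      have : G.incl₂ (tmk _ _ (u a) (u b)) = tmk _ _ (G.incl (u a)) (G.incl (u b)) := rfl
      rw [hu, hu] at this
      exact this
    | add a b ha hb => simp only [_root_.map_add, ha, hb]
  have h2 : ∀ y, tcongr (v line) (v line) (F.swapUnitary line y) =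
      G.swapUnitary line (tcongr (v line) (v line) y) := by
    intro y
    obtain ⟨x, rfl⟩ := F.tau_surjective line line y
    rw [swapUnitary_tau, ← ht, hn, ← ht, swapUnitary_tau]
  have h3 := F.incl₂_rEquiv x
  have h4 := G.incl₂_rEquiv (tmap u.toLinearEquiv.toLinearMap u.toLinearEquiv.toLinearMap x)
  rw [h1]
  exact (congrArg (tcongr (v line) (v line)) h3).trans
    ((h2 _).trans ((congrArg _ (h1 x).symm).trans h4.symm))

end PolyExpFunctor

/-! ### From strong equivalence back to a monoidal isomorphism -/

namespace RMatrix

open Inn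

/-- A strong equivalence intertwines the R-matrices themselves. -/
theorem tmap_toEquiv_of_rep {W W' : Inn} {R : RMatrix W} {S : RMatrix W'} (g : W →ₗ[ℂ] W')
    (h : ∀ (σ : Equiv.Perm (Fin 2)) (x : W.tpow 2),
      tpowMap g 2 (R.rep 2 σ x) = S.rep 2 σ (tpowMap g 2 x)) (x : W.tensor W) :
    tmap g g (R.toEquiv x) = S.toEquiv (tmap g g x) := by
  have key : ∀ x : (unit.tensor W).tensor W,
      tmap (tmap LinearMap.id g) g (actLast unit R.toEquiv x) =
        actLast unit S.toEquiv (tmap (tmap LinearMap.id g) g x) := by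
    intro x
    have := h (Equiv.swap (0 : Fin 1).castSucc (0 : Fin 1).succ) x
    rw [rep_swap, rep_swap] at this
    exact this
  -- The second tensor power is bracketed as `(ℂ ⊗ W) ⊗ W`; inserting `e = 1` and removing it again
  -- gives the statement on `W ⊗ W`.
  obtain ⟨e, he⟩ : ∃ e : unit, ∀ z : W'.tensor W', tlid _ (tmk unit _ e z) = z :=
    ⟨(1 : ℂ), fun z => one_smul ℂ z⟩
  have h1 : ∀ z, tmap (tmap LinearMap.id g) g ((tassoc unit W W).symm (tmk _ _ e z)) =
      (tassoc unit W' W').symm (tmk _ _ e (tmap g g z)) := by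
    intro z
    induction z using tensor_induction with
    | zero => simp
    | tmul a b => rfl
    | add a b ha hb => simp only [_root_.map_add, ha, hb]
  have h2 := key ((tassoc unit W W).symm (tmk _ _ e x))
  rw [actLast_assoc, h1, h1, actLast_assoc] at h2
  have h3 := congrArg (tlid (W'.tensor W')) ((tassoc unit W' W').symm.injective h2)
  rwa [he, he] at h3

end RMatrix

theorem PolyExpFunctor.monoidallyIso_of_stronglyEquivalent {F G : PolyExpFunctor}
    (h : F.rMatrix.StronglyEquivalent G.rMatrix) : F.MonoidallyIso G := by
  obtain ⟨u, hu⟩ := h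
  have hG : G.Intertwines u F.rMatrix := RMatrix.tmap_toEquiv_of_rep _ (hu 2)
  -- Both isomorphisms pass through `F^R` for the R-matrix `R` of `F`. The two versions of this
  -- functor have the same data and differ only in the proofs of their axioms.
  exact (ofRMatrix_monoidallyIso F.intertwines_refl).symm.trans (ofRMatrix_monoidallyIso hG)

theorem mainTheorem2 :
    (∀ F G : PolyExpFunctor, F.MonoidallyIso G ↔ F.rMatrix.StronglyEquivalent G.rMatrix) ∧
    (∀ F : PolyExpFunctor, ∃ FR : PolyExpFunctor,
      FR.toExpDatum = F.rMatrix.expDatum ∧ F.MonoidallyIso FR) :=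
  ⟨fun _ _ => ⟨fun h => h.stronglyEquivalent, PolyExpFunctor.monoidallyIso_of_stronglyEquivalent⟩,
    fun F => ⟨PolyExpFunctor.ofRMatrix F.intertwines_refl, rfl,
      (PolyExpFunctor.ofRMatrix_monoidallyIso F.intertwines_refl).symm⟩⟩

end
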